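/- **Theorem 1.1.** Let $d\ge 1$, let $D\subset\mathbb R^d$ be a bounded open set (for instance a bounded domain with Lipschitz boundary), let $T>0$, and let $W$ be a standard real Brownian motion on a filtered probability space $(\Omega,\mathcal F,\{\mathcal F_t\}_{t\ge0},\mathbb P)$. Let $A=-\Delta$ be the Dirichlet Laplacian on $L^2(D)$, i.e. $Au=w$ iff $u\in H^1_0(D)$, $w\in L^2(D)$ and $\int_D\nabla u\cdot\nabla v=\int_D wv$ for all $v\in H^1_0(D)$. Put $\dot H^1(D)=H^1_0(D)$ and $\dot H^2(D)=\mathrm{Dom}(A)=\{u\in H^1_0(D):\Delta u\in L^2(D)\}$ with norm $\|Au\|_{L^2(D)}$. On $\tilde H=\dot H^1(D)\times L^2(D)$ let $\tilde A(u,v)=(-v,Au)$ with $\mathrm{Dom}(\tilde A)=\dot H^2(D)\times\dot H^1(D)$. For a closed operator $\mathcal A$ on a Hilbert space $H$ and a deterministic $B\in L^2([0,T];H)$, a *strong solution* of $dX=-\mathcal AX\,dt+B\,dW$, $X(0)=0$, is a measurable $H$-valued process $X$ on $[0,T]$ such that $X(t)\in \mathrm{Dom}(\mathcal A)$ for $dt\otimes\mathbb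 P$-almost every $(t,\omega)$, $\int_0^T\|\mathcal AX(s)\|\,ds<\infty$ a.s., and for every $t\in[0,T]$, almost surely, $$X(t)=-\int_0^t\mathcal AX(s)\,ds+\int_0^tB(s)\,dW(s).$$ Assume $f\in L^2([0,T])$ and $g\in\dot H^1(D)$. Consider $$\partial_t^m u-\Delta u=g(x)f(t)\dot W(t)\ \text{ in } D\times(0,T],\qquad u=0\ \text{ on }\partial D\times[0,T],\qquad u(\cdot,0)=0,\quad \partial_tu(\cdot,0)=0\ (\text{if } m=2),$$ understood, for $m=1$, as $du=-Au\,dt+fg\,dW$ in $L^2(D)$, and, for $m=2$, as $dX=-\tilde AX\,dt+(0,fg)\,dW$ in $\tilde H$ with $X=(u,\partial_tu)$. Then, for $m=1$ and for $m=2$: 1. There is a strong solution, and it can be taken adapted to $\{\mathcal F_t\}$ up to null sets. 2. The strong solution is unique: any two strong solutions agree almost surely at each $t\in[0,T]$. 3. The strong solution satisfies $u\in L^2([0,T];\dot H^2(D))$ almost surely. For $m=2$, moreover, $X(t)\in\mathrm{Dom}(\tilde A)$ almost surely for every $t\in[0,T]$. -/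

import Mathlib

open MeasureTheory ProbabilityTheory Filter Topology Set
open scoped NNReal ENNReal InnerProductSpace

noncomputable section

/-! ### Function spaces on an open set `D ⊆ ℝ^d` -/

/-- The real Hilbert space `L²(D)`. -/
abbrev L2 {d : ℕ} (D : TopologicalSpace.Opens (EuclideanSpace ℝ (Fin d))) : Type :=
  Lp ℝ 2 ((volume : Measure (EuclideanSpace ℝ (Fin d))).restrict D)

/-- The real Hilbert space `L²(D; ℝ^d)` of square integrable vector fields. -/
abbrev L2Vec {d : ℕ} (D : TopologicalSpace.Opens (EuclideanSpace ℝ (Fin d))) : Type :=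
  Lp (EuclideanSpace ℝ (Fin d)) 2 ((volume : Measure (EuclideanSpace ℝ (Fin d))).restrict D)

/-- Test functions on `D`: smooth real functions with compact support contained in `D`. -/
def IsTestFunction {d : ℕ} (D : TopologicalSpace.Opens (EuclideanSpace ℝ (Fin d)))
    (φ : EuclideanSpace ℝ (Fin d) → ℝ) : Prop :=
  ContDiff ℝ (⊤ : ℕ∞) φ ∧ HasCompactSupport φ ∧ tsupport φ ⊆ D

/-- The pairs `(φ, ∇φ)`, `φ` a test function, in `L²(D) × L²(D; ℝ^d)`. -/
def testPairs {d : ℕ} (D : TopologicalSpace.Opens (EuclideanSpace ℝ (Fin d))) :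
    Set (WithLp 2 (L2 D × L2Vec D)) :=
  {x | ∃ φ, IsTestFunction D φ ∧
    x.fst =ᵐ[(volume : Measure (EuclideanSpace ℝ (Fin d))).restrict D] φ ∧
    x.snd =ᵐ[(volume : Measure (EuclideanSpace ℝ (Fin d))).restrict D] gradient φ}

/-- The Sobolev space `H¹₀(D)`, the closure of the test functions in the `H¹` norm. A function `u`
of `H¹₀(D)` is represented by the pair `(u, ∇u)`, so that the norm inherited from
`L²(D) × L²(D; ℝ^d)` is the `H¹` norm. The pair is determined by `u`, see `H10.toL2_injective`. -/
def H10 {d : ℕ} (D : TopologicalSpace.Opens (EuclideanSpace ℝ (Fin d))) :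
    Submodule ℝ (WithLp 2 (L2 D × L2Vec D)) :=
  (Submodule.span ℝ (testPairs D)).topologicalClosure

/-- The inclusion `H¹₀(D) → L²(D)`. -/
def H10.toL2 {d : ℕ} {D : TopologicalSpace.Opens (EuclideanSpace ℝ (Fin d))} :
    H10 D →L[ℝ] L2 D :=
  (WithLp.fstL 2 ℝ (L2 D) (L2Vec D)).comp (H10 D).subtypeL

/-- The weak gradient `H¹₀(D) → L²(D; ℝ^d)`. -/
def H10.grad {d : ℕ} {D : TopologicalSpace.Opens (EuclideanSpace ℝ (Fin d))} :
    H10 D →L[ℝ] L2Vec D :=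
  (WithLp.sndL 2 ℝ (L2 D) (L2Vec D)).comp (H10 D).subtypeL

/-- Every test function, with its gradient, is an element of `H¹₀(D)`. -/
theorem IsTestFunction.exists_H10 {d : ℕ}
    {D : TopologicalSpace.Opens (EuclideanSpace ℝ (Fin d))}
    {φ : EuclideanSpace ℝ (Fin d) → ℝ} (hφ : IsTestFunction D φ) :
    ∃ v : H10 D,
      H10.toL2 v =ᵐ[(volume : Measure (EuclideanSpace ℝ (Fin d))).restrict D] φ ∧
      H10.grad v =ᵐ[(volume : Measure (EuclideanSpace ℝ (Fin d))).restrict D] gradient φ := by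
  obtain ⟨h1, h2, h3⟩ := hφ
  have m1 : MemLp φ 2 ((volume : Measure (EuclideanSpace ℝ (Fin d))).restrict D) :=
    (h1.continuous.memLp_of_hasCompactSupport h2).restrict _
  have hg : gradient φ = fun x => (InnerProductSpace.toDual ℝ _).symm (fderiv ℝ φ x) := rfl
  have c2 : Continuous (gradient φ) := by
    rw [hg]
    exact (LinearIsometryEquiv.continuous _).comp (h1.continuous_fderiv (by simp))
  have s2 : HasCompactSupport (gradient φ) := by
    rw [hg]
    exact (h2.fderiv ℝ).comp_left (g := (InnerProductSpace.toDual ℝ _).symm) (by simp)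
  have m2 : MemLp (gradient φ) 2 ((volume : Measure (EuclideanSpace ℝ (Fin d))).restrict D) :=
    (c2.memLp_of_hasCompactSupport s2).restrict _
  refine ⟨⟨WithLp.toLp 2 (m1.toLp φ, m2.toLp _), ?_⟩, ?_, ?_⟩
  · apply Submodule.le_topologicalClosure
    apply Submodule.subset_span
    exact ⟨φ, ⟨h1, h2, h3⟩, m1.coeFn_toLp, m2.coeFn_toLp⟩
  · exact m1.coeFn_toLp
  · exact m2.coeFn_toLp

/-- A square integrable function on `D` that is orthogonal to all test functions vanishes. -/
theorem ae_eq_zero_of_forall_test {d : ℕ}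
    {D : TopologicalSpace.Opens (EuclideanSpace ℝ (Fin d))} {w : EuclideanSpace ℝ (Fin d) → ℝ}
    (hw : MemLp w 2 ((volume : Measure (EuclideanSpace ℝ (Fin d))).restrict D))
    (h : ∀ φ, IsTestFunction D φ → ∫ x in (D : Set (EuclideanSpace ℝ (Fin d))), φ x * w x = 0) :
    w =ᵐ[(volume : Measure (EuclideanSpace ℝ (Fin d))).restrict D] 0 := by
  have hl : LocallyIntegrable w ((volume : Measure (EuclideanSpace ℝ (Fin d))).restrict D) :=
    hw.locallyIntegrable (by norm_num)
  have h0 := D.isOpen.ae_eq_zero_of_integral_contDiff_smul_eq_zero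
    (μ := (volume : Measure (EuclideanSpace ℝ (Fin d))).restrict D)
    (hl.locallyIntegrableOn _) (fun φ h1 h2 h3 => by simpa using h φ ⟨h1, h2, h3⟩)
  filter_upwards [h0, ae_restrict_mem D.isOpen.measurableSet] with x hx hxD
  exact hx hxD

/-- An element of `L²(D)` that is orthogonal to all test functions vanishes. -/
theorem L2.eq_zero_of_forall_test {d : ℕ}
    {D : TopologicalSpace.Opens (EuclideanSpace ℝ (Fin d))} (w : L2 D)
    (h : ∀ φ, IsTestFunction D φ → ∫ x in (D : Set (EuclideanSpace ℝ (Fin d))), φ x * w x = 0) :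
    w = 0 :=
  Lp.eq_zero_iff_ae_eq_zero.2 (ae_eq_zero_of_forall_test (Lp.memLp w) h)

/-- Integration by parts: `H10.grad u` is the weak gradient of `u`. -/
theorem H10.integral_by_parts {d : ℕ} {D : TopologicalSpace.Opens (EuclideanSpace ℝ (Fin d))}
    (u : H10 D) {φ : EuclideanSpace ℝ (Fin d) → ℝ} (hφ : IsTestFunction D φ) (i : Fin d) :
    ∫ x in (D : Set (EuclideanSpace ℝ (Fin d))), φ x * H10.grad u x i =
      -∫ x in (D : Set (EuclideanSpace ℝ (Fin d))),
        fderiv ℝ φ x (EuclideanSpace.single i 1) * H10.toL2 u x := by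
  obtain ⟨h1, h2, h3⟩ := hφ
  set e : EuclideanSpace ℝ (Fin d) := EuclideanSpace.single i 1 with he
  set μ := (volume : Measure (EuclideanSpace ℝ (Fin d))).restrict D with hμ
  have cd : Continuous (fun x => fderiv ℝ φ x e) :=
    (h1.continuous_fderiv (by simp)).clm_apply continuous_const
  have sd : HasCompactSupport (fun x => fderiv ℝ φ x e) := h2.fderiv_apply ℝ e
  have m1 : MemLp (fun x => φ x • e) 2 μ :=
    ((h1.continuous.smul continuous_const).memLp_of_hasCompactSupport h2.smul_right).restrict _
  have m2 : MemLp (fun x => fderiv ℝ φ x e) 2 μ := (cd.memLp_of_hasCompactSupport sd).restrict _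
  let Λ : WithLp 2 (L2 D × L2Vec D) →L[ℝ] ℝ :=
    (innerSL ℝ (m1.toLp _)).comp (WithLp.sndL 2 ℝ (L2 D) (L2Vec D)) +
      (innerSL ℝ (m2.toLp _)).comp (WithLp.fstL 2 ℝ (L2 D) (L2Vec D))
  have hΛ : ∀ x, Λ x = (∫ y, φ y * x.snd y i ∂μ) + ∫ y, fderiv ℝ φ y e * x.fst y ∂μ := by
    intro x
    have i1 : ⟪m1.toLp _, x.snd⟫_ℝ = ∫ y, φ y * x.snd y i ∂μ := by
      rw [L2.inner_def]
      refine integral_congr_ae ?_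
      filter_upwards [m1.coeFn_toLp] with y hy
      rw [hy, he, inner_smul_left, EuclideanSpace.inner_single_left]
      simp
    have i2 : ⟪m2.toLp _, x.fst⟫_ℝ = ∫ y, fderiv ℝ φ y e * x.fst y ∂μ := by
      rw [L2.inner_def]
      refine integral_congr_ae ?_
      filter_upwards [m2.coeFn_toLp] with y hy
      simp [hy, mul_comm]
    rw [← i1, ← i2]
    rfl
  have hle : H10 D ≤ LinearMap.ker (Λ : WithLp 2 (L2 D × L2Vec D) →ₗ[ℝ] ℝ) := by
    refine Submodule.topologicalClosure_minimal _ ?_ Λ.isClosed_ker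
    rw [Submodule.span_le]
    rintro x ⟨ψ, ⟨g1, g2, g3⟩, hx1, hx2⟩
    change Λ x = 0
    have k1 : ∫ y, φ y * x.snd y i ∂μ = ∫ y, φ y * fderiv ℝ ψ y e := by
      rw [← setIntegral_eq_integral_of_forall_compl_eq_zero
        (f := fun y => φ y * fderiv ℝ ψ y e) (s := (D : Set (EuclideanSpace ℝ (Fin d))))
        (fun y hy => by simp [image_eq_zero_of_notMem_tsupport (fun h => hy (h3 h))])]
      refine integral_congr_ae ?_
      filter_upwards [hx2] with y hy
      have hyi : gradient ψ y i = fderiv ℝ ψ y e := by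
        have := EuclideanSpace.inner_single_right (𝕜 := ℝ) i 1 (gradient ψ y)
        rw [gradient, InnerProductSpace.toDual_symm_apply] at this
        simpa [he, gradient] using this.symm
      rw [hy, hyi]
    have k2 : ∫ y, fderiv ℝ φ y e * x.fst y ∂μ = ∫ y, fderiv ℝ φ y e * ψ y := by
      rw [← setIntegral_eq_integral_of_forall_compl_eq_zero
        (f := fun y => fderiv ℝ φ y e * ψ y) (s := (D : Set (EuclideanSpace ℝ (Fin d))))
        (fun y hy => by simp [image_eq_zero_of_notMem_tsupport (fun h => hy (g3 h))])]
      refine integral_congr_ae ?_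
      filter_upwards [hx1] with y hy
      rw [hy]
    have cψ : Continuous (fun x => fderiv ℝ ψ x e) :=
      (g1.continuous_fderiv (by simp)).clm_apply continuous_const
    rw [hΛ, k1, k2, integral_mul_fderiv_eq_neg_fderiv_mul_of_integrable, neg_add_cancel]
    · exact (cd.mul g1.continuous).integrable_of_hasCompactSupport sd.mul_right
    · exact (h1.continuous.mul cψ).integrable_of_hasCompactSupport h2.mul_right
    · exact (h1.continuous.mul g1.continuous).integrable_of_hasCompactSupport h2.mul_right
    · exact fun x _ => (h1.differentiable (by simp)) x
    · exact fun x _ => (g1.differentiable (by simp)) x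
  have hu : Λ (u : WithLp 2 (L2 D × L2Vec D)) = 0 := hle u.2
  rw [hΛ] at hu
  exact eq_neg_of_add_eq_zero_left hu

/-- A function of `H¹₀(D)` is determined by its class in `L²(D)`. -/
theorem H10.toL2_injective {d : ℕ} {D : TopologicalSpace.Opens (EuclideanSpace ℝ (Fin d))} :
    Function.Injective (H10.toL2 (D := D)) := by
  rw [injective_iff_map_eq_zero]
  intro u hu
  have hg : H10.grad u = 0 := by
    rw [Lp.eq_zero_iff_ae_eq_zero]
    have key : ∀ i : Fin d, (fun x => H10.grad u x i)
        =ᵐ[(volume : Measure (EuclideanSpace ℝ (Fin d))).restrict D] 0 := by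
      intro i
      refine ae_eq_zero_of_forall_test ?_ ?_
      · exact (EuclideanSpace.proj i : EuclideanSpace ℝ (Fin d) →L[ℝ] ℝ).comp_memLp' (Lp.memLp _)
      · intro φ hφ
        rw [H10.integral_by_parts u hφ i, hu, neg_eq_zero]
        refine integral_eq_zero_of_ae ?_
        filter_upwards [Lp.coeFn_zero ℝ 2
          ((volume : Measure (EuclideanSpace ℝ (Fin d))).restrict D)] with x hx
        rw [hx]
        simp
    filter_upwards [ae_all_iff.2 key] with x hx
    ext i
    simpa using hx i
  apply Subtype.ext
  exact (WithLp.equiv 2 _).injective (Prod.ext hu hg)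

/-! ### The Dirichlet Laplacian -/

/-- The graph of `-Δ` with homogeneous Dirichlet boundary condition: the pairs `(u, w)` such that
`u ∈ H¹₀(D)`, `w ∈ L²(D)` and `∫ ∇u · ∇v = ∫ w v` for all `v ∈ H¹₀(D)`. -/
def negLaplacianGraph {d : ℕ} (D : TopologicalSpace.Opens (EuclideanSpace ℝ (Fin d))) :
    Submodule ℝ (L2 D × L2 D) where
  carrier := {x | ∃ u : H10 D, H10.toL2 u = x.1 ∧
    ∀ v : H10 D, ⟪H10.grad u, H10.grad v⟫_ℝ = ⟪x.2, H10.toL2 v⟫_ℝ}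
  add_mem' := by
    rintro x y ⟨u, hu, hu'⟩ ⟨v, hv, hv'⟩
    exact ⟨u + v, by simp [hu, hv], fun z => by simp [inner_add_left, hu', hv']⟩
  zero_mem' := ⟨0, by simp, fun z => by simp⟩
  smul_mem' := by
    rintro c x ⟨u, hu, hu'⟩
    exact ⟨c • u, by simp [hu], fun z => by simp [inner_smul_left, hu']⟩

/-- The operator `A = -Δ` on `L²(D)` with homogeneous Dirichlet boundary condition, with domain
`{u ∈ H¹₀(D) : Δu ∈ L²(D)}`. Its graph is `negLaplacianGraph D`, see `negLaplacian_graph`. -/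
def negLaplacian {d : ℕ} (D : TopologicalSpace.Opens (EuclideanSpace ℝ (Fin d))) :
    L2 D →ₗ.[ℝ] L2 D :=
  (negLaplacianGraph D).toLinearPMap

theorem negLaplacian_graph {d : ℕ} (D : TopologicalSpace.Opens (EuclideanSpace ℝ (Fin d))) :
    (negLaplacian D).graph = negLaplacianGraph D := by
  apply Submodule.toLinearPMap_graph_eq
  rintro ⟨a, w⟩ ⟨u, hu, h⟩ (h0 : a = 0)
  have hu0 : u = 0 := H10.toL2_injective (by simpa [h0] using hu)
  subst hu0
  apply L2.eq_zero_of_forall_test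
  intro φ hφ
  obtain ⟨v, hv, -⟩ := hφ.exists_H10
  have := h v
  simp only [map_zero, inner_zero_left, L2.inner_def] at this
  rw [this]
  refine integral_congr_ae ?_
  filter_upwards [hv] with x hx
  simp [hx]

/-! ### The first order form of the wave equation -/

/-- The Hilbert space `H¹₀(D) × L²(D)` of the pairs `(u, ∂ₜu)`. -/
abbrev WaveSpace {d : ℕ} (D : TopologicalSpace.Opens (EuclideanSpace ℝ (Fin d))) : Type :=
  WithLp 2 (H10 D × L2 D)

/-- The graph of the wave operator: the pairs `((u, v), (-v, -Δu))` with `u` in the domain of `-Δ`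
and `v ∈ H¹₀(D)`. -/
def waveGraph {d : ℕ} (D : TopologicalSpace.Opens (EuclideanSpace ℝ (Fin d))) :
    Submodule ℝ (WaveSpace D × WaveSpace D) where
  carrier := {x | H10.toL2 x.2.fst = -x.1.snd ∧
    (H10.toL2 x.1.fst, x.2.snd) ∈ (negLaplacian D).graph}
  add_mem' := by
    rintro x y ⟨hx, hx'⟩ ⟨hy, hy'⟩
    refine ⟨by simp [hx, hy]; abel, ?_⟩
    simpa using add_mem hx' hy'
  zero_mem' := ⟨by simp, by simp⟩
  smul_mem' := by
    rintro c x ⟨hx, hx'⟩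
    refine ⟨by simp [hx], ?_⟩
    simpa using (negLaplacian D).graph.smul_mem c hx'

/-- The wave operator `(u, v) ↦ (-v, -Δu)` on `H¹₀(D) × L²(D)`, with domain
`Dom(-Δ) × H¹₀(D)`. Its graph is `waveGraph D`, see `waveOperator_graph`. -/
def waveOperator {d : ℕ} (D : TopologicalSpace.Opens (EuclideanSpace ℝ (Fin d))) :
    WaveSpace D →ₗ.[ℝ] WaveSpace D :=
  (waveGraph D).toLinearPMap

theorem waveOperator_graph {d : ℕ} (D : TopologicalSpace.Opens (EuclideanSpace ℝ (Fin d))) :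
    (waveOperator D).graph = waveGraph D := by
  apply Submodule.toLinearPMap_graph_eq
  rintro ⟨a, b⟩ ⟨h1, h2⟩ (h0 : a = 0)
  subst h0
  have e1 : b.fst = 0 := H10.toL2_injective (by simpa using h1)
  have e2 : b.snd = 0 := by
    have h2' : ((0 : L2 D), b.snd) ∈ (negLaplacian D).graph := by simpa using h2
    exact (negLaplacian D).graph_fst_eq_zero_snd h2' rfl
  exact (WithLp.equiv 2 _).injective (Prod.ext e1 e2)

/-! ### Brownian motion and the stochastic integral of deterministic functions -/

/-- `W` is a standard real Brownian motion on the filtered probability space `(Ω, ℱ, P)`: it is a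
Brownian motion, adapted to `ℱ`, and `W t - W s` is independent of `ℱ s` for `s ≤ t`. -/
structure IsBrownianMotionFor {Ω : Type*} {mΩ : MeasurableSpace Ω} (ℱ : Filtration ℝ≥0 mΩ)
    (W : ℝ≥0 → Ω → ℝ) (P : Measure Ω) : Prop where
  isBrownian : IsBrownianReal W P
  adapted : Adapted ℱ W
  indep : ∀ s t : ℝ≥0, s ≤ t →
    Indep (MeasurableSpace.comap (fun ω => W t ω - W s ω) inferInstance) (ℱ s) P

/-- A deterministic `H`-valued step function `∑ i < n, value i · 1_{(time i, time (i+1)]}`. -/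
structure StepFunction (H : Type*) where
  n : ℕ
  time : ℕ → ℝ≥0
  time_mono : Monotone time
  value : ℕ → H

/-- The value of a step function at time `s`. -/
def StepFunction.eval {H : Type*} [AddCommMonoid H] (b : StepFunction H) (s : ℝ) : H :=
  ∑ i ∈ Finset.range b.n,
    (Ioc (b.time i : ℝ) (b.time (i + 1))).indicator (fun _ => b.value i) s

/-- The elementary integral `∫₀ᵗ b(s) dW(s)` of a step function `b`. -/
def StepFunction.integral {H : Type*} [AddCommMonoid H] [Module ℝ H] {Ω : Type*}
    (b : StepFunction H) (W : ℝ≥0 → Ω → ℝ) (t : ℝ≥0) (ω : Ω) : H :=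
  ∑ i ∈ Finset.range b.n,
    (W (min (b.time (i + 1)) t) ω - W (min (b.time i) t) ω) • b.value i

/-- `I` is (a version of) the stochastic integral `∫₀ᵗ B(s) dW(s)` of the deterministic function
`B ∈ L²([0,t]; H)`: the limit in `L²(Ω; H)` of the elementary integrals of step functions that
converge to `B` in `L²([0,t]; H)`. -/
def IsStochasticIntegral {H : Type*} [NormedAddCommGroup H] [InnerProductSpace ℝ H]
    {Ω : Type*} {mΩ : MeasurableSpace Ω} (W : ℝ≥0 → Ω → ℝ) (P : Measure Ω)
    (B : ℝ → H) (t : ℝ≥0) (I : Ω → H) : Prop :=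
  MemLp B 2 (volume.restrict (Icc (0 : ℝ) t)) ∧ MemLp I 2 P ∧
  ∃ b : ℕ → StepFunction H,
    Tendsto (fun k => eLpNorm (fun s => (b k).eval s - B s) 2 (volume.restrict (Icc (0 : ℝ) t)))
      atTop (𝓝 0) ∧
    Tendsto (fun k => eLpNorm (fun ω => (b k).integral W t ω - I ω) 2 P) atTop (𝓝 0)

/-! ### Strong solutions -/

/-- `X` is a strong solution on `[0,T]` of `dX = -A X dt + B dW`, `X(0) = 0`: a measurable process
that takes values in the domain of `A` for `dt ⊗ P`-almost every `(t, ω)`, such that almost every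
path of `A X` is Bochner integrable on `[0,T]`, and, for every `t ∈ [0,T]`, almost surely
`X(t) = -∫₀ᵗ A X(s) ds + ∫₀ᵗ B(s) dW(s)`. The process `Y` is `A X`. -/
def IsStrongSolution {H : Type*} [NormedAddCommGroup H] [InnerProductSpace ℝ H]
    {Ω : Type*} {mΩ : MeasurableSpace Ω} (A : H →ₗ.[ℝ] H) (B : ℝ → H)
    (W : ℝ≥0 → Ω → ℝ) (P : Measure Ω) (T : ℝ) (X : ℝ → Ω → H) : Prop :=
  AEStronglyMeasurable (fun p : ℝ × Ω => X p.1 p.2) ((volume.restrict (Icc 0 T)).prod P) ∧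
  ∃ Y : ℝ → Ω → H,
    AEStronglyMeasurable (fun p : ℝ × Ω => Y p.1 p.2) ((volume.restrict (Icc 0 T)).prod P) ∧
    (∀ᵐ p ∂((volume.restrict (Icc 0 T)).prod P), (X p.1 p.2, Y p.1 p.2) ∈ A.graph) ∧
    (∀ᵐ ω ∂P, IntegrableOn (fun s => Y s ω) (Icc 0 T)) ∧
    ∀ t : ℝ≥0, (t : ℝ) ≤ T → ∃ I : Ω → H, IsStochasticIntegral W P B t I ∧
      ∀ᵐ ω ∂P, X t ω = -(∫ s in (0 : ℝ)..t, Y s ω) + I ω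

/-- The process `X` is adapted on `[0,T]`. The filtration need not be complete, so measurability
is required up to null sets. -/
def IsAdaptedOn {H : Type*} [TopologicalSpace H] {Ω : Type*} {mΩ : MeasurableSpace Ω}
    (ℱ : Filtration ℝ≥0 mΩ) (P : Measure Ω) (T : ℝ) (X : ℝ → Ω → H) : Prop :=
  ∀ t : ℝ≥0, (t : ℝ) ≤ T → AEStronglyMeasurable[ℱ t] (X t) P

/-- The processes `X` and `X'` are versions of each other on `[0,T]`. -/
def AreVersionsOn {H : Type*} {Ω : Type*} {mΩ : MeasurableSpace Ω} (P : Measure Ω) (T : ℝ)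
    (X X' : ℝ → Ω → H) : Prop :=
  ∀ t ∈ Icc 0 T, ∀ᵐ ω ∂P, X t ω = X' t ω

/-- The path `x` belongs to `L²([0,T]; Dom(A))`, `Dom(A)` with the graph norm. -/
def MemL2Dom {H : Type*} [NormedAddCommGroup H] [InnerProductSpace ℝ H]
    (A : H →ₗ.[ℝ] H) (T : ℝ) (x : ℝ → H) : Prop :=
  MemLp x 2 (volume.restrict (Icc 0 T)) ∧
  ∃ y : ℝ → H, MemLp y 2 (volume.restrict (Icc 0 T)) ∧
    ∀ᵐ t ∂(volume.restrict (Icc 0 T)), (x t, y t) ∈ A.graph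

end

/-! ### Isometric extension and density -/

/-! The noise moves along one fixed vector `b`, equal to `g` for the heat equation and `(0, g)` for
the wave equation. With `v(t) = exp(-tA) b` and `w = A v`, the candidate solution is the stochastic
convolution `X(t) = ∫₀ᵗ f(s) v(t - s) dW(s)`, and `A X(t)` should be `∫₀ᵗ f(s) w(t - s) dW(s)`. A
stochastic Fubini argument integrates the latter over `[0,t]`: since `∫ₛᵗ w(r - s) dr = b - v(t -
s)`, the result is `∫₀ᵗ f b dW - X(t)`, which is the equation. All that is needed of the orbit is
that `v` is bounded and `w` is square integrable on `[0,T]`.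

The integrands are deterministic, so the stochastic analysis is Hilbert space geometry. The Wiener
integral is the isometry from `L²([0,T]; H)` to `L²(Ω; H)` fixed by its values on intervals starting
at 0. Applying it in the second variable of a kernel (`liftProd`) gives a jointly measurable
process, and `setIntegral_liftProd` is the Fubini theorem for it. Unboundedness of `A` is harmless
because membership in its graph is an equation `R (c • x + y) = x` with `R` bounded
(`IsMaxAccretive.exists_mem_iff_of_shift`), and bounded operators commute with Bochner and Wiener
integrals.

Orbits come from the Yosida approximations of a maximal accretive graph. For the wave operator,
which is accretive after adding the identity, `b` lies in the domain and `w` is bounded on `[0,T]`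
(`IsMaxAccretive.exists_orbit`); this is why `X(t)` is in the domain at every time. For the
Laplacian, `g` lies only in the form domain, and the energy identity for symmetric operators bounds
`w` in `L²` (`IsMaxAccretive.exists_orbit_of_symm`).

Uniqueness is pathwise: the noise cancels in the difference of two solutions, and the time integral
of that difference solves `z' = -A z`, `z(0) = 0`, to which an energy estimate applies
(`IsMaxAccretive.eq_zero_of_integral`). -/

theorem exists_linearIsometry_of_inner_eq {ι E F : Type*} [NormedAddCommGroup E]
    [InnerProductSpace ℝ E] [NormedAddCommGroup F] [InnerProductSpace ℝ F] [CompleteSpace F]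
    (e : ι → E) (f : ι → F) (hef : ∀ i j, ⟪e i, e j⟫_ℝ = ⟪f i, f j⟫_ℝ)
    (he : (Submodule.span ℝ (range e)).topologicalClosure = ⊤) :
    ∃ L : E →ₗᵢ[ℝ] F, ∀ i, L (e i) = f i := by
  set le := Finsupp.linearCombination ℝ e with hle
  set lf := Finsupp.linearCombination ℝ f with hlf
  -- Equal Gram matrices give equal norms of all linear combinations, so `e i ↦ f i` is well defined
  -- and isometric on the span.
  have hnorm : ∀ x, ‖lf x‖ = ‖le x‖ := by
    intro x
    have h2 : ‖lf x‖ ^ 2 = ‖le x‖ ^ 2 := by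
      rw [← real_inner_self_eq_norm_sq, ← real_inner_self_eq_norm_sq]
      simp only [hle, hlf, Finsupp.linearCombination_apply, Finsupp.sum, inner_sum, sum_inner, inner_smul_left, inner_smul_right, hef]
    exact (sq_eq_sq₀ (norm_nonneg _) (norm_nonneg _)).1 h2
  have hd : DenseRange le := by
    have : Dense ((Submodule.span ℝ (range e) : Submodule ℝ E) : Set E) :=
      Submodule.dense_iff_topologicalClosure_eq_top.2 he
    rw [← Finsupp.range_linearCombination] at this
    exact this
  have hb : ∀ x, lf.extendOfNorm le (le x) = lf x := fun x =>
    LinearMap.extendOfNorm_eq hd ⟨1, fun x => by rw [one_mul, hnorm]⟩ x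
  refine ⟨⟨(lf.extendOfNorm le : E →ₗ[ℝ] F), ?_⟩, fun i => ?_⟩
  · intro x
    refine hd.induction_on (p := fun x => ‖lf.extendOfNorm le x‖ = ‖x‖) x
      (isClosed_eq (by fun_prop) (by fun_prop)) fun y => ?_
    rw [hb, hnorm]
  · have := hb (Finsupp.single i 1)
    simpa [hle, hlf] using this

/-- Because the total integral vanishes, the sets on which the integral is zero form a λ-system, so
Dynkin's theorem applies. -/
theorem ae_eq_zero_of_setIntegral_piSystem {α E : Type*} [NormedAddCommGroup E] [NormedSpace ℝ E]
    [CompleteSpace E] {m : MeasurableSpace α} {μ : Measure α} [IsFiniteMeasure μ]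
    {C : Set (Set α)} (hgen : m = MeasurableSpace.generateFrom C) (hpi : IsPiSystem C)
    {φ : α → E} (hφ : Integrable φ μ) (huniv : ∫ x, φ x ∂μ = 0)
    (h : ∀ s ∈ C, ∫ x in s, φ x ∂μ = 0) : φ =ᵐ[μ] 0 := by
  have key : ∀ s, MeasurableSet s → ∫ x in s, φ x ∂μ = 0 := by
    refine MeasurableSpace.induction_on_inter (C := fun s _ => ∫ x in s, φ x ∂μ = 0)
      hgen hpi (by simp) h ?_ ?_
    · intro t ht h0
      have := integral_add_compl ht hφ
      rw [h0, huniv, zero_add] at this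
      exact this
    · intro f hd hm h0
      rw [integral_iUnion hm hd hφ.integrableOn]
      simp [h0]
  exact hφ.ae_eq_zero_of_forall_setIntegral_eq_zero fun s hs _ => key s hs

/-- Pairing with `1_{s i} v` for all `v` computes the integral over `s i`, so the hypothesis says
exactly that nothing nonzero is orthogonal to the span. It serves for time intervals and for
measurable rectangles. -/
theorem span_indicatorConstLp_dense {α E ι : Type*} [NormedAddCommGroup E]
    [InnerProductSpace ℝ E] [CompleteSpace E] {m : MeasurableSpace α} {μ : Measure α}
    [IsFiniteMeasure μ] {s : ι → Set α} (hs : ∀ i, MeasurableSet (s i))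
    (h : ∀ φ : α → E, Integrable φ μ → (∀ i, ∫ x in s i, φ x ∂μ = 0) → φ =ᵐ[μ] 0) :
    (Submodule.span ℝ (range fun p : ι × E =>
      indicatorConstLp 2 (hs p.1) (measure_ne_top μ _) p.2)).topologicalClosure = ⊤ := by
  rw [Submodule.topologicalClosure_eq_top_iff, Submodule.eq_bot_iff]
  intro φ hφ
  rw [Submodule.mem_orthogonal] at hφ
  rw [Lp.eq_zero_iff_ae_eq_zero]
  refine h _ ((Lp.memLp φ).integrable (by norm_num)) fun i => ?_
  refine ext_inner_left ℝ fun v => ?_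
  rw [inner_zero_right, ← L2.inner_indicatorConstLp_eq_inner_setIntegral ℝ (hs i)
    (measure_ne_top μ _)]
  exact hφ _ (Submodule.subset_span ⟨(i, v), rfl⟩)

/-! ### The Wiener integral -/

/-- Lebesgue measure on the time interval `[0,T]`. -/
noncomputable abbrev timeMeasure (T : ℝ≥0) : Measure ℝ := volume.restrict (Icc 0 (T : ℝ))

theorem ae_eq_zero_of_setIntegral_Ioc {E : Type*} [NormedAddCommGroup E] [NormedSpace ℝ E]
    [CompleteSpace E] {T : ℝ≥0} {φ : ℝ → E} (hφ : Integrable φ (timeMeasure T))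
    (h : ∀ a : ℝ≥0, ∫ x in Ioc 0 (a : ℝ), φ x ∂(timeMeasure T) = 0) :
    φ =ᵐ[timeMeasure T] 0 := by
  -- Within `[0,T]` the interval `(0,a]` differs from the half-line `(-∞,a]` by the null set `{0}`;
  -- the half-lines are a generating π-system.
  have hz : ∀ (a : ℝ), ∫ x in Iic a, φ x ∂(timeMeasure T) = 0 := by
    intro a
    rcases le_or_gt 0 a with ha | ha
    · lift a to ℝ≥0 using ha
      rw [← h a]
      refine setIntegral_congr_set ?_
      have h0 : ∀ᵐ x ∂(volume : Measure ℝ), x ≠ 0 := by simp [ae_iff]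
      filter_upwards [ae_restrict_mem measurableSet_Icc, ae_restrict_of_ae h0] with x hx hx0
      have hx' : 0 < x := lt_of_le_of_ne hx.1 (Ne.symm hx0)
      exact propext ⟨fun hxa => ⟨hx', hxa⟩, fun hxa => hxa.2⟩
    · have : (timeMeasure T).restrict (Iic a) = 0 := by
        rw [Measure.restrict_restrict measurableSet_Iic, Measure.restrict_eq_zero]
        have : Iic a ∩ Icc 0 (T : ℝ) = ∅ := by
          ext x; simp only [mem_inter_iff, mem_Iic, mem_Icc, mem_empty_iff_false, iff_false]
          intro hx; linarith [hx.1, hx.2.1]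
        simp [this]
      rw [this, integral_zero_measure]
  refine ae_eq_zero_of_setIntegral_piSystem (borel_eq_generateFrom_Iic ℝ ▸ BorelSpace.measurable_eq)
    isPiSystem_Iic hφ ?_ ?_
  · rw [← hz T]
    refine (setIntegral_eq_integral_of_ae_compl_eq_zero ?_).symm
    filter_upwards [ae_restrict_mem measurableSet_Icc] with x hx hx'
    exact absurd hx.2 hx'
  · rintro _ ⟨a, rfl⟩
    exact hz a

section Wiener

variable {Ω : Type*} {mΩ : MeasurableSpace Ω} {P : Measure Ω} {W : ℝ≥0 → Ω → ℝ}

theorem brownian_memLp (hW : IsPreBrownianReal W P) (t : ℝ≥0) : MemLp (W t) 2 P :=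
  (hW.isGaussianProcess.hasGaussianLaw_eval t).memLp_two

theorem brownian_integral_mul (hW : IsPreBrownianReal W P) [IsProbabilityMeasure P] (s t : ℝ≥0) :
    ∫ ω, W s ω * W t ω ∂P = min s t := by
  have := hW.covariance_eval s t
  rw [covariance_eq_sub (brownian_memLp hW s) (brownian_memLp hW t), hW.integral_eval] at this
  simpa using this

theorem brownian_smul_memLp {H : Type*} [NormedAddCommGroup H] [InnerProductSpace ℝ H]
    (hW : IsPreBrownianReal W P) (t : ℝ≥0) (h : H) :
    MemLp (fun ω => W t ω • h) 2 P :=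
  (ContinuousLinearMap.toSpanSingleton ℝ h).comp_memLp' (brownian_memLp hW t)

variable {H : Type*} [NormedAddCommGroup H] [InnerProductSpace ℝ H] [CompleteSpace H]

/-- The Itô isometry is needed only on generators: `(0,a]` and `(0,c]` overlap within `[0,T]` in
length `min(a,c,T)`, which is the covariance of `W` at `min(a,T)` and `min(c,T)`. -/
theorem exists_wienerIntegral (hW : IsPreBrownianReal W P) [IsProbabilityMeasure P] (T : ℝ≥0) :
    ∃ J : Lp H 2 (timeMeasure T) →ₗᵢ[ℝ] Lp H 2 P, ∀ (a : ℝ≥0) (h : H),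
      J (indicatorConstLp 2 (measurableSet_Ioc : MeasurableSet (Ioc 0 (a : ℝ)))
        (measure_ne_top _ _) h) = (brownian_smul_memLp hW (min a T) h).toLp _ := by
  have hinner : ∀ p q : ℝ≥0 × H, ⟪indicatorConstLp 2
      (measurableSet_Ioc : MeasurableSet (Ioc 0 (p.1 : ℝ))) (measure_ne_top (timeMeasure T) _) p.2,
      indicatorConstLp 2 (measurableSet_Ioc : MeasurableSet (Ioc 0 (q.1 : ℝ)))
        (measure_ne_top (timeMeasure T) _) q.2⟫_ℝ =
      ⟪(brownian_smul_memLp hW (min p.1 T) p.2).toLp _,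
        (brownian_smul_memLp hW (min q.1 T) q.2).toLp _⟫_ℝ := by
    rintro ⟨a, h⟩ ⟨c, k⟩
    dsimp only
    rw [L2.inner_indicatorConstLp_indicatorConstLp, L2.inner_def]
    have e1 : ∫ ω, ⟪(brownian_smul_memLp hW (min a T) h).toLp _ ω,
        (brownian_smul_memLp hW (min c T) k).toLp _ ω⟫_ℝ ∂P =
        ∫ ω, (W (min a T) ω * W (min c T) ω) * ⟪h, k⟫_ℝ ∂P := by
      refine integral_congr_ae ?_
      filter_upwards [(brownian_smul_memLp hW (min a T) h).coeFn_toLp,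
        (brownian_smul_memLp hW (min c T) k).coeFn_toLp] with ω h1 h2
      rw [h1, h2, inner_smul_left, inner_smul_right]
      simp [mul_assoc]
    rw [e1, integral_mul_const, brownian_integral_mul hW]
    have e2 : Ioc 0 (a : ℝ) ∩ Ioc 0 (c : ℝ) ∩ Icc 0 (T : ℝ) =
        Ioc 0 ((min (min a T) (min c T) : ℝ≥0) : ℝ) := by
      ext x
      simp only [mem_inter_iff, mem_Ioc, mem_Icc, NNReal.coe_min, le_min_iff]
      constructor
      · rintro ⟨⟨h1, h2⟩, h3⟩
        exact ⟨h1.1, ⟨h1.2, h3.2⟩, h2.2, h3.2⟩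
      · rintro ⟨h1, h2, h3⟩
        exact ⟨⟨⟨h1, h2.1⟩, h1, h3.1⟩, h1.le, h2.2⟩
    have e3 : (timeMeasure T).real (Ioc 0 (a : ℝ) ∩ Ioc 0 (c : ℝ)) =
        ((min (min a T) (min c T) : ℝ≥0) : ℝ) := by
      rw [measureReal_restrict_apply (measurableSet_Ioc.inter measurableSet_Ioc), e2]
      simp
    simp only [e3]
    simp
  obtain ⟨J, hJ⟩ := exists_linearIsometry_of_inner_eq _ _ hinner
    (span_indicatorConstLp_dense (fun a : ℝ≥0 => measurableSet_Ioc)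
      fun φ hφ h => ae_eq_zero_of_setIntegral_Ioc hφ h)
  exact ⟨J, fun a h => hJ (a, h)⟩

/-- The Wiener integral `∫₀ᵀ φ dW`, `φ ∈ L²([0,T]; H)`. -/
noncomputable def wienerIntegral (hW : IsPreBrownianReal W P) [IsProbabilityMeasure P] (T : ℝ≥0) :
    Lp H 2 (timeMeasure T) →ₗᵢ[ℝ] Lp H 2 P :=
  (exists_wienerIntegral hW T).choose

theorem wienerIntegral_indicator (hW : IsPreBrownianReal W P) [IsProbabilityMeasure P]
    (T a : ℝ≥0) (h : H) :
    wienerIntegral hW T (indicatorConstLp 2 (measurableSet_Ioc : MeasurableSet (Ioc 0 (a : ℝ)))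
        (measure_ne_top _ _) h) = (brownian_smul_memLp hW (min a T) h).toLp _ :=
  (exists_wienerIntegral hW T).choose_spec a h

theorem dense_induction_Ioc {T : ℝ≥0} {p : Submodule ℝ (Lp H 2 (timeMeasure T))}
    (hp : IsClosed (p : Set (Lp H 2 (timeMeasure T))))
    (h : ∀ (a : ℝ≥0) (h : H), indicatorConstLp 2 (measurableSet_Ioc : MeasurableSet (Ioc 0 (a : ℝ)))
        (measure_ne_top _ _) h ∈ p) (φ : Lp H 2 (timeMeasure T)) : φ ∈ p := by
  have h1 := span_indicatorConstLp_dense (E := H) (fun a : ℝ≥0 =>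
    (measurableSet_Ioc : MeasurableSet (Ioc 0 (a : ℝ))))
      fun φ hφ h => ae_eq_zero_of_setIntegral_Ioc (T := T) hφ h
  have h3 : Submodule.span ℝ (range fun q : ℝ≥0 × H => indicatorConstLp 2
      (measurableSet_Ioc : MeasurableSet (Ioc 0 (q.1 : ℝ))) (measure_ne_top (timeMeasure T) _)
        q.2) ≤ p := by
    rw [Submodule.span_le]
    rintro _ ⟨q, rfl⟩
    exact h q.1 q.2
  have h2 := Submodule.topologicalClosure_minimal _ h3 hp
  rw [h1] at h2
  exact h2 trivial

/-- The Wiener integral commutes with bounded operators. -/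
theorem wienerIntegral_compLpL (hW : IsPreBrownianReal W P) [IsProbabilityMeasure P] (T : ℝ≥0)
    (R : H →L[ℝ] H) (φ : Lp H 2 (timeMeasure T)) :
    wienerIntegral hW T (R.compLpL 2 _ φ) = R.compLpL 2 P (wienerIntegral hW T φ) := by
  let L : Lp H 2 (timeMeasure T) →L[ℝ] Lp H 2 P :=
    (wienerIntegral hW T).toContinuousLinearMap.comp (R.compLpL 2 _) -
      (R.compLpL 2 P).comp (wienerIntegral hW T).toContinuousLinearMap
  suffices φ ∈ LinearMap.ker (L : Lp H 2 (timeMeasure T) →ₗ[ℝ] Lp H 2 P) from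
    sub_eq_zero.1 this
  refine dense_induction_Ioc L.isClosed_ker (fun a h => ?_) φ
  have e1 : R.compLpL 2 (timeMeasure T) (indicatorConstLp 2
      (measurableSet_Ioc : MeasurableSet (Ioc 0 (a : ℝ))) (measure_ne_top _ _) h) =
      indicatorConstLp 2 (measurableSet_Ioc : MeasurableSet (Ioc 0 (a : ℝ)))
        (measure_ne_top _ _) (R h) := by
    apply Lp.ext
    filter_upwards [R.coeFn_compLpL (indicatorConstLp 2 (measurableSet_Ioc : MeasurableSet
      (Ioc 0 (a : ℝ))) (measure_ne_top (timeMeasure T) _) h), indicatorConstLp_coeFn (p := 2)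
      (hs := (measurableSet_Ioc : MeasurableSet (Ioc 0 (a : ℝ))))
      (hμs := measure_ne_top (timeMeasure T) _) (c := h), indicatorConstLp_coeFn (p := 2)
      (hs := (measurableSet_Ioc : MeasurableSet (Ioc 0 (a : ℝ))))
      (hμs := measure_ne_top (timeMeasure T) _) (c := R h)] with s h1 h2 h3
    rw [h1, h2, h3]
    by_cases hs : s ∈ Ioc 0 (a : ℝ) <;> simp [hs]
  have e2 : R.compLpL 2 P ((brownian_smul_memLp hW (min a T) h).toLp _) =
      (brownian_smul_memLp hW (min a T) (R h)).toLp _ := by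
    apply Lp.ext
    filter_upwards [R.coeFn_compLpL ((brownian_smul_memLp hW (min a T) h).toLp _),
      (brownian_smul_memLp hW (min a T) h).coeFn_toLp,
      (brownian_smul_memLp hW (min a T) (R h)).coeFn_toLp] with s h1 h2 h3
    rw [h1, h2, h3, map_smul]
  change wienerIntegral hW T (R.compLpL 2 _ _) - R.compLpL 2 P (wienerIntegral hW T _) = 0
  rw [e1, wienerIntegral_indicator, wienerIntegral_indicator, e2, sub_self]

end Wiener

/-! ### Truncation in `Lp` -/

/-- Multiplication by the indicator of a measurable set, as a bounded operator on `L²`. -/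
noncomputable def indicatorL {α E : Type*} [NormedAddCommGroup E] [NormedSpace ℝ E]
    {m : MeasurableSpace α} (μ : Measure α) {s : Set α} (hs : MeasurableSet s) :
    Lp E 2 μ →L[ℝ] Lp E 2 μ :=
  LinearMap.mkContinuous
    { toFun := fun φ => ((Lp.memLp φ).indicator hs).toLp _
      map_add' := fun φ ψ => by
        apply Lp.ext
        filter_upwards [((Lp.memLp (φ + ψ)).indicator hs).coeFn_toLp, Lp.coeFn_add φ ψ,
          Lp.coeFn_add (((Lp.memLp φ).indicator hs).toLp _) (((Lp.memLp ψ).indicator hs).toLp _),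
          ((Lp.memLp φ).indicator hs).coeFn_toLp, ((Lp.memLp ψ).indicator hs).coeFn_toLp]
          with x h1 h2 h3 h4 h5
        rw [h1, h3, Pi.add_apply, h4, h5]
        by_cases hx : x ∈ s
        · simp only [indicator_of_mem hx]
          exact h2
        · simp [hx]
      map_smul' := fun c φ => by
        apply Lp.ext
        filter_upwards [((Lp.memLp (c • φ)).indicator hs).coeFn_toLp, Lp.coeFn_smul c φ,
          Lp.coeFn_smul c (((Lp.memLp φ).indicator hs).toLp _),
          ((Lp.memLp φ).indicator hs).coeFn_toLp] with x h1 h2 h3 h4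
        rw [h1, RingHom.id_apply, h3, Pi.smul_apply, h4]
        by_cases hx : x ∈ s <;> simp [hx, h2] } 1 fun φ => by
    rw [one_mul]
    refine Lp.norm_le_norm_of_ae_le ?_
    filter_upwards [((Lp.memLp φ).indicator hs).coeFn_toLp] with x h1
    simp only [LinearMap.coe_mk, AddHom.coe_mk]
    rw [h1]
    exact norm_indicator_le_norm_self _ _

theorem coeFn_indicatorL {α E : Type*} [NormedAddCommGroup E] [NormedSpace ℝ E]
    {m : MeasurableSpace α} (μ : Measure α) {s : Set α} (hs : MeasurableSet s) (φ : Lp E 2 μ) :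
    indicatorL μ hs φ =ᵐ[μ] s.indicator φ :=
  ((Lp.memLp φ).indicator hs).coeFn_toLp

/-! ### Step functions -/

section Step

variable {H : Type*} [NormedAddCommGroup H]

theorem StepFunction.memLp_eval (b : StepFunction H) (T : ℝ≥0) :
    MemLp b.eval 2 (timeMeasure T) := by
  have : b.eval = ∑ i ∈ Finset.range b.n,
      (Ioc (b.time i : ℝ) (b.time (i + 1))).indicator fun _ => b.value i := by
    ext s; simp [StepFunction.eval]
  rw [this]
  exact memLp_finsetSum' _ fun i _ => (memLp_const _).indicator measurableSet_Ioc

/-- The step function with the values of `φ` at the left end points of a uniform partition. -/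
noncomputable def uniformStep (φ : ℝ → H) (t : ℝ≥0) (n : ℕ) : StepFunction H where
  n := n
  time i := i * t / n
  time_mono i j hij := by
    change (i * t / n : ℝ≥0) ≤ j * t / n
    gcongr
  value i := φ ((i * t / n : ℝ≥0) : ℝ)

theorem uniformStep_eval (φ : ℝ → H) (t : ℝ≥0) {n : ℕ} (hn : n ≠ 0) {s : ℝ}
    (hs : s ∈ Ioc (0 : ℝ) t) :
    ∃ r ∈ Icc (0 : ℝ) t, dist r s ≤ t / n ∧ (uniformStep φ t n).eval s = φ r := by
  set b := uniformStep φ t n with hb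
  have hn' : (0 : ℝ) < n := by positivity
  have hmono : Monotone fun i => (b.time i : ℝ) := fun i j hij => NNReal.coe_le_coe.2 (b.time_mono hij)
  have hU := hmono.biUnion_Ico_Ioc_map_succ 0 n
  have h0 : (b.time 0 : ℝ) = 0 := by simp [hb, uniformStep]
  have h1 : (b.time n : ℝ) = t := by
    simp [hb, uniformStep]; field_simp
  rw [h0, h1] at hU
  rw [← hU] at hs
  simp only [mem_iUnion] at hs
  obtain ⟨i, hi, hsi⟩ := hs
  have hin : i < n := hi.2
  have hsucc : (b.time (i + 1) : ℝ) = b.time i + t / n := by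
    simp [hb, uniformStep]; ring
  change s ∈ Ioc (b.time i : ℝ) (b.time (i + 1)) at hsi
  refine ⟨b.time i, ⟨NNReal.coe_nonneg _, ?_⟩, ?_, ?_⟩
  · rw [← h1]; exact hmono hin.le
  · rw [Real.dist_eq, abs_sub_comm, abs_of_nonneg (by linarith [hsi.1])]
    linarith [hsi.2]
  · rw [StepFunction.eval, Finset.sum_eq_single i]
    · rw [indicator_of_mem hsi]; rfl
    · intro j _ hji
      rw [indicator_of_notMem]
      intro hsj
      exact (disjoint_left.1 (hmono.pairwise_disjoint_on_Ioc_succ hji) hsj) hsi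
    · intro h
      exact absurd (Finset.mem_range.2 hin) h

/-- Bounded continuous functions are dense in `L²`, and on the compact interval a continuous
function is uniformly close to its samples on a fine partition. -/
theorem exists_stepFunction_eLpNorm_sub_le [NormedSpace ℝ H] {B : ℝ → H} {t : ℝ≥0}
    (hB : MemLp B 2 (timeMeasure t)) {ε : ℝ≥0∞} (hε : ε ≠ 0) :
    ∃ b : StepFunction H, eLpNorm (fun s => b.eval s - B s) 2 (timeMeasure t) ≤ ε := by
  obtain ⟨φ, hφ, hφm⟩ := hB.exists_boundedContinuous_eLpNorm_sub_le (by norm_num)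
    (ENNReal.half_pos hε).ne'
  have hcomp : UniformContinuousOn φ (Icc (0 : ℝ) t) :=
    isCompact_Icc.uniformContinuousOn_of_continuous φ.continuous.continuousOn
  -- The square root of the length of the interval, which turns a uniform bound into an `L²` bound.
  set c : ℝ≥0∞ := (timeMeasure t) univ ^ (ENNReal.toReal 2)⁻¹ with hc
  have hctop : c ≠ ∞ := ENNReal.rpow_ne_top_of_nonneg (by positivity) (measure_ne_top _ _)
  obtain ⟨δ, hδ, hδε⟩ : ∃ δ : ℝ, 0 < δ ∧ c * ENNReal.ofReal δ ≤ ε / 2 := by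
    have hlim : Tendsto (fun δ : ℝ => c * ENNReal.ofReal δ) (𝓝[>] 0) (𝓝 (c * ENNReal.ofReal 0)) :=
      ((ENNReal.Tendsto.const_mul ENNReal.continuous_ofReal.continuousAt (Or.inr hctop))).mono_left
        nhdsWithin_le_nhds
    rw [ENNReal.ofReal_zero, mul_zero] at hlim
    have h1 := (hlim.eventually (ge_mem_nhds (ENNReal.half_pos hε))).and self_mem_nhdsWithin
    obtain ⟨δ, h2, h3⟩ := h1.exists
    exact ⟨δ, h3, h2⟩
  obtain ⟨η, hη, hu⟩ := Metric.uniformContinuousOn_iff.1 hcomp δ hδ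
  obtain ⟨n, hn⟩ := exists_nat_gt ((t : ℝ) / η)
  have hn0 : (0 : ℝ) < n := lt_of_le_of_lt (by positivity) hn
  have hn0' : n ≠ 0 := by rintro rfl; simp at hn0
  have htn : (t : ℝ) / n < η := by
    rw [div_lt_iff₀ hη] at hn
    rw [div_lt_iff₀ hn0]; linarith [mul_comm η (n : ℝ)]
  refine ⟨uniformStep φ t n, ?_⟩
  have h1 : eLpNorm ((uniformStep φ t n).eval - (φ : ℝ → H)) 2 (timeMeasure t) ≤ ε / 2 := by
    refine (eLpNorm_le_of_ae_bound (C := δ) ?_).trans hδε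
    have h0 : ∀ᵐ x ∂(volume : Measure ℝ), x ≠ 0 := by simp [ae_iff]
    filter_upwards [ae_restrict_mem measurableSet_Icc, ae_restrict_of_ae h0] with s hs hs0
    have hs' : s ∈ Ioc (0 : ℝ) t := ⟨lt_of_le_of_ne hs.1 (Ne.symm hs0), hs.2⟩
    obtain ⟨r, hr, hrs, he⟩ := uniformStep_eval φ t hn0' hs'
    rw [Pi.sub_apply, he, ← dist_eq_norm]
    exact (hu r hr s hs (hrs.trans_lt htn)).le
  have h2 : (fun s => (uniformStep φ t n).eval s - B s) =
      ((uniformStep φ t n).eval - (φ : ℝ → H)) - (B - (φ : ℝ → H)) := by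
    ext s; simp
  have m1 : AEStronglyMeasurable ((uniformStep φ t n).eval - (φ : ℝ → H)) (timeMeasure t) :=
    ((StepFunction.memLp_eval _ t).sub hφm).1
  rw [h2]
  calc _ ≤ _ := eLpNorm_sub_le m1 (hB.1.sub hφm.1) (by norm_num)
    _ ≤ ε / 2 + ε / 2 := add_le_add h1 hφ
    _ = ε := ENNReal.add_halves ε

end Step

/-! ### Stochastic integrals as Wiener integrals -/

section Wiener

variable {Ω : Type*} {mΩ : MeasurableSpace Ω} {P : Measure Ω} {W : ℝ≥0 → Ω → ℝ}

theorem timeMeasure_restrict_Iic {t T : ℝ≥0} (htT : t ≤ T) :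
    (timeMeasure T).restrict (Iic (t : ℝ)) = timeMeasure t := by
  rw [Measure.restrict_restrict measurableSet_Iic]
  congr 1
  ext s
  simp only [mem_inter_iff, mem_Iic, mem_Icc]
  have : (t : ℝ) ≤ T := htT
  constructor
  · rintro ⟨h1, h2, -⟩; exact ⟨h2, h1⟩
  · rintro ⟨h1, h2⟩; exact ⟨h2, h1, h2.trans this⟩

theorem eLpNorm_indicator_Iic {H : Type*} [NormedAddCommGroup H] {t T : ℝ≥0} (htT : t ≤ T)
    (φ : ℝ → H) :
    eLpNorm ((Iic (t : ℝ)).indicator φ) 2 (timeMeasure T) = eLpNorm φ 2 (timeMeasure t) := by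
  rw [eLpNorm_indicator_eq_eLpNorm_restrict measurableSet_Iic, timeMeasure_restrict_Iic htT]

/-- Rewrites a truncated piece of a step function through intervals starting at 0, on which the
Wiener integral is known. -/
theorem indicator_Ioc_sub {H : Type*} [NormedAddCommGroup H] (a c t : ℝ≥0) (hac : a ≤ c) (h : H) (s : ℝ) :
    (Iic (t : ℝ)).indicator ((Ioc (a : ℝ) c).indicator fun _ => h) s =
      (Ioc (0 : ℝ) (min c t : ℝ≥0)).indicator (fun _ => h) s -
        (Ioc (0 : ℝ) (min a t : ℝ≥0)).indicator (fun _ => h) s := by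
  have hac' : (a : ℝ) ≤ c := hac
  have ha := a.coe_nonneg
  simp only [indicator_apply, mem_Iic, mem_Ioc, NNReal.coe_min, le_min_iff]
  by_cases h1 : s ≤ t <;> by_cases h2 : s ≤ a <;> by_cases h3 : s ≤ c <;> by_cases h4 : 0 < s <;>
    simp [h1, h2, h3, h4]
  all_goals first | (intro; linarith) | (exfalso; linarith)

variable {H : Type*} [NormedAddCommGroup H] [InnerProductSpace ℝ H] [CompleteSpace H]

/-- The Wiener integral of a truncated step function is the elementary integral. -/
theorem wienerIntegral_step (hW : IsPreBrownianReal W P) [IsProbabilityMeasure P] {t T : ℝ≥0}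
    (htT : t ≤ T) (b : StepFunction H) :
    wienerIntegral hW T (((b.memLp_eval T).indicator
      (measurableSet_Iic : MeasurableSet (Iic (t : ℝ)))).toLp _) =ᵐ[P] b.integral W t := by
  let e : ℝ≥0 → H → Lp H 2 (timeMeasure T) := fun a h => indicatorConstLp 2
    (measurableSet_Ioc : MeasurableSet (Ioc 0 (a : ℝ))) (measure_ne_top _ _) h
  have he : ∀ a h, e a h =ᵐ[timeMeasure T] (Ioc (0 : ℝ) a).indicator fun _ => h :=
    fun a h => indicatorConstLp_coeFn
  have h1 : ((b.memLp_eval T).indicator (measurableSet_Iic : MeasurableSet (Iic (t : ℝ)))).toLp _ =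
      ∑ i ∈ Finset.range b.n,
        (e (min (b.time (i + 1)) t) (b.value i) - e (min (b.time i) t) (b.value i)) := by
    apply Lp.ext
    have k1 := ae_all_iff.2 fun i : ℕ => he (min (b.time (i + 1)) t) (b.value i)
    have k2 := ae_all_iff.2 fun i : ℕ => he (min (b.time i) t) (b.value i)
    have k3 := ae_all_iff.2 fun i : ℕ => Lp.coeFn_sub (e (min (b.time (i + 1)) t) (b.value i))
      (e (min (b.time i) t) (b.value i))
    filter_upwards [k1, k2, k3, Lp.coeFn_finsetSum (Finset.range b.n) (fun i =>
      (e (min (b.time (i + 1)) t) (b.value i) - e (min (b.time i) t) (b.value i))),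
      ((b.memLp_eval T).indicator
        (measurableSet_Iic : MeasurableSet (Iic (t : ℝ)))).coeFn_toLp] with s h1 h2 h3 h4 h5
    rw [h5, h4, Finset.sum_apply]
    have : (Iic (t : ℝ)).indicator b.eval s = ∑ i ∈ Finset.range b.n, (Iic (t : ℝ)).indicator
        ((Ioc (b.time i : ℝ) (b.time (i + 1))).indicator fun _ => b.value i) s := by
      by_cases hs : s ∈ Iic (t : ℝ) <;> simp [hs, StepFunction.eval]
    rw [this]
    refine Finset.sum_congr rfl fun i _ => ?_
    rw [h3, Pi.sub_apply, h1, h2, indicator_Ioc_sub _ _ _ (b.time_mono (Nat.le_succ i))]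
  have h2 : ∀ a h, wienerIntegral hW T (e (min a t) h) =
      (brownian_smul_memLp hW (min a t) h).toLp _ := by
    intro a h
    have : min (min a t) T = min a t := min_eq_left ((min_le_right _ _).trans htT)
    rw [wienerIntegral_indicator]
    simp only [this]
  rw [h1, map_sum]
  simp only [map_sub, h2]
  have k1 := ae_all_iff.2 fun i : ℕ =>
    (brownian_smul_memLp hW (min (b.time (i + 1)) t) (b.value i)).coeFn_toLp
  have k2 := ae_all_iff.2 fun i : ℕ =>
    (brownian_smul_memLp hW (min (b.time i) t) (b.value i)).coeFn_toLp
  have k3 := ae_all_iff.2 fun i : ℕ => Lp.coeFn_sub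
    ((brownian_smul_memLp hW (min (b.time (i + 1)) t) (b.value i)).toLp _)
    ((brownian_smul_memLp hW (min (b.time i) t) (b.value i)).toLp _)
  filter_upwards [k1, k2, k3, Lp.coeFn_finsetSum (Finset.range b.n) (fun i =>
    ((brownian_smul_memLp hW (min (b.time (i + 1)) t) (b.value i)).toLp _ -
      (brownian_smul_memLp hW (min (b.time i) t) (b.value i)).toLp _))] with ω h1 h2 h3 h4
  rw [h4, Finset.sum_apply, StepFunction.integral]
  refine Finset.sum_congr rfl fun i _ => ?_
  rw [h3, Pi.sub_apply, h1, h2, sub_smul]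

/-- By the isometry the two errors in the definition of a stochastic integral are the same number.
Hence the Wiener integral is a stochastic integral, and any other one agrees with it almost surely.
-/
theorem eLpNorm_step_sub_wienerIntegral (hW : IsPreBrownianReal W P) [IsProbabilityMeasure P]
    {t T : ℝ≥0} (htT : t ≤ T) (b : StepFunction H) {B : ℝ → H}
    (hB : MemLp ((Iic (t : ℝ)).indicator B) 2 (timeMeasure T)) :
    eLpNorm (fun ω => b.integral W t ω - wienerIntegral hW T (hB.toLp _) ω) 2 P =
      eLpNorm (fun s => b.eval s - B s) 2 (timeMeasure t) := by
  set hb := (b.memLp_eval T).indicator (measurableSet_Iic : MeasurableSet (Iic (t : ℝ)))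
  have h1 : (fun ω => b.integral W t ω - wienerIntegral hW T (hB.toLp _) ω) =ᵐ[P]
      wienerIntegral hW T (hb.toLp _ - hB.toLp _) := by
    rw [map_sub]
    filter_upwards [wienerIntegral_step hW htT b, Lp.coeFn_sub (wienerIntegral hW T (hb.toLp _))
      (wienerIntegral hW T (hB.toLp _))] with ω h1 h2
    rw [h2, Pi.sub_apply, h1]
  rw [eLpNorm_congr_ae h1, ← Lp.enorm_def, LinearIsometry.enorm_map, Lp.enorm_def,
    ← eLpNorm_indicator_Iic htT]
  refine eLpNorm_congr_ae ?_
  filter_upwards [Lp.coeFn_sub (hb.toLp _) (hB.toLp _), hb.coeFn_toLp, hB.coeFn_toLp]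
    with s h1 h2 h3
  rw [h1, Pi.sub_apply, h2, h3]
  by_cases hs : s ∈ Iic (t : ℝ) <;> simp [hs]

theorem IsStochasticIntegral.ae_eq_wienerIntegral (hW : IsPreBrownianReal W P)
    [IsProbabilityMeasure P] {t T : ℝ≥0} (htT : t ≤ T) {B : ℝ → H}
    (hB : MemLp ((Iic (t : ℝ)).indicator B) 2 (timeMeasure T)) {I : Ω → H}
    (hI : IsStochasticIntegral W P B t I) : I =ᵐ[P] wienerIntegral hW T (hB.toLp _) := by
  obtain ⟨-, hI, b, hb1, hb2⟩ := hI
  simp_rw [← eLpNorm_step_sub_wienerIntegral hW htT _ hB] at hb1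
  have hm : ∀ k, AEStronglyMeasurable ((b k).integral W t) P := fun k =>
    (Lp.aestronglyMeasurable _).congr (wienerIntegral_step hW htT (b k))
  have h0 : eLpNorm (I - (wienerIntegral hW T (hB.toLp _) : Ω → H)) 2 P = 0 := by
    refine le_antisymm ?_ (zero_le)
    have h1 := hb1.add hb2
    rw [add_zero] at h1
    refine ge_of_tendsto' h1 fun k => ?_
    have : I - (wienerIntegral hW T (hB.toLp _) : Ω → H) =
        (fun ω => (b k).integral W t ω - wienerIntegral hW T (hB.toLp _) ω) -
          fun ω => (b k).integral W t ω - I ω := by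
      ext ω; simp
    rw [this]
    exact eLpNorm_sub_le ((hm k).sub (Lp.aestronglyMeasurable _)) ((hm k).sub hI.1) (by norm_num)
  rw [eLpNorm_eq_zero_iff (hI.1.sub (Lp.aestronglyMeasurable _)) (by norm_num)] at h0
  filter_upwards [h0] with ω hω
  exact sub_eq_zero.1 hω

theorem isStochasticIntegral_wienerIntegral (hW : IsPreBrownianReal W P)
    [IsProbabilityMeasure P] {t T : ℝ≥0} (htT : t ≤ T) {B : ℝ → H}
    (hB : MemLp ((Iic (t : ℝ)).indicator B) 2 (timeMeasure T)) :
    IsStochasticIntegral W P B t (wienerIntegral hW T (hB.toLp _)) := by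
  have hBt : MemLp B 2 (timeMeasure t) := by
    rw [memLp_indicator_iff_restrict measurableSet_Iic, timeMeasure_restrict_Iic htT] at hB
    exact hB
  have hε : ∀ n : ℕ, ((n : ℝ≥0∞) + 1)⁻¹ ≠ 0 := fun n => by
    simp
  choose b hb using fun n : ℕ => exists_stepFunction_eLpNorm_sub_le hBt (hε n)
  have hlim : Tendsto (fun n : ℕ => ((n : ℝ≥0∞) + 1)⁻¹) atTop (𝓝 0) := by
    have := (tendsto_add_atTop_iff_nat 1).2 ENNReal.tendsto_inv_nat_nhds_zero
    simpa using this
  have hb' := tendsto_of_tendsto_of_tendsto_of_le_of_le tendsto_const_nhds hlim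
    (fun n => zero_le) hb
  refine ⟨hBt, Lp.memLp _, b, hb', ?_⟩
  simp_rw [eLpNorm_step_sub_wienerIntegral hW htT _ hB]
  exact hb'

/-- The Wiener integral of a function supported in `[0,t]` is measurable at time `t`. -/
theorem aestronglyMeasurable_wienerIntegral [IsProbabilityMeasure P] {ℱ : Filtration ℝ≥0 mΩ}
    (hW : IsPreBrownianReal W P) (had : Adapted ℱ W) (T t : ℝ≥0) (φ : Lp H 2 (timeMeasure T)) :
    AEStronglyMeasurable[ℱ t] (wienerIntegral hW T (indicatorL (timeMeasure T)
      (measurableSet_Iic : MeasurableSet (Iic (t : ℝ))) φ)) P := by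
  let L : Lp H 2 (timeMeasure T) →L[ℝ] Lp H 2 P :=
    (wienerIntegral hW T).toContinuousLinearMap.comp (indicatorL (timeMeasure T)
      (measurableSet_Iic : MeasurableSet (Iic (t : ℝ))))
  let p := (lpMeas H ℝ (ℱ t) 2 P).comap (L : Lp H 2 (timeMeasure T) →ₗ[ℝ] Lp H 2 P)
  have hp : IsClosed (p : Set (Lp H 2 (timeMeasure T))) :=
    (isClosed_aestronglyMeasurable (p := 2) (F := H) (μ := P) (ℱ.le t)).preimage L.continuous
  suffices φ ∈ p from (mem_lpMeas_iff_aestronglyMeasurable (𝕜 := ℝ)).1 this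
  refine dense_induction_Ioc hp (fun a h => ?_) φ
  change L _ ∈ lpMeas H ℝ (ℱ t) 2 P
  rw [mem_lpMeas_iff_aestronglyMeasurable]
  have h1 : indicatorL (timeMeasure T) (measurableSet_Iic : MeasurableSet (Iic (t : ℝ)))
      (indicatorConstLp 2 (measurableSet_Ioc : MeasurableSet (Ioc 0 (a : ℝ)))
        (measure_ne_top _ _) h) =
      indicatorConstLp 2 (measurableSet_Ioc : MeasurableSet (Ioc 0 ((min a t : ℝ≥0) : ℝ)))
        (measure_ne_top _ _) h := by
    apply Lp.ext
    filter_upwards [coeFn_indicatorL (timeMeasure T)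
      (measurableSet_Iic : MeasurableSet (Iic (t : ℝ)))
      (indicatorConstLp 2 (measurableSet_Ioc : MeasurableSet (Ioc 0 (a : ℝ)))
        (measure_ne_top _ _) h), indicatorConstLp_coeFn (p := 2)
      (hs := (measurableSet_Ioc : MeasurableSet (Ioc 0 (a : ℝ))))
      (hμs := measure_ne_top (timeMeasure T) _) (c := h), indicatorConstLp_coeFn (p := 2)
      (hs := (measurableSet_Ioc : MeasurableSet (Ioc 0 ((min a t : ℝ≥0) : ℝ))))
      (hμs := measure_ne_top (timeMeasure T) _) (c := h)] with s h1 h2 h3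
    rw [h1, h3]
    simp only [indicator_apply, h2, mem_Iic, mem_Ioc, NNReal.coe_min, le_min_iff]
    by_cases k1 : s ≤ t <;> by_cases k2 : s ≤ a <;> simp [k1, k2]
  have h2 : L (indicatorConstLp 2 (measurableSet_Ioc : MeasurableSet (Ioc 0 (a : ℝ)))
      (measure_ne_top _ _) h) = (brownian_smul_memLp hW (min (min a t) T) h).toLp _ := by
    change wienerIntegral hW T (indicatorL _ _ _) = _
    rw [h1, wienerIntegral_indicator]
  rw [h2]
  have h3 : Measurable[ℱ t] (W (min (min a t) T)) :=
    (had _).mono (ℱ.mono ((min_le_left _ _).trans (min_le_right _ _))) le_rfl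
  have h4 : StronglyMeasurable[ℱ t] fun ω => W (min (min a t) T) ω • h :=
    h3.stronglyMeasurable.smul_const h
  exact h4.aestronglyMeasurable.congr (brownian_smul_memLp hW _ h).coeFn_toLp.symm

end Wiener

/-! ### Lifting an isometry to a product space -/

theorem eLpNorm_two_sq_eq_lintegral {α E : Type*} [NormedAddCommGroup E] {m : MeasurableSpace α}
    (f : α → E) (μ : Measure α) : eLpNorm f 2 μ ^ 2 = ∫⁻ x, ‖f x‖ₑ ^ 2 ∂μ := by
  have := eLpNorm_nnreal_pow_eq_lintegral (μ := μ) (f := f) (p := 2) (by norm_num)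
  simpa using this

/-! ### Slices of square integrable functions on a product -/

section Slice

variable {S α : Type*} {mS : MeasurableSpace S} {mα : MeasurableSpace α}
  (ν : Measure S) {μ : Measure α}

theorem ae_prod_snd [SFinite μ] {p : α → Prop} (h : ∀ᵐ y ∂μ, p y) : ∀ᵐ z ∂(ν.prod μ), p z.2 :=
  Measure.quasiMeasurePreserving_snd.ae h

variable [IsFiniteMeasure μ] {E : Type*} [NormedAddCommGroup E]

theorem ae_memLp_slice {f : S × α → E} (hf : MemLp f 2 (ν.prod μ)) :
    ∀ᵐ x ∂ν, MemLp (fun y => f (x, y)) 2 μ := by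
  have h1 : ∫⁻ z, ‖f z‖ₑ ^ 2 ∂(ν.prod μ) ≠ ∞ := by
    rw [← eLpNorm_two_sq_eq_lintegral]
    exact ENNReal.pow_ne_top hf.2.ne
  rw [lintegral_prod _ (hf.1.enorm.pow_const 2)] at h1
  filter_upwards [ae_lt_top' (hf.1.enorm.pow_const 2).lintegral_prod_right' h1,
    hf.1.prodMk_left] with x hx hm
  refine ⟨hm, ?_⟩
  rw [← eLpNorm_two_sq_eq_lintegral (fun y => f (x, y))] at hx
  by_contra h
  rw [not_lt, top_le_iff] at h
  simp [h] at hx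

/-- By Tonelli the sum of the squared slice errors has finite integral, so it is finite at almost
every `x` and its terms tend to zero there. -/
theorem ae_tendsto_slice {K : ℕ → Lp E 2 (ν.prod μ)} {L : Lp E 2 (ν.prod μ)}
    (h : ∑' n, ‖K n - L‖ₑ ^ 2 ≠ ∞) :
    ∀ᵐ x ∂ν, Tendsto (fun n => eLpNorm (fun y => K n (x, y) - L (x, y)) 2 μ) atTop (𝓝 0) := by
  have hm : ∀ n, AEMeasurable (fun z : S × α => ‖K n z - L z‖ₑ ^ 2) (ν.prod μ) := fun n =>
    (((Lp.aestronglyMeasurable _).sub (Lp.aestronglyMeasurable _)).enorm.pow_const 2)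
  have h1 : ∀ n, ‖K n - L‖ₑ ^ 2 = ∫⁻ x, ∫⁻ y, ‖K n (x, y) - L (x, y)‖ₑ ^ 2 ∂μ ∂ν := by
    intro n
    rw [Lp.enorm_def, eLpNorm_two_sq_eq_lintegral, ← lintegral_prod _ (hm n)]
    refine lintegral_congr_ae ?_
    filter_upwards [Lp.coeFn_sub (K n) L] with z hz
    rw [hz, Pi.sub_apply]
  simp_rw [h1] at h
  rw [← lintegral_tsum fun n => (hm n).lintegral_prod_right'] at h
  filter_upwards [ae_lt_top' (AEMeasurable.tsum
    fun n => (hm n).lintegral_prod_right') h] with x hx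
  have h2 := ENNReal.tendsto_atTop_zero_of_tsum_ne_top hx.ne
  simp_rw [← eLpNorm_two_sq_eq_lintegral (fun y => K _ (x, y) - L (x, y))] at h2
  have h3 := ((ENNReal.continuous_rpow_const (y := (1 / 2 : ℝ))).tendsto 0).comp h2
  rw [ENNReal.zero_rpow_of_pos (by norm_num)] at h3
  refine h3.congr fun n => ?_
  rw [Function.comp_apply, ← ENNReal.rpow_natCast, ← ENNReal.rpow_mul]
  norm_num

end Slice

/-! ### Tensors, and isometries acting in the second variable -/

section Tensor

variable {S α : Type*} {mS : MeasurableSpace S} {mα : MeasurableSpace α}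
  (ν : Measure S) [IsFiniteMeasure ν] {μ : Measure α} [IsFiniteMeasure μ]
  {E : Type*} [NormedAddCommGroup E]

theorem memLp_tensor (φ : Lp E 2 μ) {C : Set S} (hC : MeasurableSet C) :
    MemLp ((C ×ˢ (univ : Set α)).indicator fun p : S × α => φ p.2) 2 (ν.prod μ) :=
  ((Lp.memLp φ).comp_snd ν).indicator (hC.prod MeasurableSet.univ)

/-- The function `(x, y) ↦ 1_C(x) φ(y)`. -/
noncomputable def tensorLp {C : Set S} (hC : MeasurableSet C) (φ : Lp E 2 μ) :
    Lp E 2 (ν.prod μ) :=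
  (memLp_tensor ν φ hC).toLp _

theorem coeFn_tensorLp {C : Set S} (hC : MeasurableSet C) (φ : Lp E 2 μ) :
    tensorLp ν hC φ =ᵐ[ν.prod μ] (C ×ˢ (univ : Set α)).indicator fun p : S × α => φ p.2 :=
  (memLp_tensor ν φ hC).coeFn_toLp

variable [InnerProductSpace ℝ E]

theorem inner_tensorLp {C C' : Set S} (hC : MeasurableSet C) (hC' : MeasurableSet C')
    (φ ψ : Lp E 2 μ) :
    ⟪tensorLp ν hC φ, tensorLp ν hC' ψ⟫_ℝ = ν.real (C ∩ C') * ⟪φ, ψ⟫_ℝ := by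
  rw [L2.inner_def, L2.inner_def]
  have e1 : ∫ z, ⟪tensorLp ν hC φ z, tensorLp ν hC' ψ z⟫_ℝ ∂(ν.prod μ) =
      ∫ z : S × α, ((C ∩ C').indicator (fun _ => (1 : ℝ)) z.1) * ⟪φ z.2, ψ z.2⟫_ℝ ∂(ν.prod μ) := by
    refine integral_congr_ae ?_
    filter_upwards [coeFn_tensorLp ν hC φ, coeFn_tensorLp ν hC' ψ] with z h1 h2
    rw [h1, h2]
    by_cases k1 : z.1 ∈ C <;> by_cases k2 : z.1 ∈ C' <;> simp [k1, k2]
  rw [e1, integral_prod_mul (fun x => (C ∩ C').indicator (fun _ => (1 : ℝ)) x)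
    (fun y => ⟪φ y, ψ y⟫_ℝ), integral_indicator_const _ (hC.inter hC')]
  simp

/-- `tensorLp` as a bounded operator. -/
noncomputable def tensorL {C : Set S} (hC : MeasurableSet C) :
    Lp E 2 μ →L[ℝ] Lp E 2 (ν.prod μ) :=
  LinearMap.mkContinuous
    { toFun := fun φ => tensorLp ν hC φ
      map_add' := fun φ ψ => by
        apply Lp.ext
        filter_upwards [coeFn_tensorLp ν hC (φ + ψ), coeFn_tensorLp ν hC φ, coeFn_tensorLp ν hC ψ,
          Lp.coeFn_add (tensorLp ν hC φ) (tensorLp ν hC ψ), ae_prod_snd ν (Lp.coeFn_add φ ψ)]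
          with z h1 h2 h3 h4 h5
        rw [h1, h4, Pi.add_apply, h2, h3]
        by_cases hz : z ∈ C ×ˢ (univ : Set α)
        · simp only [indicator_of_mem hz]
          exact h5
        · simp [indicator_of_notMem hz]
      map_smul' := fun c φ => by
        apply Lp.ext
        filter_upwards [coeFn_tensorLp ν hC (c • φ), coeFn_tensorLp ν hC φ,
          Lp.coeFn_smul c (tensorLp ν hC φ), ae_prod_snd ν (Lp.coeFn_smul c φ)]
          with z h1 h2 h3 h4
        rw [h1, RingHom.id_apply, h3, Pi.smul_apply, h2]
        by_cases hz : z ∈ C ×ˢ (univ : Set α)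
        · simp only [indicator_of_mem hz]
          exact h4
        · simp [indicator_of_notMem hz] } (√(ν.real C)) fun φ => by
    refine le_of_sq_le_sq ?_ (by positivity)
    simp only [LinearMap.coe_mk, AddHom.coe_mk]
    rw [mul_pow, Real.sq_sqrt measureReal_nonneg, ← real_inner_self_eq_norm_sq, inner_tensorLp,
      ← real_inner_self_eq_norm_sq, inter_self]

@[simp]
theorem tensorL_apply {C : Set S} (hC : MeasurableSet C) (φ : Lp E 2 μ) :
    tensorL ν hC φ = tensorLp ν hC φ := rfl

theorem compLpL_tensorLp (R : E →L[ℝ] E) {C : Set S} (hC : MeasurableSet C) (φ : Lp E 2 μ) :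
    R.compLpL 2 (ν.prod μ) (tensorLp ν hC φ) = tensorLp ν hC (R.compLpL 2 μ φ) := by
  apply Lp.ext
  filter_upwards [R.coeFn_compLpL (tensorLp ν hC φ), coeFn_tensorLp ν hC φ,
    coeFn_tensorLp ν hC (R.compLpL 2 μ φ), ae_prod_snd ν (R.coeFn_compLpL φ)] with z h1 h2 h3 h4
  rw [h1, h2, h3]
  by_cases k1 : z.1 ∈ C <;> simp [k1, h4]

variable [CompleteSpace E]

/-- The indicator of a rectangle with a constant value is a tensor, and measurable rectangles are a
π-system generating the product σ-algebra. -/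
theorem span_tensorLp_dense :
    (Submodule.span ℝ (range fun p : {C : Set S // MeasurableSet C} × Lp E 2 μ =>
      tensorLp ν p.1.2 p.2)).topologicalClosure = ⊤ := by
  have h1 := span_indicatorConstLp_dense (E := E) (μ := ν.prod μ)
    (s := fun p : {C : Set S // MeasurableSet C} × {D : Set α // MeasurableSet D} =>
      (p.1 : Set S) ×ˢ (p.2 : Set α)) (fun p => p.1.2.prod p.2.2) ?_
  · rw [eq_top_iff, ← h1]
    refine Submodule.topologicalClosure_mono (Submodule.span_mono ?_)
    rintro _ ⟨⟨⟨C, D⟩, h⟩, rfl⟩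
    refine ⟨(C, indicatorConstLp 2 D.2 (measure_ne_top μ _) h), ?_⟩
    apply Lp.ext
    filter_upwards [coeFn_tensorLp ν C.2 (indicatorConstLp 2 D.2 (measure_ne_top μ _) h),
      ae_prod_snd ν (indicatorConstLp_coeFn (p := 2) (hs := D.2) (hμs := measure_ne_top μ _)
        (c := h)), indicatorConstLp_coeFn (p := 2) (hs := C.2.prod D.2)
        (hμs := measure_ne_top (ν.prod μ) _) (c := h)] with z h1 h2 h3
    rw [h1, h3]
    by_cases k1 : z.1 ∈ (C : Set S) <;> by_cases k2 : z.2 ∈ (D : Set α) <;>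
      simp [k1, k2, h2]
  · intro φ hφ h
    refine ae_eq_zero_of_setIntegral_piSystem generateFrom_prod.symm isPiSystem_prod hφ ?_ ?_
    · have := h (⟨univ, MeasurableSet.univ⟩, ⟨univ, MeasurableSet.univ⟩)
      simpa using this
    · rintro _ ⟨C, hC, D, hD, rfl⟩
      exact h (⟨C, hC⟩, ⟨D, hD⟩)

theorem tensor_induction {p : Submodule ℝ (Lp E 2 (ν.prod μ))}
    (hp : IsClosed (p : Set (Lp E 2 (ν.prod μ))))
    (h : ∀ (C : Set S) (hC : MeasurableSet C) (φ : Lp E 2 μ), tensorLp ν hC φ ∈ p)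
    (K : Lp E 2 (ν.prod μ)) : K ∈ p := by
  have h3 : Submodule.span ℝ (range fun q : {C : Set S // MeasurableSet C} × Lp E 2 μ =>
      tensorLp ν q.1.2 q.2) ≤ p := by
    rw [Submodule.span_le]
    rintro _ ⟨q, rfl⟩
    exact h q.1 q.1.2 q.2
  have h2 := Submodule.topologicalClosure_minimal _ h3 hp
  rw [span_tensorLp_dense] at h2
  exact h2 trivial

/-- The adjoint of `tensorL` is integration over `C` in the first variable. -/
theorem coeFn_adjoint_tensorL {C : Set S} (hC : MeasurableSet C) (K : Lp E 2 (ν.prod μ)) :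
    ((tensorL ν hC).adjoint K : Lp E 2 μ) =ᵐ[μ] fun y => ∫ x in C, K (x, y) ∂ν := by
  have hK : Integrable K (ν.prod μ) := (Lp.memLp K).integrable (by norm_num)
  have hKC : Integrable K ((ν.restrict C).prod μ) := by
    have := hK.integrableOn (s := C ×ˢ (univ : Set α))
    rwa [IntegrableOn, ← Measure.prod_restrict, Measure.restrict_univ] at this
  refine Integrable.ae_eq_of_forall_setIntegral_eq _ _
    ((Lp.memLp _).integrable (by norm_num)) hKC.integral_prod_right fun D hD _ => ?_
  refine ext_inner_left ℝ fun h => ?_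
  rw [← L2.inner_indicatorConstLp_eq_inner_setIntegral ℝ hD (measure_ne_top _ _),
    ContinuousLinearMap.adjoint_inner_right]
  have e1 : tensorL ν hC (indicatorConstLp 2 hD (measure_ne_top μ D) h) =
      indicatorConstLp 2 (hC.prod hD) (measure_ne_top (ν.prod μ) _) h := by
    apply Lp.ext
    filter_upwards [coeFn_tensorLp ν hC (indicatorConstLp 2 hD (measure_ne_top μ _) h),
      ae_prod_snd ν (indicatorConstLp_coeFn (p := 2) (hs := hD) (hμs := measure_ne_top μ _)
        (c := h)), indicatorConstLp_coeFn (p := 2) (hs := hC.prod hD)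
        (hμs := measure_ne_top (ν.prod μ) _) (c := h)] with z h1 h2 h3
    rw [tensorL_apply, h1, h3]
    by_cases k1 : z.1 ∈ C <;> by_cases k2 : z.2 ∈ D <;>
      simp [k1, k2, h2]
  rw [e1, L2.inner_indicatorConstLp_eq_inner_setIntegral ℝ (hC.prod hD)]
  congr 1
  have h2 : Integrable K ((ν.restrict C).prod (μ.restrict D)) := by
    rw [Measure.prod_restrict]
    exact hK.integrableOn
  rw [← Measure.prod_restrict, integral_prod_symm _ h2]

variable {Ω : Type*} {mΩ : MeasurableSpace Ω} {P : Measure Ω} [IsFiniteMeasure P]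
  (J : Lp E 2 μ →ₗᵢ[ℝ] Lp E 2 P)

/-- Inner products of tensors factor and `J` preserves the second factor, so replacing `φ` by `J φ`
leaves the Gram matrix unchanged. -/
theorem exists_liftProd : ∃ L : Lp E 2 (ν.prod μ) →ₗᵢ[ℝ] Lp E 2 (ν.prod P),
    ∀ (C : Set S) (hC : MeasurableSet C) (φ : Lp E 2 μ),
      L (tensorLp ν hC φ) = tensorLp ν hC (J φ) := by
  obtain ⟨L, hL⟩ := exists_linearIsometry_of_inner_eq
    (fun p : {C : Set S // MeasurableSet C} × Lp E 2 μ => tensorLp ν p.1.2 p.2)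
    (fun p => tensorLp ν p.1.2 (J p.2))
    (fun p q => by simp only [inner_tensorLp, J.inner_map_map]) (span_tensorLp_dense ν)
  exact ⟨L, fun C hC φ => hL (⟨C, hC⟩, φ)⟩

/-- The isometry `J` applied in the second variable. -/
noncomputable def liftProd : Lp E 2 (ν.prod μ) →ₗᵢ[ℝ] Lp E 2 (ν.prod P) :=
  (exists_liftProd ν J).choose

theorem liftProd_tensorLp {C : Set S} (hC : MeasurableSet C) (φ : Lp E 2 μ) :
    liftProd ν J (tensorLp ν hC φ) = tensorLp ν hC (J φ) :=
  (exists_liftProd ν J).choose_spec C hC φ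

/-- Both sides are continuous in `K`, and on a tensor over `C'` both equal `ν(C ∩ C') J φ`. -/
theorem adjoint_tensorL_liftProd {C : Set S} (hC : MeasurableSet C) (K : Lp E 2 (ν.prod μ)) :
    (tensorL ν hC).adjoint (liftProd ν J K) = J ((tensorL ν hC).adjoint K) := by
  let L : Lp E 2 (ν.prod μ) →L[ℝ] Lp E 2 P :=
    ((tensorL ν hC).adjoint).comp (liftProd ν J).toContinuousLinearMap -
      J.toContinuousLinearMap.comp (tensorL ν hC).adjoint
  suffices K ∈ LinearMap.ker (L : Lp E 2 (ν.prod μ) →ₗ[ℝ] Lp E 2 P) from sub_eq_zero.1 this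
  refine tensor_induction ν L.isClosed_ker (fun C' hC' φ => ?_) K
  change (tensorL ν hC).adjoint (liftProd ν J _) - J ((tensorL ν hC).adjoint _) = 0
  rw [liftProd_tensorLp, sub_eq_zero]
  have h1 : (tensorL ν hC).adjoint (tensorLp ν hC' (J φ)) = ν.real (C ∩ C') • J φ := by
    refine ext_inner_left ℝ fun ψ => ?_
    rw [ContinuousLinearMap.adjoint_inner_right, tensorL_apply, inner_tensorLp, inner_smul_right]
  have h2 : (tensorL ν hC).adjoint (tensorLp ν hC' φ) = ν.real (C ∩ C') • φ := by
    refine ext_inner_left ℝ fun ψ => ?_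
    rw [ContinuousLinearMap.adjoint_inner_right, tensorL_apply, inner_tensorLp, inner_smul_right]
  rw [h1, h2, map_smul]

/-- When `J` is the Wiener integral this is the stochastic Fubini theorem: integration over `C` in
the parameter is exchanged with integration against `dW`. -/
theorem setIntegral_liftProd {C : Set S} (hC : MeasurableSet C) (K : Lp E 2 (ν.prod μ)) :
    J ((tensorL ν hC).adjoint K) =ᵐ[P] fun ω => ∫ x in C, liftProd ν J K (x, ω) ∂ν := by
  rw [← adjoint_tensorL_liftProd]
  exact coeFn_adjoint_tensorL ν hC _

theorem liftProd_compLpL (R : E →L[ℝ] E)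
    (hJ : ∀ φ, J (R.compLpL 2 μ φ) = R.compLpL 2 P (J φ)) (K : Lp E 2 (ν.prod μ)) :
    liftProd ν J (R.compLpL 2 _ K) = R.compLpL 2 _ (liftProd ν J K) := by
  let L : Lp E 2 (ν.prod μ) →L[ℝ] Lp E 2 (ν.prod P) :=
    (liftProd ν J).toContinuousLinearMap.comp (R.compLpL 2 _) -
      (R.compLpL 2 _).comp (liftProd ν J).toContinuousLinearMap
  suffices K ∈ LinearMap.ker (L : Lp E 2 (ν.prod μ) →ₗ[ℝ] Lp E 2 (ν.prod P)) from
    sub_eq_zero.1 this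
  refine tensor_induction ν L.isClosed_ker (fun C hC φ => ?_) K
  change liftProd ν J (R.compLpL 2 _ _) - R.compLpL 2 _ (liftProd ν J _) = 0
  rw [compLpL_tensorLp, liftProd_tensorLp, liftProd_tensorLp, compLpL_tensorLp, hJ, sub_self]

/-- Almost every slice of `liftProd ν J K` is the image under `J` of the slice of `K`. -/
theorem ae_liftProd_slice (K : Lp E 2 (ν.prod μ)) :
    ∀ᵐ x ∂ν, ∃ f : Lp E 2 μ, (fun y => K (x, y)) =ᵐ[μ] f ∧
      (fun ω => liftProd ν J K (x, ω)) =ᵐ[P] J f := by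
  let p : Submodule ℝ (Lp E 2 (ν.prod μ)) :=
    { carrier := {K | ∀ᵐ x ∂ν, ∃ f : Lp E 2 μ, (fun y => K (x, y)) =ᵐ[μ] f ∧
        (fun ω => liftProd ν J K (x, ω)) =ᵐ[P] J f}
      add_mem' := by
        intro K L hK hL
        filter_upwards [hK, hL, Measure.ae_ae_of_ae_prod (Lp.coeFn_add K L),
          Measure.ae_ae_of_ae_prod (Lp.coeFn_add (liftProd ν J K) (liftProd ν J L))]
          with x ⟨f, h1, h1'⟩ ⟨g, h2, h2'⟩ h3 h4
        refine ⟨f + g, ?_, ?_⟩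
        · filter_upwards [h1, h2, h3, Lp.coeFn_add f g] with ω k1 k2 k3 k4
          rw [k3, k4, Pi.add_apply, Pi.add_apply, k1, k2]
        · rw [map_add, map_add]
          filter_upwards [h1', h2', h4, Lp.coeFn_add (J f) (J g)] with ω k1 k2 k3 k4
          rw [k3, k4, Pi.add_apply, Pi.add_apply, k1, k2]
      zero_mem' := by
        filter_upwards [Measure.ae_ae_of_ae_prod (Lp.coeFn_zero E 2 (ν.prod μ)),
          Measure.ae_ae_of_ae_prod (Lp.coeFn_zero E 2 (ν.prod P))] with x h1 h2
        refine ⟨0, ?_, ?_⟩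
        · filter_upwards [h1, Lp.coeFn_zero E 2 μ] with ω k1 k2
          rw [k1, k2]; rfl
        · rw [map_zero, map_zero]
          filter_upwards [h2, Lp.coeFn_zero E 2 P] with ω k1 k2
          rw [k1, k2]; rfl
      smul_mem' := by
        intro c K hK
        filter_upwards [hK, Measure.ae_ae_of_ae_prod (Lp.coeFn_smul c K),
          Measure.ae_ae_of_ae_prod (Lp.coeFn_smul c (liftProd ν J K))] with x ⟨f, h1, h1'⟩ h3 h4
        refine ⟨c • f, ?_, ?_⟩
        · filter_upwards [h1, h3, Lp.coeFn_smul c f] with ω k1 k3 k4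
          rw [k3, k4, Pi.smul_apply, Pi.smul_apply, k1]
        · rw [map_smul, map_smul]
          filter_upwards [h1', h4, Lp.coeFn_smul c (J f)] with ω k1 k3 k4
          rw [k3, k4, Pi.smul_apply, Pi.smul_apply, k1] }
  suffices K ∈ p from this
  refine tensor_induction ν ?_ (fun C hC φ => ?_) K
  · refine isClosed_of_closure_subset fun L hL => ?_
    -- Approximation at the rate `2⁻ⁿ` makes the squared errors summable, so almost all slices
    -- converge; the isometry gives the same for the lifted kernels.
    have hε : ∀ n : ℕ, (0 : ℝ≥0∞) < (2⁻¹) ^ n := fun n => ENNReal.pow_pos (by simp) n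
    choose K hKp hKL using fun n => EMetric.mem_closure_iff.1 hL _ (hε n)
    have hsum : ∑' n, ‖K n - L‖ₑ ^ 2 ≠ ∞ := by
      refine ne_top_of_le_ne_top (b := ∑' n : ℕ, (2⁻¹ : ℝ≥0∞) ^ n) ?_ ?_
      · rw [ENNReal.tsum_geometric_two]; norm_num
      · refine ENNReal.tsum_le_tsum fun n => ?_
        have h1 : ‖K n - L‖ₑ ≤ 2⁻¹ ^ n := by
          rw [← edist_eq_enorm_sub, edist_comm]; exact (hKL n).le
        have h2 : (2⁻¹ : ℝ≥0∞) ^ n ≤ 1 := pow_le_one₀ zero_le (by simp)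
        calc ‖K n - L‖ₑ ^ 2 ≤ (2⁻¹ ^ n) ^ 2 := by gcongr
          _ = 2⁻¹ ^ n * 2⁻¹ ^ n := sq _
          _ ≤ 2⁻¹ ^ n * 1 := by gcongr
          _ = 2⁻¹ ^ n := mul_one _
    have hsum' : ∑' n, ‖liftProd ν J (K n) - liftProd ν J L‖ₑ ^ 2 ≠ ∞ := by
      simp_rw [← map_sub, LinearIsometry.enorm_map]
      exact hsum
    filter_upwards [ae_all_iff.2 hKp, ae_tendsto_slice ν hsum, ae_tendsto_slice ν hsum',
      ae_memLp_slice ν (Lp.memLp L), ae_memLp_slice ν (Lp.memLp (liftProd ν J L))]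
      with x hx h1 h2 h3 h4
    choose f hxm hxe using hx
    refine ⟨h3.toLp _, h3.coeFn_toLp.symm, ?_⟩
    have t1 : Tendsto f atTop (𝓝 (h3.toLp _)) := by
      rw [Lp.tendsto_Lp_iff_tendsto_eLpNorm']
      refine h1.congr fun n => eLpNorm_congr_ae ?_
      filter_upwards [hxm n, h3.coeFn_toLp] with ω k1 k2
      rw [Pi.sub_apply, k2, ← k1]
    have t2 : Tendsto (fun n => J (f n)) atTop (𝓝 (h4.toLp _)) := by
      rw [Lp.tendsto_Lp_iff_tendsto_eLpNorm']
      refine h2.congr fun n => eLpNorm_congr_ae ?_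
      filter_upwards [hxe n, h4.coeFn_toLp] with ω k1 k2
      rw [Pi.sub_apply, k2, ← k1]
    have e := tendsto_nhds_unique t2 ((J.continuous.tendsto _).comp t1)
    exact h4.coeFn_toLp.symm.trans (by rw [e])
  · have h0 := Measure.ae_ae_of_ae_prod (coeFn_tensorLp ν hC φ)
    have h1 := Measure.ae_ae_of_ae_prod (coeFn_tensorLp ν hC (J φ))
    rw [← liftProd_tensorLp] at h1
    filter_upwards [h0, h1] with x k0 k1
    by_cases hx : x ∈ C
    · refine ⟨φ, ?_, ?_⟩
      · filter_upwards [k0] with y hy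
        rw [hy]; simp [hx]
      · filter_upwards [k1] with y hy
        rw [hy]; simp [hx]
    · refine ⟨0, ?_, ?_⟩
      · filter_upwards [k0, Lp.coeFn_zero E 2 μ] with y hy hy'
        rw [hy, hy']; simp [hx]
      · rw [map_zero]
        filter_upwards [k1, Lp.coeFn_zero E 2 P] with y hy hy'
        rw [hy, hy']; simp [hx]

end Tensor

/-! ### Evolution under a bounded operator -/

theorem le_initial_of_hasDerivAt_nonpos {F F' : ℝ → ℝ} (h : ∀ t, HasDerivAt F (F' t) t)
    (h' : ∀ t, 0 ≤ t → F' t ≤ 0) {t : ℝ} (ht : 0 ≤ t) : F t ≤ F 0 := by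
  refine antitoneOn_of_deriv_nonpos (convex_Ici 0)
    (fun x _ => (h x).continuousAt.continuousWithinAt)
    (fun x _ => (h x).differentiableAt.differentiableWithinAt) (fun x hx => ?_)
    (mem_Ici.2 le_rfl) (mem_Ici.2 ht) ht
  rw [(h x).deriv]
  rw [interior_Ici] at hx
  exact h' x (le_of_lt hx)

section Orbit

variable {H : Type*} [NormedAddCommGroup H] [InnerProductSpace ℝ H]

/-- The solution `e^{-tA} c` of `v' = -A v`, `v(0) = c`, for a bounded operator `A`. -/
noncomputable def expOrbit (A : H →L[ℝ] H) (t : ℝ) : H →L[ℝ] H := NormedSpace.exp (t • (-A))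

@[simp]
theorem expOrbit_zero (A : H →L[ℝ] H) (c : H) : expOrbit A 0 c = c := by
  simp [expOrbit]

variable [CompleteSpace H]

theorem hasDerivAt_expOrbit (A : H →L[ℝ] H) (c : H) (t : ℝ) :
    HasDerivAt (fun t => expOrbit A t c) (-(A (expOrbit A t c))) t := by
  have h := hasDerivAt_exp_smul_const' (𝕂 := ℝ) (-A) t
  have := h.clm_apply (hasDerivAt_const t c)
  simpa [expOrbit] using this

theorem hasDerivAt_expOrbit' (A : H →L[ℝ] H) (c : H) (t : ℝ) :
    HasDerivAt (fun t => expOrbit A t c) (-(expOrbit A t (A c))) t := by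
  have h := hasDerivAt_exp_smul_const (𝕂 := ℝ) (-A) t
  have := h.clm_apply (hasDerivAt_const t c)
  simpa [expOrbit] using this

theorem apply_expOrbit (A : H →L[ℝ] H) (c : H) (t : ℝ) :
    A (expOrbit A t c) = expOrbit A t (A c) :=
  neg_injective ((hasDerivAt_expOrbit A c t).unique (hasDerivAt_expOrbit' A c t))

theorem continuous_expOrbit (A : H →L[ℝ] H) (c : H) : Continuous fun t => expOrbit A t c :=
  continuous_iff_continuousAt.2 fun t => (hasDerivAt_expOrbit A c t).continuousAt

/-- The derivative of `‖v‖²` is `-2⟪A v, v⟫`. The bound does not depend on the norm of `A`, so it is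
uniform over Yosida approximations; the same holds for the three estimates below. -/
theorem norm_expOrbit_le {A : H →L[ℝ] H} (hA : ∀ z, 0 ≤ ⟪A z, z⟫_ℝ) (c : H) {t : ℝ}
    (ht : 0 ≤ t) : ‖expOrbit A t c‖ ≤ ‖c‖ := by
  have h : ∀ t, HasDerivAt (fun t => ‖expOrbit A t c‖ ^ 2)
      (2 * ⟪expOrbit A t c, -(A (expOrbit A t c))⟫_ℝ) t := fun t =>
    (hasDerivAt_expOrbit A c t).norm_sq
  have := le_initial_of_hasDerivAt_nonpos h (fun t _ => by
    rw [inner_neg_right, real_inner_comm]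
    linarith [hA (expOrbit A t c)]) ht
  rw [expOrbit_zero] at this
  exact le_of_sq_le_sq this (norm_nonneg _)

theorem hasDerivAt_inner_expOrbit (A : H →L[ℝ] H) (hs : ∀ x y, ⟪A x, y⟫_ℝ = ⟪x, A y⟫_ℝ) (c : H)
    (t : ℝ) : HasDerivAt (fun t => ⟪A (expOrbit A t c), expOrbit A t c⟫_ℝ)
      (-2 * ‖A (expOrbit A t c)‖ ^ 2) t := by
  have h1 : HasDerivAt (fun t => A (expOrbit A t c)) (A (-(A (expOrbit A t c)))) t :=
    A.hasFDerivAt.comp_hasDerivAt t (hasDerivAt_expOrbit A c t)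
  have h2 := h1.inner ℝ (hasDerivAt_expOrbit A c t)
  refine h2.congr_deriv ?_
  rw [inner_neg_right, map_neg, inner_neg_left, hs (A (expOrbit A t c)),
    real_inner_self_eq_norm_sq]
  ring

theorem hasDerivAt_norm_sq_apply_expOrbit (A : H →L[ℝ] H) (c : H)
    (t : ℝ) : HasDerivAt (fun t => ‖A (expOrbit A t c)‖ ^ 2)
      (-2 * ⟪A (A (expOrbit A t c)), A (expOrbit A t c)⟫_ℝ) t := by
  have h1 : HasDerivAt (fun t => A (expOrbit A t c)) (A (-(A (expOrbit A t c)))) t :=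
    A.hasFDerivAt.comp_hasDerivAt t (hasDerivAt_expOrbit A c t)
  refine h1.norm_sq.congr_deriv ?_
  rw [map_neg, inner_neg_right, real_inner_comm]
  ring

/-- The functional `½‖v‖² + t⟪A v, v⟫ + t²‖A v‖²` is nonincreasing: for symmetric `A` its derivative
telescopes to `-2t²⟪A(A v), A v⟫`. This is the smoothing bound `‖A exp(-tA)‖ ≤ 1/t`. -/
theorem sq_mul_norm_sq_apply_expOrbit_le {A : H →L[ℝ] H} (hA : ∀ z, 0 ≤ ⟪A z, z⟫_ℝ)
    (hs : ∀ x y, ⟪A x, y⟫_ℝ = ⟪x, A y⟫_ℝ) (c : H) {t : ℝ} (ht : 0 ≤ t) :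
    t ^ 2 * ‖A (expOrbit A t c)‖ ^ 2 ≤ ‖c‖ ^ 2 := by
  have h : ∀ t, HasDerivAt (fun t => (1 / 2) * ‖expOrbit A t c‖ ^ 2 +
      t * ⟪A (expOrbit A t c), expOrbit A t c⟫_ℝ + t ^ 2 * ‖A (expOrbit A t c)‖ ^ 2)
      (-2 * t ^ 2 * ⟪A (A (expOrbit A t c)), A (expOrbit A t c)⟫_ℝ) t := by
    intro t
    have h1 := ((hasDerivAt_expOrbit A c t).norm_sq.const_mul (1 / 2 : ℝ)).add
      ((hasDerivAt_id t).mul (hasDerivAt_inner_expOrbit A hs c t))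
    have h2 := h1.add ((hasDerivAt_pow 2 t).mul (hasDerivAt_norm_sq_apply_expOrbit A c t))
    refine h2.congr_deriv ?_
    rw [inner_neg_right, real_inner_comm]
    simp
    ring
  have h3 := le_initial_of_hasDerivAt_nonpos h (fun t _ => by
    have := mul_nonneg (sq_nonneg t) (hA (A (expOrbit A t c)))
    linarith) ht
  simp only [expOrbit_zero, zero_mul, add_zero] at h3
  have h4 := mul_nonneg ht (hA (expOrbit A t c))
  nlinarith [sq_nonneg ‖expOrbit A t c‖, sq_nonneg ‖c‖]

/-- Here `½⟪A v, v⟫ + t‖A v‖²` decreases. Data of finite energy thus improve the singularity at `t =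
0` to the integrable `t^(-1/2)`. -/
theorem mul_norm_sq_apply_expOrbit_le {A : H →L[ℝ] H} (hA : ∀ z, 0 ≤ ⟪A z, z⟫_ℝ)
    (hs : ∀ x y, ⟪A x, y⟫_ℝ = ⟪x, A y⟫_ℝ) (c : H) {t : ℝ} (ht : 0 ≤ t) :
    t * ‖A (expOrbit A t c)‖ ^ 2 ≤ ⟪A c, c⟫_ℝ := by
  have h : ∀ t, HasDerivAt (fun t => (1 / 2) * ⟪A (expOrbit A t c), expOrbit A t c⟫_ℝ +
      t * ‖A (expOrbit A t c)‖ ^ 2)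
      (-2 * t * ⟪A (A (expOrbit A t c)), A (expOrbit A t c)⟫_ℝ) t := by
    intro t
    have h1 := ((hasDerivAt_inner_expOrbit A hs c t).const_mul (1 / 2 : ℝ)).add
      ((hasDerivAt_id t).mul (hasDerivAt_norm_sq_apply_expOrbit A c t))
    refine h1.congr_deriv ?_
    simp
    ring
  have h3 := le_initial_of_hasDerivAt_nonpos h (fun t ht => by
    have := mul_nonneg ht (hA (A (expOrbit A t c)))
    linarith) ht
  simp only [expOrbit_zero, zero_mul, add_zero] at h3
  nlinarith [hA (expOrbit A t c), hA c]

/-- Integrating the derivative of the energy gives `2∫‖A v‖² = ⟪A c, c⟫ - ⟪A v(t), v(t)⟫`. This is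
the source of the `L²(Dom A)` regularity for the heat equation. -/
theorem integral_norm_sq_apply_expOrbit_le {A : H →L[ℝ] H} (hA : ∀ z, 0 ≤ ⟪A z, z⟫_ℝ)
    (hs : ∀ x y, ⟪A x, y⟫_ℝ = ⟪x, A y⟫_ℝ) (c : H) (t : ℝ) :
    ∫ s in (0 : ℝ)..t, ‖A (expOrbit A s c)‖ ^ 2 ≤ ⟪A c, c⟫_ℝ := by
  have hc : Continuous fun s => ‖A (expOrbit A s c)‖ ^ 2 :=
    (A.continuous.comp (continuous_expOrbit A c)).norm.pow 2
  have h1 := intervalIntegral.integral_eq_sub_of_hasDerivAt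
    (fun s _ => hasDerivAt_inner_expOrbit A hs c s)
    ((hc.const_mul (-2 : ℝ)).intervalIntegrable 0 t)
  rw [intervalIntegral.integral_const_mul, expOrbit_zero] at h1
  linarith [hA (expOrbit A t c), hA c]

end Orbit

/-! ### Maximal accretive graphs -/

theorem cauchySeq_of_dense {E : Type*} [NormedAddCommGroup E] [NormedSpace ℝ E]
    {L : ℕ → E →L[ℝ] E} {M : ℝ} (hM : ∀ n z, ‖L n z‖ ≤ M * ‖z‖) {D : Set E} (hD : Dense D)
    (h : ∀ x ∈ D, CauchySeq fun n => L n x) (z : E) : CauchySeq fun n => L n z := by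
  rw [Metric.cauchySeq_iff']
  intro ε hε
  have hM' : (0 : ℝ) < |M| + 1 := by positivity
  obtain ⟨x, hxD, hx⟩ := Metric.dense_iff.1 hD z (ε / 3 / (|M| + 1)) (by positivity)
  have hb : ∀ n, ‖L n z - L n x‖ < ε / 3 := by
    intro n
    rw [← map_sub]
    rw [Metric.mem_ball, dist_comm, dist_eq_norm, lt_div_iff₀ hM'] at hxD
    have h2 : M * ‖z - x‖ ≤ |M| * ‖z - x‖ := by gcongr; exact le_abs_self M
    nlinarith [hM n (z - x), norm_nonneg (z - x)]
  obtain ⟨N, hN⟩ := Metric.cauchySeq_iff'.1 (h x hx) (ε / 3) (by positivity)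
  refine ⟨N, fun n hn => ?_⟩
  have h1 := hN n hn
  rw [dist_eq_norm] at h1 ⊢
  calc ‖L n z - L N z‖ = ‖(L n z - L n x) + (L n x - L N x) - (L N z - L N x)‖ := by congr 1; abel
    _ ≤ ‖L n z - L n x‖ + ‖L n x - L N x‖ + ‖L N z - L N x‖ :=
        (norm_sub_le _ _).trans (by gcongr; exact norm_add_le _ _)
    _ < ε := by linarith [hb n, hb N]

section Accretive

variable {H : Type*} [NormedAddCommGroup H] [InnerProductSpace ℝ H]

/-- The graph of a maximal accretive operator. -/
structure IsMaxAccretive (G : Submodule ℝ (H × H)) : Prop where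
  accretive : ∀ p ∈ G, 0 ≤ ⟪p.1, p.2⟫_ℝ
  range : ∀ l : ℝ, 0 < l → ∀ z, ∃ p ∈ G, p.1 + l • p.2 = z
  singleValued : ∀ y, ((0 : H), y) ∈ G → y = 0

variable {G : Submodule ℝ (H × H)}

theorem IsMaxAccretive.norm_fst_le (hG : IsMaxAccretive G) {l : ℝ} (hl : 0 < l) {p : H × H}
    (hp : p ∈ G) : ‖p.1‖ ≤ ‖p.1 + l • p.2‖ := by
  have h1 : ‖p.1‖ ^ 2 ≤ ‖p.1‖ * ‖p.1 + l • p.2‖ := by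
    refine le_trans ?_ (real_inner_le_norm _ _)
    rw [inner_add_right, inner_smul_right, real_inner_self_eq_norm_sq]
    have := mul_nonneg hl.le (hG.accretive p hp)
    linarith
  rcases (norm_nonneg p.1).eq_or_lt with h | h
  · rw [← h]; exact norm_nonneg _
  · nlinarith

/-- The estimate `norm_fst_le` makes the solution of the range equation unique, which forces linear
dependence on `z` as well as contractivity. -/
theorem IsMaxAccretive.exists_resolvent (hG : IsMaxAccretive G) {l : ℝ} (hl : 0 < l) :
    ∃ R : H →L[ℝ] H, (∀ z, (R z, l⁻¹ • (z - R z)) ∈ G) ∧ (∀ z, ‖R z‖ ≤ ‖z‖) ∧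
      ∀ p ∈ G, R (p.1 + l • p.2) = p.1 := by
  choose q hq hqz using hG.range l hl
  have huniq : ∀ p ∈ G, ∀ p' ∈ G, p.1 + l • p.2 = p'.1 + l • p'.2 → p.1 = p'.1 := by
    intro p hp p' hp' h
    have h1 := hG.norm_fst_le hl (G.sub_mem hp hp')
    have h2 : (p - p').1 + l • (p - p').2 = 0 := by
      rw [Prod.fst_sub, Prod.snd_sub, smul_sub]
      rw [← sub_eq_zero] at h
      rw [← h]; abel
    rw [h2, norm_zero] at h1
    exact sub_eq_zero.1 (norm_le_zero_iff.1 h1)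
  have hR : ∀ p ∈ G, (q (p.1 + l • p.2)).1 = p.1 := fun p hp =>
    huniq _ (hq _) _ hp (hqz _)
  have hadd : ∀ x y, (q (x + y)).1 = (q x).1 + (q y).1 := by
    intro x y
    have := hR _ (G.add_mem (hq x) (hq y))
    rw [← Prod.fst_add, ← this]
    congr 2
    rw [Prod.fst_add, Prod.snd_add, smul_add]
    nth_rewrite 1 [← hqz x, ← hqz y]
    abel
  have hsmul : ∀ (c : ℝ) x, (q (c • x)).1 = c • (q x).1 := by
    intro c x
    have := hR _ (G.smul_mem c (hq x))
    rw [← Prod.smul_fst, ← this]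
    congr 2
    rw [Prod.smul_fst, Prod.smul_snd, smul_comm l c, ← smul_add, hqz]
  refine ⟨LinearMap.mkContinuous ⟨⟨fun z => (q z).1, hadd⟩, hsmul⟩ 1 fun z => ?_, fun z => ?_,
    fun z => ?_, hR⟩
  · rw [one_mul]
    refine (hG.norm_fst_le hl (hq z)).trans ?_
    rw [hqz]
  · have h1 : l⁻¹ • (z - (q z).1) = (q z).2 := by
      nth_rewrite 1 [← hqz z]
      rw [add_sub_cancel_left, inv_smul_smul₀ hl.ne']
    change ((q z).1, l⁻¹ • (z - (q z).1)) ∈ G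
    rw [h1]
    exact hq z
  · refine (hG.norm_fst_le hl (hq z)).trans ?_
    rw [hqz]

/-- Membership in the graph is a linear equation for bounded operators. -/
theorem IsMaxAccretive.exists_mem_iff (hG : IsMaxAccretive G) :
    ∃ R : H →L[ℝ] H, ∀ p, p ∈ G ↔ R (p.1 + p.2) = p.1 := by
  obtain ⟨R, h1, -, h3⟩ := hG.exists_resolvent one_pos
  refine ⟨R, fun p => ⟨fun hp => by simpa using h3 p hp, fun hp => ?_⟩⟩
  have := h1 (p.1 + p.2)
  rw [hp] at this
  simpa using this

theorem IsMaxAccretive.isClosed (hG : IsMaxAccretive G) : IsClosed (G : Set (H × H)) := by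
  obtain ⟨R, hR⟩ := hG.exists_mem_iff
  have : (G : Set (H × H)) = {p | R (p.1 + p.2) = p.1} := by ext p; exact hR p
  rw [this]
  exact isClosed_eq (by fun_prop) (by fun_prop)

/-- For `h` orthogonal to the domain, solve `x + A x = h` and pair with `x`: accretivity gives `x =
0`, and single-valuedness then gives `A x = 0`, so `h = 0`. -/
theorem IsMaxAccretive.dense_domain [CompleteSpace H] (hG : IsMaxAccretive G) :
    Dense (Prod.fst '' (G : Set (H × H))) := by
  have : Prod.fst '' (G : Set (H × H)) =
      ((G.map (LinearMap.fst ℝ H H) : Submodule ℝ H) : Set H) := by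
    ext x; simp
  rw [this, Submodule.dense_iff_topologicalClosure_eq_top, Submodule.topologicalClosure_eq_top_iff,
    Submodule.eq_bot_iff]
  intro h hh
  rw [Submodule.mem_orthogonal] at hh
  obtain ⟨p, hp, hph⟩ := hG.range 1 one_pos h
  rw [one_smul] at hph
  have h1 : ⟪p.1, h⟫_ℝ = 0 := hh _ ⟨p, hp, rfl⟩
  rw [← hph, inner_add_right] at h1
  have h2 := hG.accretive p hp
  have h3 : p.1 = 0 := by
    rw [← norm_le_zero_iff]
    have h5 := real_inner_self_eq_norm_sq p.1
    nlinarith [norm_nonneg p.1]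
  have h4 := hG.singleValued p.2 (by rw [← h3]; exact hp)
  rw [← hph, h3, h4, add_zero]

end Accretive

/-! ### Yosida approximation -/

section Yosida

variable {H : Type*} [NormedAddCommGroup H] [InnerProductSpace ℝ H] {G : Submodule ℝ (H × H)}

/-- The Yosida approximations `A n = (1 - R n) / l n` of an accretive operator, `R n` being the
resolvent with parameter `l n`. -/
structure IsYosida (G : Submodule ℝ (H × H)) (l : ℕ → ℝ) (R A : ℕ → H →L[ℝ] H) : Prop where
  pos : ∀ n, 0 < l n
  lim : Tendsto l atTop (𝓝 0)
  mem : ∀ n z, (R n z, A n z) ∈ G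
  add : ∀ n z, R n z + l n • A n z = z
  norm_le : ∀ n z, ‖R n z‖ ≤ ‖z‖
  apply_fst : ∀ n, ∀ p ∈ G, A n p.1 = R n p.2

theorem IsMaxAccretive.exists_yosida (hG : IsMaxAccretive G) :
    ∃ (l : ℕ → ℝ) (R A : ℕ → H →L[ℝ] H), IsYosida G l R A := by
  have hl : ∀ n : ℕ, (0 : ℝ) < 1 / ((n : ℝ) + 1) := fun n => by positivity
  choose R h1 h2 h3 using fun n => hG.exists_resolvent (hl n)
  refine ⟨fun n => 1 / ((n : ℝ) + 1), R,
    fun n => (1 / ((n : ℝ) + 1))⁻¹ • (ContinuousLinearMap.id ℝ H - R n),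
    hl, tendsto_one_div_add_atTop_nhds_zero_nat, ?_, ?_, h2, ?_⟩
  · intro n z
    exact h1 n z
  · intro n z
    change R n z + (1 / ((n : ℝ) + 1)) • ((1 / ((n : ℝ) + 1))⁻¹ • (z - R n z)) = z
    rw [smul_inv_smul₀ (hl n).ne']
    abel
  · intro n p hp
    change (1 / ((n : ℝ) + 1))⁻¹ • (p.1 - R n p.1) = R n p.2
    rw [inv_smul_eq_iff₀ (hl n).ne']
    nth_rewrite 1 [← h3 n p hp]
    rw [map_add, map_smul, add_sub_cancel_left]

variable {l : ℕ → ℝ} {R A : ℕ → H →L[ℝ] H}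

namespace IsYosida

theorem accretive (hG : IsMaxAccretive G) (hY : IsYosida G l R A) (n : ℕ) (z : H) :
    0 ≤ ⟪A n z, z⟫_ℝ := by
  nth_rewrite 2 [← hY.add n z]
  rw [inner_add_right, inner_smul_right, real_inner_comm]
  have h1 := hG.accretive _ (hY.mem n z)
  have h2 : 0 ≤ ⟪A n z, A n z⟫_ℝ := real_inner_self_nonneg
  have := mul_nonneg (hY.pos n).le h2
  simp only at h1
  linarith

theorem inner_fst_le (hY : IsYosida G l R A) (n : ℕ) (z : H) :
    ⟪A n z, R n z⟫_ℝ ≤ ⟪A n z, z⟫_ℝ := by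
  nth_rewrite 4 [← hY.add n z]
  rw [inner_add_right, inner_smul_right]
  have h2 : 0 ≤ ⟪A n z, A n z⟫_ℝ := real_inner_self_nonneg
  have := mul_nonneg (hY.pos n).le h2
  linarith

theorem symm (hY : IsYosida G l R A) (hs : ∀ p ∈ G, ∀ q ∈ G, ⟪p.2, q.1⟫_ℝ = ⟪p.1, q.2⟫_ℝ)
    (n : ℕ) (x y : H) : ⟪A n x, y⟫_ℝ = ⟪x, A n y⟫_ℝ := by
  nth_rewrite 1 [← hY.add n y]
  nth_rewrite 2 [← hY.add n x]
  have := hs _ (hY.mem n x) _ (hY.mem n y)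
  simp only at this
  rw [inner_add_right, inner_smul_right, inner_add_left, inner_smul_left, this]
  simp

theorem norm_apply_fst_le (hY : IsYosida G l R A) (n : ℕ) {p : H × H} (hp : p ∈ G) :
    ‖A n p.1‖ ≤ ‖p.2‖ := by
  rw [hY.apply_fst n p hp]
  exact hY.norm_le n _

/-- A limit of `(v n, A n (v n))` with `v n` convergent lies in the graph. -/
theorem mem_of_tendsto (hG : IsMaxAccretive G) (hY : IsYosida G l R A) {v : ℕ → H} {x y : H}
    (hv : Tendsto v atTop (𝓝 x)) (hw : Tendsto (fun n => A n (v n)) atTop (𝓝 y)) :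
    (x, y) ∈ G := by
  have h1 : Tendsto (fun n => R n (v n)) atTop (𝓝 x) := by
    have h2 := hv.sub (hY.lim.smul hw)
    rw [zero_smul, sub_zero] at h2
    refine h2.congr fun n => ?_
    nth_rewrite 1 [← hY.add n (v n)]
    abel
  exact hG.isClosed.mem_of_tendsto (h1.prodMk_nhds hw) (Eventually.of_forall fun n => hY.mem n _)

variable [CompleteSpace H]

/-- On the domain the error is `l n • A n x`, of norm at most `l n * ‖A x‖`; contractivity extends
the limit from the dense domain. -/
theorem tendsto_resolvent (hG : IsMaxAccretive G) (hY : IsYosida G l R A) (z : H) :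
    Tendsto (fun n => R n z) atTop (𝓝 z) := by
  have hdom : ∀ p ∈ G, Tendsto (fun n => R n p.1) atTop (𝓝 p.1) := by
    intro p hp
    rw [tendsto_iff_norm_sub_tendsto_zero]
    have h1 : Tendsto (fun n => l n * ‖p.2‖) atTop (𝓝 0) := by
      simpa using hY.lim.mul_const ‖p.2‖
    refine squeeze_zero (fun _ => norm_nonneg _) (fun n => ?_) h1
    have : R n p.1 - p.1 = -(l n • A n p.1) := by
      nth_rewrite 2 [← hY.add n p.1]
      abel
    rw [this, norm_neg, norm_smul, Real.norm_of_nonneg (hY.pos n).le]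
    have := hY.norm_apply_fst_le n hp
    have := (hY.pos n).le
    gcongr
  rw [Metric.tendsto_atTop]
  intro ε hε
  obtain ⟨x, hxD, ⟨p, hp, hpx⟩⟩ := Metric.dense_iff.1 hG.dense_domain z (ε / 3) (by positivity)
  subst hpx
  rw [Metric.mem_ball, dist_comm, dist_eq_norm] at hxD
  obtain ⟨N, hN⟩ := Metric.tendsto_atTop.1 (hdom p hp) (ε / 3) (by positivity)
  refine ⟨N, fun n hn => ?_⟩
  have h1 := hN n hn
  have h2 := hY.norm_le n (z - p.1)
  rw [dist_eq_norm] at h1 ⊢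
  calc ‖R n z - z‖ = ‖R n (z - p.1) + (R n p.1 - p.1) - (z - p.1)‖ := by
        rw [map_sub]; congr 1; abel
    _ ≤ ‖R n (z - p.1)‖ + ‖R n p.1 - p.1‖ + ‖z - p.1‖ :=
        (norm_sub_le _ _).trans (by gcongr; exact norm_add_le _ _)
    _ < ε := by linarith

theorem norm_apply_expOrbit_le (hG : IsMaxAccretive G) (hY : IsYosida G l R A) (n : ℕ)
    {p : H × H} (hp : p ∈ G) {t : ℝ} (ht : 0 ≤ t) : ‖A n (expOrbit (A n) t p.1)‖ ≤ ‖p.2‖ := by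
  rw [apply_expOrbit]
  exact (norm_expOrbit_le (hY.accretive hG n) _ ht).trans (hY.norm_apply_fst_le n hp)

/-- Kato's estimate for the difference of two approximate solutions. -/
theorem norm_sq_expOrbit_sub_le (hG : IsMaxAccretive G) (hY : IsYosida G l R A) (n m : ℕ)
    {p : H × H} (hp : p ∈ G) {t : ℝ} (ht : 0 ≤ t) :
    ‖expOrbit (A n) t p.1 - expOrbit (A m) t p.1‖ ^ 2 ≤ 4 * (l n + l m) * ‖p.2‖ ^ 2 * t := by
  -- Twice the product of the bounds `(l n + l m)‖p.2‖` and `2‖p.2‖` obtained below; the outer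
  -- factor 2 comes from differentiating a square.
  set K := 4 * (l n + l m) * ‖p.2‖ ^ 2 with hK
  have h : ∀ t, HasDerivAt
      (fun t => ‖expOrbit (A n) t p.1 - expOrbit (A m) t p.1‖ ^ 2 - K * t)
      (2 * ⟪expOrbit (A n) t p.1 - expOrbit (A m) t p.1,
        -(A n (expOrbit (A n) t p.1)) - -(A m (expOrbit (A m) t p.1))⟫_ℝ - K) t := by
    intro t
    have h1 := ((hasDerivAt_expOrbit (A n) p.1 t).sub (hasDerivAt_expOrbit (A m) p.1 t)).norm_sq
    have h2 : HasDerivAt (fun t => K * t) K t := by simpa using (hasDerivAt_id t).const_mul K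
    exact h1.sub h2
  have h0 := le_initial_of_hasDerivAt_nonpos h (fun t ht => ?_) ht
  · simp only [expOrbit_zero, sub_self, norm_zero, mul_zero] at h0
    linarith
  · set v := expOrbit (A n) t p.1
    set w := expOrbit (A m) t p.1
    have e1 := hY.add n v
    have e2 := hY.add m w
    have ha : ‖A n v‖ ≤ ‖p.2‖ := hY.norm_apply_expOrbit_le hG n hp ht
    have hb : ‖A m w‖ ≤ ‖p.2‖ := hY.norm_apply_expOrbit_le hG m hp ht
    have hacc := hG.accretive _ (G.sub_mem (hY.mem n v) (hY.mem m w))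
    simp only [Prod.fst_sub, Prod.snd_sub] at hacc
    -- Accretivity of the graph controls the resolvent part of the difference; the remainder is
    -- small with `l n` and `l m`.
    have hvw : v - w = (R n v - R m w) + (l n • A n v - l m • A m w) := by
      nth_rewrite 1 [← e1, ← e2]; abel
    have hneg : -(A n v) - -(A m w) = -(A n v - A m w) := by abel
    have hc : |⟪l n • A n v - l m • A m w, A n v - A m w⟫_ℝ| ≤
        ((l n + l m) * ‖p.2‖) * (2 * ‖p.2‖) := by
      refine (abs_real_inner_le_norm _ _).trans ?_
      have hn := (hY.pos n).le
      have hm := (hY.pos m).le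
      have k1 : ‖l n • A n v - l m • A m w‖ ≤ (l n + l m) * ‖p.2‖ := by
        refine (norm_sub_le _ _).trans ?_
        rw [norm_smul, norm_smul, Real.norm_of_nonneg hn, Real.norm_of_nonneg hm, add_mul]
        gcongr
      have k2 : ‖A n v - A m w‖ ≤ 2 * ‖p.2‖ := by
        refine (norm_sub_le _ _).trans ?_
        linarith
      gcongr
    rw [hneg, inner_neg_right, hvw, inner_add_left]
    have := (abs_le.1 hc).1
    rw [hK]
    nlinarith

theorem cauchySeq_expOrbit (hG : IsMaxAccretive G) (hY : IsYosida G l R A) (c : H) {t : ℝ}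
    (ht : 0 ≤ t) : CauchySeq fun n => expOrbit (A n) t c := by
  refine cauchySeq_of_dense (M := 1) (L := fun n => expOrbit (A n) t) (fun n z => ?_)
    hG.dense_domain ?_ c
  · rw [one_mul]
    exact norm_expOrbit_le (hY.accretive hG n) z ht
  · rintro _ ⟨p, hp, rfl⟩
    rw [Metric.cauchySeq_iff']
    intro ε hε
    have h1 : Tendsto (fun n => 8 * ‖p.2‖ ^ 2 * t * l n) atTop (𝓝 0) := by
      simpa using hY.lim.const_mul (8 * ‖p.2‖ ^ 2 * t)
    have h2 := h1.eventually (gt_mem_nhds (show (0 : ℝ) < ε ^ 2 by positivity))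
    obtain ⟨N, hN⟩ := eventually_atTop.1 h2
    refine ⟨N, fun n hn => ?_⟩
    have h3 := hY.norm_sq_expOrbit_sub_le hG n N hp ht
    rw [dist_eq_norm]
    refine lt_of_pow_lt_pow_left₀ 2 hε.le ?_
    linarith [hN n hn, hN N le_rfl]

theorem exists_tendsto_expOrbit (hG : IsMaxAccretive G) (hY : IsYosida G l R A) (c : H) :
    ∃ v : ℝ → H, StronglyMeasurable v ∧
      (∀ t, 0 ≤ t → Tendsto (fun n => expOrbit (A n) t c) atTop (𝓝 (v t))) ∧
      ∀ t, 0 ≤ t → ‖v t‖ ≤ ‖c‖ := by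
  choose! v hv using fun t (ht : 0 ≤ t) => cauchySeq_tendsto_of_complete
    (hY.cauchySeq_expOrbit hG c ht)
  -- Cutting off negative times, where no convergence is known, makes the limit hold at every real
  -- time and so gives measurability.
  refine ⟨(Ici 0).indicator v, ?_, ?_, ?_⟩
  · refine stronglyMeasurable_of_tendsto atTop (f := fun n => (Ici 0).indicator
      fun t => expOrbit (A n) t c) (fun n =>
        (continuous_expOrbit (A n) c).stronglyMeasurable.indicator measurableSet_Ici) ?_
    rw [tendsto_pi_nhds]
    intro t
    by_cases ht : t ∈ Ici (0 : ℝ)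
    · simp only [indicator_of_mem ht]
      exact hv t ht
    · simp only [indicator_of_notMem ht]
      exact tendsto_const_nhds
  · intro t ht
    rw [indicator_of_mem (mem_Ici.2 ht)]
    exact hv t ht
  · intro t ht
    rw [indicator_of_mem (mem_Ici.2 ht)]
    exact le_of_tendsto' (hv t ht).norm fun n => norm_expOrbit_le (hY.accretive hG n) c ht

end IsYosida

variable [CompleteSpace H]

/-- The weight `exp(κt)` turns an orbit of `A` into one of `A - κ`, which undoes a shift of the
operator; `κ = 0` is the plain integrated equation. -/
theorem expOrbit_integral_eq (A : H →L[ℝ] H) (c : H) (κ t : ℝ) :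
    Real.exp (κ * t) • expOrbit A t c =
      c - ∫ s in (0 : ℝ)..t, Real.exp (κ * s) • (A (expOrbit A s c) - κ • expOrbit A s c) := by
  have hd : ∀ s, HasDerivAt (fun s => Real.exp (κ * s) • expOrbit A s c)
      (-(Real.exp (κ * s) • (A (expOrbit A s c) - κ • expOrbit A s c))) s := by
    intro s
    have h1 : HasDerivAt (fun s => Real.exp (κ * s)) (Real.exp (κ * s) * κ) s := by
      simpa using ((hasDerivAt_id s).const_mul κ).exp
    refine (h1.smul (hasDerivAt_expOrbit A c s)).congr_deriv ?_
    rw [smul_neg, smul_sub, smul_smul]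
    abel
  have hc : Continuous fun s => -(Real.exp (κ * s) • (A (expOrbit A s c) - κ • expOrbit A s c)) := by
    have h1 := continuous_expOrbit A c
    have h2 := A.continuous.comp h1
    have h3 : Continuous fun s : ℝ => Real.exp (κ * s) := by fun_prop
    exact (h3.smul (h2.sub (h1.const_smul κ))).neg
  have h := intervalIntegral.integral_eq_sub_of_hasDerivAt (fun s _ => hd s)
    (hc.intervalIntegrable 0 t)
  rw [intervalIntegral.integral_neg] at h
  simp only [mul_zero, Real.exp_zero, one_smul, expOrbit_zero] at h
  rw [sub_eq_add_neg c, h]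
  abel

/-- Orbits starting in the domain. -/
theorem IsMaxAccretive.exists_orbit (hG : IsMaxAccretive G) {b c : H} (hbc : (b, c) ∈ G) :
    ∃ v w : ℝ → H, StronglyMeasurable v ∧ StronglyMeasurable w ∧
      (∀ t, 0 ≤ t → (v t, w t) ∈ G ∧ ‖v t‖ ≤ ‖b‖ ∧ ‖w t‖ ≤ ‖c‖) ∧
      ∀ κ t : ℝ, 0 ≤ t → Real.exp (κ * t) • v t =
        b - ∫ s in (0 : ℝ)..t, Real.exp (κ * s) • (w s - κ • v s) := by
  obtain ⟨l, R, A, hY⟩ := hG.exists_yosida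
  obtain ⟨v, hvm, hv, hvb⟩ := hY.exists_tendsto_expOrbit hG b
  obtain ⟨w, hwm, hw, hwc⟩ := hY.exists_tendsto_expOrbit hG c
  -- On the domain `A n` acts as `R n` after the operator, so `A n` of the orbit of `b` is the orbit
  -- of `R n c`, and `R n c → c`.
  have hAw : ∀ t, 0 ≤ t → Tendsto (fun n => A n (expOrbit (A n) t b)) atTop (𝓝 (w t)) := by
    intro t ht
    have h1 : Tendsto (fun n => expOrbit (A n) t (R n c - c)) atTop (𝓝 0) := by
      refine squeeze_zero_norm (fun n => norm_expOrbit_le (hY.accretive hG n) _ ht) ?_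
      exact tendsto_iff_norm_sub_tendsto_zero.1 (hY.tendsto_resolvent hG c)
    have h2 := h1.add (hw t ht)
    rw [zero_add] at h2
    refine h2.congr fun n => ?_
    rw [apply_expOrbit, ← map_add, hY.apply_fst n _ hbc]
    simp
  refine ⟨v, w, hvm, hwm, fun t ht =>
    ⟨hY.mem_of_tendsto hG (hv t ht) (hAw t ht), hvb t ht, hwc t ht⟩, fun κ t ht => ?_⟩
  refine tendsto_nhds_unique ((hv t ht).const_smul (Real.exp (κ * t))) ?_
  simp_rw [expOrbit_integral_eq]
  refine tendsto_const_nhds.sub ?_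
  refine intervalIntegral.tendsto_integral_filter_of_dominated_convergence
    (fun s => Real.exp (κ * s) * (‖c‖ + |κ| * ‖b‖)) ?_ ?_ ?_ ?_
  · refine Eventually.of_forall fun n => Continuous.aestronglyMeasurable ?_
    have h1 := continuous_expOrbit (A n) b
    have h2 := (A n).continuous.comp h1
    have h3 : Continuous fun s : ℝ => Real.exp (κ * s) := by fun_prop
    exact h3.smul (h2.sub (h1.const_smul κ))
  · refine Eventually.of_forall fun n => ae_of_all _ fun s hs => ?_
    rw [uIoc_of_le ht] at hs
    rw [norm_smul, Real.norm_of_nonneg (Real.exp_pos _).le]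
    gcongr
    refine (norm_sub_le _ _).trans ?_
    rw [norm_smul, Real.norm_eq_abs]
    have k1 := hY.norm_apply_expOrbit_le hG n hbc hs.1.le
    have k2 := norm_expOrbit_le (hY.accretive hG n) b hs.1.le
    simp only at k1
    gcongr
  · exact Continuous.intervalIntegrable (by fun_prop) _ _
  · refine ae_of_all _ fun s hs => ?_
    rw [uIoc_of_le ht] at hs
    exact ((hAw s hs.1.le).sub ((hv s hs.1.le).const_smul κ)).const_smul _

/-- Orbits of a self-adjoint operator starting in the form domain. -/
theorem IsMaxAccretive.exists_orbit_of_symm (hG : IsMaxAccretive G)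
    (hs : ∀ p ∈ G, ∀ q ∈ G, ⟪p.2, q.1⟫_ℝ = ⟪p.1, q.2⟫_ℝ) {g : H} {C : ℝ}
    (hg : ∀ p ∈ G, ⟪p.2, g⟫_ℝ ^ 2 ≤ C * ⟪p.2, p.1⟫_ℝ) :
    ∃ v w : ℝ → H, StronglyMeasurable v ∧ StronglyMeasurable w ∧
      (∀ t, 0 < t → (v t, w t) ∈ G) ∧ (∀ t, 0 ≤ t → ‖v t‖ ≤ ‖g‖) ∧
      (∀ T : ℝ, 0 ≤ T → MemLp w 2 (volume.restrict (Ioc 0 T))) ∧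
      ∀ t : ℝ, 0 ≤ t → v t = g - ∫ s in (0 : ℝ)..t, w s := by
  obtain ⟨l, R, A, hY⟩ := hG.exists_yosida
  have hAs := fun n => hY.symm hs n
  have hAp := fun n => hY.accretive hG n
  obtain ⟨v, hvm, hv, hvb⟩ := hY.exists_tendsto_expOrbit hG g
  -- The hypothesis at `(R n g, A n g)` gives `⟪A n g, g⟫² ≤ |C| ⟪A n g, g⟫`; dividing bounds the
  -- approximate energies of `g` uniformly in `n`.
  have hC : ∀ n, ⟪A n g, g⟫_ℝ ≤ |C| := by
    intro n
    have h1 := hg _ (hY.mem n g)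
    simp only at h1
    have h2 := hY.inner_fst_le n g
    have h3 := hAp n g
    have h4 : 0 ≤ ⟪A n g, R n g⟫_ℝ := by
      rw [real_inner_comm]; exact hG.accretive _ (hY.mem n g)
    rcases h3.eq_or_lt with h | h
    · rw [← h]; exact abs_nonneg C
    · have h5 : ⟪A n g, g⟫_ℝ ^ 2 ≤ |C| * ⟪A n g, g⟫_ℝ := h1.trans (by
        calc C * ⟪A n g, R n g⟫_ℝ ≤ |C| * ⟪A n g, R n g⟫_ℝ := by gcongr; exact le_abs_self C
          _ ≤ |C| * ⟪A n g, g⟫_ℝ := by gcongr)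
      nlinarith
  -- The smoothing bound `1/t` is uniform in `n`, so convergence for data in the domain extends to
  -- all data at positive times.
  have hcauchy : ∀ t, 0 < t → ∀ c, CauchySeq fun n => A n (expOrbit (A n) t c) := by
    intro t ht c
    refine cauchySeq_of_dense (M := t⁻¹) (L := fun n => (A n).comp (expOrbit (A n) t))
      (fun n z => ?_) hG.dense_domain ?_ c
    · have h1 := sq_mul_norm_sq_apply_expOrbit_le (hAp n) (hAs n) z ht.le
      rw [← mul_pow] at h1
      have h2 := le_of_sq_le_sq h1 (norm_nonneg z)
      rw [inv_mul_eq_div, le_div_iff₀ ht, mul_comm]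
      exact h2
    · rintro _ ⟨p, hp, rfl⟩
      have h1 : Tendsto (fun n => expOrbit (A n) t (R n p.2 - p.2)) atTop (𝓝 0) := by
        refine squeeze_zero_norm (fun n => norm_expOrbit_le (hAp n) _ ht.le) ?_
        exact tendsto_iff_norm_sub_tendsto_zero.1 (hY.tendsto_resolvent hG p.2)
      have h2 := h1.cauchySeq.add (hY.cauchySeq_expOrbit hG p.2 ht.le)
      have h3 : (fun n => ((A n).comp (expOrbit (A n) t)) p.1) =
          (fun n => expOrbit (A n) t (R n p.2 - p.2)) + fun n => expOrbit (A n) t p.2 := by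
        funext n
        rw [Pi.add_apply, ← map_add, sub_add_cancel, ContinuousLinearMap.comp_apply,
          apply_expOrbit, hY.apply_fst n _ hp]
      rw [h3]
      exact h2
  choose! w hw using fun t (ht : 0 < t) => cauchySeq_tendsto_of_complete (hcauchy t ht g)
  have hcont : ∀ n, Continuous fun t => A n (expOrbit (A n) t g) := fun n =>
    (A n).continuous.comp (continuous_expOrbit (A n) g)
  have hwm : StronglyMeasurable ((Ioi 0).indicator w) := by
    refine stronglyMeasurable_of_tendsto atTop (f := fun n => (Ioi 0).indicator
      fun t => A n (expOrbit (A n) t g)) (fun n =>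
        (hcont n).stronglyMeasurable.indicator measurableSet_Ioi) ?_
    rw [tendsto_pi_nhds]
    intro t
    by_cases ht : t ∈ Ioi (0 : ℝ)
    · simp only [indicator_of_mem ht]
      exact hw t ht
    · simp only [indicator_of_notMem ht]
      exact tendsto_const_nhds
  refine ⟨v, (Ioi 0).indicator w, hvm, hwm, fun t ht => ?_, hvb, fun T hT => ?_, fun t ht => ?_⟩
  · rw [indicator_of_mem (mem_Ioi.2 ht)]
    exact hY.mem_of_tendsto hG (hv t ht.le) (hw t ht)
  · refine ⟨hwm.aestronglyMeasurable, ?_⟩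
    -- Fatou's lemma carries the uniform energy bound over to the limit.
    have h1 : eLpNorm ((Ioi 0).indicator w) 2 (volume.restrict (Ioc 0 T)) ≤
        liminf (fun n => eLpNorm (fun t => A n (expOrbit (A n) t g)) 2
          (volume.restrict (Ioc 0 T))) atTop := by
      refine Lp.eLpNorm_lim_le_liminf_eLpNorm (fun n => (hcont n).aestronglyMeasurable) _ ?_
      filter_upwards [ae_restrict_mem measurableSet_Ioc] with t ht
      rw [indicator_of_mem (mem_Ioi.2 ht.1)]
      exact hw t ht.1
    refine h1.trans_lt ?_
    have h2 : ∀ n, eLpNorm (fun t => A n (expOrbit (A n) t g)) 2 (volume.restrict (Ioc 0 T)) ≤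
        ENNReal.ofReal (√|C|) := by
      intro n
      have h3 := (integral_norm_sq_apply_expOrbit_le (hAp n) (hAs n) g T).trans (hC n)
      rw [intervalIntegral.integral_of_le hT] at h3
      have h4 : ENNReal.ofReal (∫ t in Ioc 0 T, ‖A n (expOrbit (A n) t g)‖ ^ 2) =
          ∫⁻ t in Ioc 0 T, ENNReal.ofReal (‖A n (expOrbit (A n) t g)‖ ^ 2) :=
        ofReal_integral_eq_lintegral_ofReal ((hcont n).norm.pow 2).integrableOn_Ioc
          (ae_of_all _ fun _ => sq_nonneg _)
      have h5 : eLpNorm (fun t => A n (expOrbit (A n) t g)) 2 (volume.restrict (Ioc 0 T)) ^ 2 ≤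
          ENNReal.ofReal (√|C|) ^ 2 := by
        rw [eLpNorm_two_sq_eq_lintegral, ← ENNReal.ofReal_pow (by positivity),
          Real.sq_sqrt (abs_nonneg C)]
        refine le_trans (le_of_eq ?_) (ENNReal.ofReal_le_ofReal h3)
        rw [h4]
        refine lintegral_congr fun t => ?_
        rw [ENNReal.ofReal_pow (norm_nonneg _), ofReal_norm]
      exact (ENNReal.pow_le_pow_left_iff (by norm_num)).1 h5
    refine lt_of_le_of_lt (b := ENNReal.ofReal (√|C|))
      (liminf_le_of_le (by isBoundedDefault) fun b hb => ?_) ENNReal.ofReal_lt_top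
    obtain ⟨n, hn⟩ := hb.exists
    exact hn.trans (h2 n)
  · refine tendsto_nhds_unique (hv t ht) ?_
    have h1 : ∀ n, expOrbit (A n) t g = g - ∫ s in (0 : ℝ)..t, A n (expOrbit (A n) s g) := by
      intro n
      simpa using expOrbit_integral_eq (A n) g 0 t
    simp_rw [h1]
    refine tendsto_const_nhds.sub ?_
    refine intervalIntegral.tendsto_integral_filter_of_dominated_convergence
      -- The dominating function comes from `mul_norm_sq_apply_expOrbit_le` and the uniform energy
      -- bound.
      (fun s => √|C| * s ^ (-(1 / 2) : ℝ)) ?_ ?_ ?_ ?_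
    · exact Eventually.of_forall fun n => (hcont n).aestronglyMeasurable
    · refine Eventually.of_forall fun n => ae_of_all _ fun s hs => ?_
      rw [uIoc_of_le ht] at hs
      have k1 := (mul_norm_sq_apply_expOrbit_le (hAp n) (hAs n) g hs.1.le).trans (hC n)
      have k2 : √s * ‖A n (expOrbit (A n) s g)‖ ≤ √|C| := by
        refine Real.le_sqrt_of_sq_le ?_
        rw [mul_pow, Real.sq_sqrt hs.1.le]
        exact k1
      rw [Real.rpow_neg hs.1.le, ← Real.sqrt_eq_rpow, ← div_eq_mul_inv,
        le_div_iff₀ (Real.sqrt_pos.2 hs.1), mul_comm]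
      exact k2
    · exact (intervalIntegral.intervalIntegrable_rpow' (by norm_num)).const_mul _
    · refine ae_of_all _ fun s hs => ?_
      rw [uIoc_of_le ht] at hs
      rw [indicator_of_mem (mem_Ioi.2 hs.1)]
      exact hw s hs.1

end Yosida

/-! ### Quasi-accretive operators and uniqueness -/

section Shift

variable {H : Type*} [NormedAddCommGroup H] [InnerProductSpace ℝ H]

/-- The graph of `A + κ`, given the graph of `A`. -/
def shiftGraph (G : Submodule ℝ (H × H)) (κ : ℝ) : Submodule ℝ (H × H) :=
  G.comap ((LinearMap.fst ℝ H H).prod (LinearMap.snd ℝ H H - κ • LinearMap.fst ℝ H H))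

theorem mem_shiftGraph {G : Submodule ℝ (H × H)} {κ : ℝ} {x y : H} :
    (x, y) ∈ shiftGraph G κ ↔ (x, y - κ • x) ∈ G := Iff.rfl

theorem add_mem_shiftGraph {G : Submodule ℝ (H × H)} {κ : ℝ} {x y : H} (h : (x, y) ∈ G) :
    (x, y + κ • x) ∈ shiftGraph G κ := by
  rw [mem_shiftGraph, add_sub_cancel_right]
  exact h

/-- A linear equation with a bounded operator passes through Bochner integrals, Wiener integrals and
lifted kernels. It does the work of closedness of `A` in both uniqueness and existence. -/
theorem IsMaxAccretive.exists_mem_iff_of_shift {G : Submodule ℝ (H × H)} {κ : ℝ}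
    (hG : IsMaxAccretive (shiftGraph G κ)) :
    ∃ (R : H →L[ℝ] H) (c : ℝ), ∀ x y, (x, y) ∈ G ↔ R (c • x + y) = x := by
  obtain ⟨R, hR⟩ := hG.exists_mem_iff
  refine ⟨R, 1 + κ, fun x y => ?_⟩
  have h := hR (x, y + κ • x)
  rw [mem_shiftGraph, add_sub_cancel_right] at h
  rw [show (1 + κ) • x + y = x + (y + κ • x) by module]
  exact h

theorem IsMaxAccretive.shift_singleValued {G : Submodule ℝ (H × H)} {κ : ℝ}
    (hG : IsMaxAccretive (shiftGraph G κ)) {y : H} (hy : ((0 : H), y) ∈ G) : y = 0 := by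
  refine hG.singleValued y ?_
  rw [mem_shiftGraph]
  simpa using hy

/-- Uniqueness for `D' = -A D`, `D(0) = 0`. -/
theorem IsMaxAccretive.eq_zero_of_integral [CompleteSpace H] {G : Submodule ℝ (H × H)} {κ : ℝ}
    (hG : IsMaxAccretive (shiftGraph G κ)) {T : ℝ} {y D : ℝ → H} (hy : IntegrableOn y (Icc 0 T))
    (hD : ∀ t ∈ Icc 0 T, D t = -∫ s in (0 : ℝ)..t, y s)
    (h : ∀ᵐ t ∂(volume.restrict (Icc 0 T)), (D t, y t) ∈ G) {t : ℝ} (ht : t ∈ Icc 0 T) :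
    D t = 0 := by
  obtain ⟨R, c, hR⟩ := hG.exists_mem_iff_of_shift
  set y0 := (Icc 0 T).indicator y with hy0
  have hy0i : Integrable y0 := (integrable_indicator_iff measurableSet_Icc).2 hy
  set E : ℝ → H := fun t => -∫ s in (0 : ℝ)..t, y0 s with hE
  have hEc : Continuous E := (intervalIntegral.continuous_primitive
    (fun a b => hy0i.intervalIntegrable) 0).neg
  have hED : ∀ t ∈ Icc 0 T, E t = D t := by
    intro t ht
    rw [hD t ht, hE]
    simp only [neg_inj]
    refine intervalIntegral.integral_congr fun s hs => ?_
    rw [uIcc_of_le ht.1] at hs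
    rw [hy0, indicator_of_mem]
    exact ⟨hs.1, hs.2.trans ht.2⟩
  -- `D` is in the domain only at almost every time and need not be differentiable there. Its
  -- primitive is continuously differentiable, stays in the domain at every time of `[0,T]`, and
  -- satisfies `z' = -A z`.
  set z : ℝ → H := fun t => ∫ s in (0 : ℝ)..t, E s with hz
  have hzd : ∀ t, HasDerivAt z (E t) t := fun t =>
    intervalIntegral.integral_hasDerivAt_right (hEc.intervalIntegrable _ _)
      hEc.stronglyMeasurable.stronglyMeasurableAtFilter hEc.continuousAt
  have hmem : ∀ t ∈ Icc 0 T, (z t, -(E t)) ∈ G := by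
    intro t ht
    rw [hR]
    have h1 : z t = ∫ s in (0 : ℝ)..t, R (c • E s + y0 s) := by
      rw [hz]
      refine intervalIntegral.integral_congr_ae ?_
      rw [uIoc_of_le ht.1]
      have h2 := (ae_restrict_iff' measurableSet_Icc).1 h
      filter_upwards [h2] with s hs hst
      have hs' : s ∈ Icc 0 T := ⟨hst.1.le, hst.2.trans ht.2⟩
      have h3 := (hR _ _).1 (hs hs')
      rw [hED s hs', hy0, indicator_of_mem hs', h3]
    have h4 : IntervalIntegrable (fun s => c • E s) volume 0 t :=
      (hEc.const_smul c).intervalIntegrable _ _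
    have h5 : IntervalIntegrable y0 volume 0 t := hy0i.intervalIntegrable
    rw [ContinuousLinearMap.intervalIntegral_comp_comm R (h4.add h5),
      intervalIntegral.integral_add h4 h5, intervalIntegral.integral_smul] at h1
    rw [h1]
    congr 1
    rw [← h1, hE, neg_neg]
  have hF : ∀ t, HasDerivAt (fun t => Real.exp (-2 * κ * t) * ‖z t‖ ^ 2)
      (Real.exp (-2 * κ * t) * (2 * ⟪z t, E t⟫_ℝ - 2 * κ * ‖z t‖ ^ 2)) t := by
    intro t
    have h1 : HasDerivAt (fun s => Real.exp (-2 * κ * s)) (Real.exp (-2 * κ * t) * (-2 * κ)) t := by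
      simpa using ((hasDerivAt_id t).const_mul (-2 * κ)).exp
    refine (h1.mul (hzd t).norm_sq).congr_deriv ?_
    ring
  -- Accretivity of `A + κ` at `z` reads `⟪z, E⟫ ≤ κ‖z‖²`, so the weighted energy decreases.
  have hanti : AntitoneOn (fun t => Real.exp (-2 * κ * t) * ‖z t‖ ^ 2) (Icc 0 T) := by
    refine antitoneOn_of_deriv_nonpos (convex_Icc 0 T)
      (fun x _ => (hF x).continuousAt.continuousWithinAt)
      (fun x _ => (hF x).differentiableAt.differentiableWithinAt) (fun x hx => ?_)
    rw [(hF x).deriv]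
    have h1 := hG.accretive _ (add_mem_shiftGraph (κ := κ) (hmem x (interior_subset hx)))
    simp only [inner_add_right, inner_neg_right, inner_smul_right,
      real_inner_self_eq_norm_sq] at h1
    have h2 := Real.exp_pos (-2 * κ * x)
    nlinarith
  have hz0 : z t = 0 := by
    have h1 := hanti ⟨le_rfl, ht.1.trans ht.2⟩ ht ht.1
    have h2 : z 0 = 0 := by simp [hz]
    simp only [h2, norm_zero] at h1
    have h3 := Real.exp_pos (-2 * κ * t)
    have h4 : ‖z t‖ ^ 2 ≤ 0 := by nlinarith
    have h5 : ‖z t‖ = 0 := by nlinarith [norm_nonneg (z t)]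
    exact norm_eq_zero.1 h5
  have h1 := hmem t ht
  rw [hz0] at h1
  rw [← hED t ht]
  exact neg_eq_zero.1 (hG.shift_singleValued h1)

end Shift

/-! ### Uniqueness of strong solutions -/

section Uniqueness

variable {S Ω : Type*} {mS : MeasurableSpace S} {mΩ : MeasurableSpace Ω} {ν : Measure S}
  {P : Measure Ω}

theorem ae_ae_of_ae_prod_swap [SFinite ν] [SFinite P] {q : S × Ω → Prop}
    (h : ∀ᵐ p ∂(ν.prod P), q p) : ∀ᵐ ω ∂P, ∀ᵐ s ∂ν, q (s, ω) := by
  rw [← Measure.prod_swap] at h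
  exact Measure.ae_ae_of_ae_prod (ae_of_ae_map measurable_swap.aemeasurable h)

/-- Passing from almost every slice to the product measure requires a measurable exceptional set,
hence the measurable representatives. -/
theorem ae_prod_eq_of_ae_ae [SFinite P] {E : Type*} [TopologicalSpace E]
    [TopologicalSpace.MetrizableSpace E] {f g : S × Ω → E}
    (hf : AEStronglyMeasurable f (ν.prod P)) (hg : AEStronglyMeasurable g (ν.prod P))
    (h : ∀ᵐ s ∂ν, ∀ᵐ ω ∂P, f (s, ω) = g (s, ω)) : f =ᵐ[ν.prod P] g := by
  have h1 : ∀ᵐ s ∂ν, ∀ᵐ ω ∂P, hf.mk f (s, ω) = hg.mk g (s, ω) := by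
    filter_upwards [h, Measure.ae_ae_of_ae_prod hf.ae_eq_mk, Measure.ae_ae_of_ae_prod hg.ae_eq_mk]
      with s h1 h2 h3
    filter_upwards [h1, h2, h3] with ω k1 k2 k3
    rw [← k2, ← k3, k1]
  have h2 := (Measure.ae_prod_iff_ae_ae
    (hf.stronglyMeasurable_mk.measurableSet_eq_fun hg.stronglyMeasurable_mk)).2 h1
  filter_upwards [h2, hf.ae_eq_mk, hg.ae_eq_mk] with p k1 k2 k3
  rw [k2, k3, k1]

/-- Strong solutions are unique up to versions. -/
theorem IsStrongSolution.areVersionsOn {H : Type*} [NormedAddCommGroup H] [InnerProductSpace ℝ H]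
    [CompleteSpace H] [IsProbabilityMeasure P] {W : ℝ≥0 → Ω → ℝ} (hW : IsPreBrownianReal W P)
    {A : H →ₗ.[ℝ] H} {κ : ℝ} (hA : IsMaxAccretive (shiftGraph A.graph κ)) {T : ℝ≥0} {B : ℝ → H}
    (hB : MemLp B 2 (timeMeasure T)) {X X' : ℝ → Ω → H} (hX : IsStrongSolution A B W P T X)
    (hX' : IsStrongSolution A B W P T X') : AreVersionsOn P T X X' := by
  obtain ⟨hXm, Y, hYm, hXY, hYi, hXe⟩ := hX
  obtain ⟨hXm', Y', hYm', hXY', hYi', hXe'⟩ := hX'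
  have hym := hYm.sub hYm'
  set y : ℝ × Ω → H := hym.mk _ with hy
  have hys : StronglyMeasurable y := hym.stronglyMeasurable_mk
  have hyeq : ∀ᵐ p ∂((timeMeasure T).prod P), Y p.1 p.2 - Y' p.1 p.2 = y p := hym.ae_eq_mk
  have hyω := ae_ae_of_ae_prod_swap hyeq
  -- Built from a measurable representative and written as a parametric integral over a fixed
  -- measure, this version of `X - X'` is jointly measurable and is a genuine primitive along every
  -- path.
  let D : ℝ × Ω → H := fun p => -∫ s, (Iic p.1).indicator (fun s => y (s, p.2)) s ∂(timeMeasure T)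
  have hDs : StronglyMeasurable D := by
    refine StronglyMeasurable.neg ?_
    refine StronglyMeasurable.integral_prod_right (f := fun (p : ℝ × Ω) (s : ℝ) =>
      (Iic p.1).indicator (fun s => y (s, p.2)) s) ?_
    have h1 : StronglyMeasurable fun q : (ℝ × Ω) × ℝ => y (q.2, q.1.2) :=
      hys.comp_measurable (by fun_prop)
    have h2 : MeasurableSet {q : (ℝ × Ω) × ℝ | q.2 ≤ q.1.1} :=
      measurableSet_le (by fun_prop) (by fun_prop)
    exact h1.indicator h2
  have hDi : ∀ᵐ ω ∂P, ∀ t ∈ Icc 0 (T : ℝ), D (t, ω) = -∫ s in (0 : ℝ)..t, y (s, ω) := by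
    refine ae_of_all _ fun ω t ht => ?_
    lift t to ℝ≥0 using ht.1
    have ht' : t ≤ T := ht.2
    simp only [D]
    rw [integral_indicator measurableSet_Iic, timeMeasure_restrict_Iic ht',
      intervalIntegral.integral_of_le t.coe_nonneg, integral_Icc_eq_integral_Ioc]
  have hDX : ∀ t ∈ Icc 0 (T : ℝ), ∀ᵐ ω ∂P, X t ω - X' t ω = D (t, ω) := by
    intro t ht
    have ht0 := ht
    lift t to ℝ≥0 using ht.1
    have ht' : t ≤ T := ht.2
    obtain ⟨I, hI, hXI⟩ := hXe t ht.2
    obtain ⟨I', hI', hXI'⟩ := hXe' t ht.2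
    have hBt := hB.indicator (measurableSet_Iic : MeasurableSet (Iic (t : ℝ)))
    filter_upwards [hXI, hXI', hI.ae_eq_wienerIntegral hW ht' hBt,
      hI'.ae_eq_wienerIntegral hW ht' hBt, hYi, hYi', hyω, hDi] with ω h1 h2 h3 h4 h5 h6 h7 h8
    rw [h8 t ht0, h1, h2, h3, h4]
    have h9 : ∫ s in (0 : ℝ)..t, y (s, ω) = (∫ s in (0 : ℝ)..t, Y s ω) -
        ∫ s in (0 : ℝ)..t, Y' s ω := by
      have hsub : Icc (0 : ℝ) t ⊆ Icc 0 T := Icc_subset_Icc_right ht'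
      have i1 := (intervalIntegrable_iff_integrableOn_Icc_of_le t.coe_nonneg).2 (h5.mono_set hsub)
      have i2 := (intervalIntegrable_iff_integrableOn_Icc_of_le t.coe_nonneg).2 (h6.mono_set hsub)
      rw [← intervalIntegral.integral_sub i1 i2]
      refine intervalIntegral.integral_congr_ae ?_
      rw [uIoc_of_le t.coe_nonneg]
      filter_upwards [(ae_restrict_iff' measurableSet_Icc).1 h7] with s hs hst
      exact (hs (hsub ⟨hst.1.le, hst.2⟩)).symm
    rw [h9]
    abel
  -- The identity known almost surely at each fixed time now holds almost everywhere in `(t, ω)`, so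
  -- the graph relation passes to `D` along almost every path.
  have hDXp : ∀ᵐ p ∂((timeMeasure T).prod P), X p.1 p.2 - X' p.1 p.2 = D p := by
    refine ae_prod_eq_of_ae_ae (hXm.sub hXm') hDs.aestronglyMeasurable ?_
    filter_upwards [ae_restrict_mem measurableSet_Icc] with t ht
    exact hDX t ht
  have hgr : ∀ᵐ p ∂((timeMeasure T).prod P), (D p, y p) ∈ A.graph := by
    filter_upwards [hDXp, hyeq, hXY, hXY'] with p h1 h2 h3 h4
    rw [← h1, ← h2]
    exact A.graph.sub_mem h3 h4
  have hD0 : ∀ᵐ ω ∂P, ∀ t ∈ Icc 0 (T : ℝ), D (t, ω) = 0 := by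
    filter_upwards [ae_ae_of_ae_prod_swap hgr, hDi, hYi, hYi', hyω] with ω h1 h2 h3 h4 h5 t ht
    refine hA.eq_zero_of_integral (y := fun s => y (s, ω)) (D := fun s => D (s, ω))
      ((h3.sub h4).congr ?_) h2 h1 ht
    exact h5
  intro t ht
  filter_upwards [hDX t ht, hD0] with ω h1 h2
  rw [h2 t ht] at h1
  exact sub_eq_zero.1 h1

end Uniqueness

/-! ### Existence -/

section Existence

variable {H : Type*} [NormedAddCommGroup H] [NormedSpace ℝ H]

/-- The convolution kernel `(t, s) ↦ 1_{s < t} f(s) v(t - s)`. -/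
noncomputable def convKernel (f : ℝ → ℝ) (v : ℝ → H) (p : ℝ × ℝ) : H :=
  {p : ℝ × ℝ | p.2 < p.1}.indicator (fun p => f p.2 • v (p.1 - p.2)) p

theorem convKernel_of_lt (f : ℝ → ℝ) (v : ℝ → H) {t s : ℝ} (h : s < t) :
    convKernel f v (t, s) = f s • v (t - s) :=
  indicator_of_mem (s := {p : ℝ × ℝ | p.2 < p.1}) (a := (t, s)) h _

theorem convKernel_of_le (f : ℝ → ℝ) (v : ℝ → H) {t s : ℝ} (h : t ≤ s) :
    convKernel f v (t, s) = 0 :=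
  indicator_of_notMem (s := {p : ℝ × ℝ | p.2 < p.1}) (a := (t, s)) (not_lt.2 h) _

theorem stronglyMeasurable_convKernel {f : ℝ → ℝ} {v : ℝ → H} (hf : StronglyMeasurable f)
    (hv : StronglyMeasurable v) : StronglyMeasurable (convKernel f v) := by
  have h1 : StronglyMeasurable fun p : ℝ × ℝ => f p.2 := hf.comp_measurable measurable_snd
  have h2 : StronglyMeasurable fun p : ℝ × ℝ => v (p.1 - p.2) :=
    hv.comp_measurable (measurable_fst.sub measurable_snd)
  exact (h1.smul h2).indicator (measurableSet_lt measurable_snd measurable_fst)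

/-- Tonelli and translation invariance bound the squared norm by `‖f‖² ‖v‖²`. Square integrability
of the orbit suffices here, but yields good slices only for almost every `t`. -/
theorem memLp_convKernel {T : ℝ≥0} {f : ℝ → ℝ} {v : ℝ → H} (hf : StronglyMeasurable f)
    (hv : StronglyMeasurable v) (hf2 : MemLp f 2 (timeMeasure T))
    (hv2 : MemLp v 2 (volume.restrict (Ioc 0 (T : ℝ)))) :
    MemLp (convKernel f v) 2 ((timeMeasure T).prod (timeMeasure T)) := by
  have hm := stronglyMeasurable_convKernel hf hv
  refine ⟨hm.aestronglyMeasurable, ?_⟩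
  have h1 : ∫⁻ p, ‖convKernel f v p‖ₑ ^ 2 ∂((timeMeasure T).prod (timeMeasure T)) < ∞ := by
    rw [lintegral_prod_symm _ (hm.enorm.pow_const 2).aemeasurable]
    have h2 : ∀ᵐ s ∂(timeMeasure T), ∫⁻ t, ‖convKernel f v (t, s)‖ₑ ^ 2 ∂(timeMeasure T) ≤
        ‖f s‖ₑ ^ 2 * ∫⁻ r in Ioc 0 (T : ℝ), ‖v r‖ₑ ^ 2 := by
      filter_upwards [ae_restrict_mem measurableSet_Icc] with s hs
      calc ∫⁻ t, ‖convKernel f v (t, s)‖ₑ ^ 2 ∂(timeMeasure T)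
          ≤ ∫⁻ t, ‖f s‖ₑ ^ 2 * (Ioc 0 (T : ℝ)).indicator (fun r => ‖v r‖ₑ ^ 2) (t - s)
              ∂(timeMeasure T) := by
            refine lintegral_mono_ae ?_
            filter_upwards [ae_restrict_mem measurableSet_Icc] with t ht
            rcases lt_or_ge s t with hst | hst
            · rw [convKernel_of_lt f v hst, indicator_of_mem, enorm_smul, mul_pow]
              exact ⟨by linarith, by linarith [ht.2, hs.1]⟩
            · rw [convKernel_of_le f v hst]
              simp
        _ ≤ ∫⁻ t, ‖f s‖ₑ ^ 2 * (Ioc 0 (T : ℝ)).indicator (fun r => ‖v r‖ₑ ^ 2) (t - s) :=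
            lintegral_mono' Measure.restrict_le_self le_rfl
        _ = ‖f s‖ₑ ^ 2 * ∫⁻ r in Ioc 0 (T : ℝ), ‖v r‖ₑ ^ 2 := by
            rw [lintegral_const_mul, lintegral_sub_right_eq_self
              (fun r => (Ioc 0 (T : ℝ)).indicator (fun r => ‖v r‖ₑ ^ 2) r) s,
              lintegral_indicator measurableSet_Ioc]
            exact ((hv.enorm.pow_const 2).indicator measurableSet_Ioc).comp
              (measurable_id.sub_const s)
    refine (lintegral_mono_ae h2).trans_lt ?_
    rw [lintegral_mul_const _ (hf.enorm.pow_const 2), ← eLpNorm_two_sq_eq_lintegral,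
      ← eLpNorm_two_sq_eq_lintegral]
    exact ENNReal.mul_lt_top (ENNReal.pow_lt_top hf2.2) (ENNReal.pow_lt_top hv2.2)
  rw [← eLpNorm_two_sq_eq_lintegral] at h1
  by_contra h
  rw [not_lt, top_le_iff] at h
  simp [h] at h1

/-- A bounded orbit gives a square integrable slice at every `t`, so the convolution can be defined
at each fixed time. -/
theorem memLp_convKernel_slice {T : ℝ≥0} {f : ℝ → ℝ} {v : ℝ → H} (hf : StronglyMeasurable f)
    (hv : StronglyMeasurable v) (hf2 : MemLp f 2 (timeMeasure T)) {M : ℝ}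
    (hM : ∀ t : ℝ, 0 < t → t ≤ T → ‖v t‖ ≤ M) {t : ℝ} (ht : t ≤ T) :
    MemLp (fun s => convKernel f v (t, s)) 2 (timeMeasure T) := by
  refine hf2.of_le_mul (c := |M|) ((stronglyMeasurable_convKernel hf hv).comp_measurable
    (measurable_const.prodMk measurable_id)).aestronglyMeasurable ?_
  filter_upwards [ae_restrict_mem measurableSet_Icc] with s hs
  rcases lt_or_ge s t with hst | hst
  · rw [convKernel_of_lt f v hst, norm_smul, mul_comm]
    have := (hM (t - s) (by linarith) (by linarith [hs.1])).trans (le_abs_self M)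
    gcongr
  · rw [convKernel_of_le f v hst, norm_zero]
    positivity

/-- The substitution `r ↦ r - s` turns the integral over `(s,t]` into `f(s)(b - v(t - s))`. The
point `s = t` is excluded because the strict cut-off of the kernel makes `convKernel f v` vanish
there while the indicator does not. -/
theorem setIntegral_convKernel {T t : ℝ≥0} (htT : t ≤ T) {f : ℝ → ℝ} {v w : ℝ → H} {b : H}
    (hvw : ∀ t : ℝ, 0 ≤ t → v t = b - ∫ s in (0 : ℝ)..t, w s) {s : ℝ} (hs : 0 ≤ s) (hst : s ≠ t) :
    ∫ r in Ioc 0 (t : ℝ), convKernel f w (r, s) ∂(timeMeasure T) =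
      (Iic (t : ℝ)).indicator (fun s => f s • b) s - convKernel f v (t, s) := by
  have h0 : (timeMeasure T).restrict (Ioc 0 (t : ℝ)) = volume.restrict (Ioc 0 (t : ℝ)) := by
    rw [Measure.restrict_restrict measurableSet_Ioc]
    congr 1
    refine inter_eq_left.2 fun r hr => ⟨hr.1.le, hr.2.trans htT⟩
  rw [h0]
  rcases lt_or_gt_of_ne hst with hst | hst
  · have h1 : ∫ r in Ioc 0 (t : ℝ), convKernel f w (r, s) =
        ∫ r in Ioc s t, f s • w (r - s) := by
      have h2 : Ioc s t ⊆ Ioc 0 (t : ℝ) := Ioc_subset_Ioc_left hs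
      rw [setIntegral_eq_of_subset_of_forall_sdiff_eq_zero measurableSet_Ioc h2]
      · exact setIntegral_congr_fun measurableSet_Ioc fun r hr => convKernel_of_lt f w hr.1
      · intro r hr
        refine convKernel_of_le f w ?_
        by_contra h
        exact hr.2 ⟨not_le.1 h, hr.1.2⟩
    rw [h1, ← intervalIntegral.integral_of_le hst.le, intervalIntegral.integral_smul,
      intervalIntegral.integral_comp_sub_right (fun r => w r) s, sub_self,
      convKernel_of_lt f v hst, indicator_of_mem (mem_Iic.2 hst.le), hvw _ (by linarith), smul_sub]
    abel
  · rw [convKernel_of_le f v hst.le, indicator_of_notMem (by simpa using hst), sub_self]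
    refine setIntegral_eq_zero_of_forall_eq_zero fun r hr => ?_
    exact convKernel_of_le f w (hr.2.trans hst.le)

end Existence

/-! ### The stochastic convolution -/

section Solution

variable {H : Type*} [NormedAddCommGroup H] [InnerProductSpace ℝ H] [CompleteSpace H]
  {Ω : Type*} {mΩ : MeasurableSpace Ω} {P : Measure Ω} [IsProbabilityMeasure P]
  {W : ℝ≥0 → Ω → ℝ}

/-- The stochastic convolution of `f` with an orbit of `-A` is a strong solution. -/
theorem exists_strongSolution {ℱ : Filtration ℝ≥0 mΩ} (hW : IsBrownianMotionFor ℱ W P)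
    {A : H →ₗ.[ℝ] H} {κ : ℝ} (hA : IsMaxAccretive (shiftGraph A.graph κ)) {T : ℝ≥0} {f : ℝ → ℝ}
    (hf : MemLp f 2 (timeMeasure T)) {b : H} {v w : ℝ → H} (hv : StronglyMeasurable v)
    (hw : StronglyMeasurable w) (hvw : ∀ t, 0 < t → (v t, w t) ∈ A.graph) {M : ℝ}
    (hM : ∀ t : ℝ, 0 < t → t ≤ T → ‖v t‖ ≤ M) (hw2 : MemLp w 2 (volume.restrict (Ioc 0 (T : ℝ))))
    (hint : ∀ t : ℝ, 0 ≤ t → v t = b - ∫ s in (0 : ℝ)..t, w s) :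
    ∃ X : ℝ → Ω → H, IsStrongSolution A (fun t => f t • b) W P T X ∧ IsAdaptedOn ℱ P T X ∧
      (∀ᵐ ω ∂P, MemL2Dom A T (fun t => X t ω)) ∧
      ((∃ M', ∀ t : ℝ, 0 < t → t ≤ T → ‖w t‖ ≤ M') →
        ∀ t ∈ Icc 0 (T : ℝ), ∀ᵐ ω ∂P, X t ω ∈ A.domain) := by
  classical
  obtain ⟨R, c, hR⟩ := hA.exists_mem_iff_of_shift
  have hW' := hW.isBrownian.toIsPreBrownianReal
  set f0 := hf.1.mk f with hf0
  have hf0m : StronglyMeasurable f0 := hf.1.stronglyMeasurable_mk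
  have hff0 : f =ᵐ[timeMeasure T] f0 := hf.1.ae_eq_mk
  have hf02 : MemLp f0 2 (timeMeasure T) := hf.ae_eq hff0
  let J : Lp H 2 (timeMeasure T) →ₗᵢ[ℝ] Lp H 2 P := wienerIntegral hW' T
  have hv2 : MemLp v 2 (volume.restrict (Ioc 0 (T : ℝ))) := by
    refine MemLp.of_bound hv.aestronglyMeasurable M ?_
    filter_upwards [ae_restrict_mem measurableSet_Ioc] with t ht
    exact hM t ht.1 ht.2
  have hVm := memLp_convKernel hf0m hv hf02 hv2
  have hKm := memLp_convKernel hf0m hw hf02 hw2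
  -- The graph relation of the orbit, as a pointwise relation of kernels; where the kernels vanish
  -- it is `R 0 = 0`.
  have hlinear : ∀ t s, R (c • convKernel f0 v (t, s) + convKernel f0 w (t, s)) =
      convKernel f0 v (t, s) := by
    intro t s
    rcases lt_or_ge s t with hst | hst
    · rw [convKernel_of_lt f0 v hst, convKernel_of_lt f0 w hst, smul_comm c, ← smul_add, map_smul,
        (hR _ _).1 (hvw _ (by linarith))]
    · rw [convKernel_of_le f0 v hst, convKernel_of_le f0 w hst]
      simp
  set V : Lp H 2 ((timeMeasure T).prod (timeMeasure T)) := hVm.toLp _ with hV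
  set K : Lp H 2 ((timeMeasure T).prod (timeMeasure T)) := hKm.toLp _ with hK
  set LV := liftProd (timeMeasure T) J V with hLV
  set LK := liftProd (timeMeasure T) J K with hLK
  have hRV : R.compLpL 2 _ (c • V + K) = V := by
    apply Lp.ext
    filter_upwards [R.coeFn_compLpL (c • V + K), Lp.coeFn_add (c • V) K, Lp.coeFn_smul c V,
      hVm.coeFn_toLp, hKm.coeFn_toLp] with p h1 h2 h3 h4 h5
    rw [h1, h2, Pi.add_apply, h3, Pi.smul_apply, h4, h5]
    exact hlinear p.1 p.2
  have hRLV : R.compLpL 2 _ (c • LV + LK) = LV := by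
    rw [hLV, hLK, ← map_smul, ← map_add, ← liftProd_compLpL (timeMeasure T) J R
      (wienerIntegral_compLpL hW' T R), hRV]
  have hgraph : ∀ᵐ p ∂((timeMeasure T).prod P), (LV p, LK p) ∈ A.graph := by
    have h0 := R.coeFn_compLpL (c • LV + LK)
    rw [hRLV] at h0
    filter_upwards [h0, Lp.coeFn_add (c • LV) LK, Lp.coeFn_smul c LV] with p h1 h2 h3
    rw [hR, ← Pi.smul_apply, ← h3, ← Pi.add_apply, ← h2]
    exact h1.symm
  have hVt : ∀ t : ℝ, t ≤ T → MemLp (fun s => convKernel f0 v (t, s)) 2 (timeMeasure T) :=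
    fun t ht => memLp_convKernel_slice hf0m hv hf02 hM ht
  let Z : ℝ → Lp H 2 P := fun t => if ht : t ≤ T then J ((hVt t ht).toLp _) else 0
  have hZ : ∀ (t : ℝ) (ht : t ≤ T), Z t = J ((hVt t ht).toLp _) := fun t ht => dif_pos ht
  -- `LV` is jointly measurable but meaningful only for almost every `t`, while `Z t` is the right
  -- random variable at each `t`. Using `LV` wherever the two agree gives joint measurability
  -- together with the correct value at every time.
  let X : ℝ → Ω → H := fun t =>
    if (fun ω => LV (t, ω)) =ᵐ[P] Z t then fun ω => LV (t, ω) else Z t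
  have hXZ : ∀ t, X t =ᵐ[P] Z t := by
    intro t
    by_cases h : (fun ω => LV (t, ω)) =ᵐ[P] Z t
    · simp only [X, if_pos h]; exact h
    · simp only [X, if_neg h]; rfl
  have hLVZ : ∀ᵐ t ∂(timeMeasure T), (fun ω => LV (t, ω)) =ᵐ[P] Z t := by
    filter_upwards [ae_liftProd_slice (timeMeasure T) J V,
      Measure.ae_ae_of_ae_prod hVm.coeFn_toLp, ae_restrict_mem measurableSet_Icc]
      with t ⟨φ, h1, h2⟩ h3 h4
    refine h2.trans ?_
    rw [hZ t h4.2]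
    have : φ = (hVt t h4.2).toLp _ := by
      apply Lp.ext
      filter_upwards [h1, h3, (hVt t h4.2).coeFn_toLp] with s k1 k2 k3
      rw [k3, ← k1, hV, k2]
    rw [this]
  have hXLV : ∀ᵐ p ∂((timeMeasure T).prod P), X p.1 p.2 = LV p := by
    have h1 : ∀ᵐ p ∂((timeMeasure T).prod P), (fun ω => LV (p.1, ω)) =ᵐ[P] Z p.1 :=
      Measure.quasiMeasurePreserving_fst.ae hLVZ
    filter_upwards [h1] with p hp
    simp only [X, if_pos hp]
  have hXmem : MemLp (fun p : ℝ × Ω => X p.1 p.2) 2 ((timeMeasure T).prod P) :=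
    (Lp.memLp LV).ae_eq (hXLV.mono fun p hp => hp.symm)
  have hXg : ∀ᵐ p ∂((timeMeasure T).prod P), (X p.1 p.2, LK p) ∈ A.graph := by
    filter_upwards [hXLV, hgraph] with p h1 h2
    rw [h1]; exact h2
  have hslice : ∀ F : ℝ × Ω → H, MemLp F 2 ((timeMeasure T).prod P) →
      ∀ᵐ ω ∂P, MemLp (fun t => F (t, ω)) 2 (timeMeasure T) := fun F hF =>
    ae_memLp_slice P (hF.comp_measurePreserving Measure.measurePreserving_swap)
  refine ⟨X, ⟨hXmem.1, fun t ω => LK (t, ω), Lp.aestronglyMeasurable LK, hXg, ?_, ?_⟩, ?_, ?_, ?_⟩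
  · filter_upwards [hslice _ (Lp.memLp LK)] with ω hω
    exact hω.integrable (by norm_num)
  · intro t ht
    have ht' : t ≤ T := ht
    have hB : MemLp ((Iic (t : ℝ)).indicator fun s => f s • b) 2 (timeMeasure T) :=
      (((ContinuousLinearMap.toSpanSingleton ℝ b).comp_memLp' hf :
        MemLp (fun s => f s • b) 2 (timeMeasure T))).indicator measurableSet_Iic
    refine ⟨_, isStochasticIntegral_wienerIntegral hW' ht' hB, ?_⟩
    set C : MeasurableSet (Ioc 0 (t : ℝ)) := measurableSet_Ioc
    -- The integrated orbit equation at the level of integrands; `J` and the Fubini theorem turn it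
    -- into the equation for `X`.
    have e1 : (hVt t ht).toLp _ =
        hB.toLp _ - (tensorL (timeMeasure T) C).adjoint K := by
      apply Lp.ext
      have h0 : ∀ᵐ x ∂(volume : Measure ℝ), x ≠ (t : ℝ) := by simp [ae_iff]
      filter_upwards [(hVt t ht).coeFn_toLp, hB.coeFn_toLp,
        Lp.coeFn_sub (hB.toLp _) ((tensorL (timeMeasure T) C).adjoint K),
        coeFn_adjoint_tensorL (timeMeasure T) C K, ae_ae_of_ae_prod_swap hKm.coeFn_toLp,
        ae_restrict_mem measurableSet_Icc, ae_restrict_of_ae h0, hff0]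
        with s h1 h2 h3 h4 h5 h6 h7 h8
      have h9 : ∫ r in Ioc 0 (t : ℝ), K (r, s) ∂(timeMeasure T) =
          ∫ r in Ioc 0 (t : ℝ), convKernel f0 w (r, s) ∂(timeMeasure T) :=
        integral_congr_ae (ae_restrict_of_ae h5)
      rw [h1, h3, Pi.sub_apply, h2, h4, h9, setIntegral_convKernel ht' hint h6.1 h7]
      by_cases hs : s ∈ Iic (t : ℝ)
      · rw [indicator_of_mem hs, indicator_of_mem hs, h8, sub_sub_cancel]
      · rw [indicator_of_notMem hs, indicator_of_notMem hs, sub_sub_cancel]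
    have e2 : Z t = J (hB.toLp _) - J ((tensorL (timeMeasure T) C).adjoint K) := by
      rw [hZ t ht, e1, map_sub]
    filter_upwards [hXZ t, setIntegral_liftProd (timeMeasure T) J C K,
      Lp.coeFn_sub (J (hB.toLp _)) (J ((tensorL (timeMeasure T) C).adjoint K))] with ω h1 h2 h3
    rw [h1, e2, h3, Pi.sub_apply, h2, intervalIntegral.integral_of_le t.coe_nonneg,
      Measure.restrict_restrict measurableSet_Ioc]
    have h4 : Ioc 0 (t : ℝ) ∩ Icc 0 (T : ℝ) = Ioc 0 (t : ℝ) :=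
      inter_eq_left.2 fun r hr => ⟨hr.1.le, hr.2.trans ht⟩
    rw [h4, sub_eq_neg_add]
  · intro t ht
    refine AEStronglyMeasurable.congr ?_ (hXZ t).symm
    rw [hZ t ht]
    -- The kernel looks only at times `s < t`, so its Wiener integral uses the Brownian motion only
    -- up to `t`.
    have e1 : (hVt t ht).toLp _ = indicatorL (timeMeasure T)
        (measurableSet_Iic : MeasurableSet (Iic (t : ℝ))) ((hVt t ht).toLp _) := by
      apply Lp.ext
      filter_upwards [coeFn_indicatorL (timeMeasure T)
        (measurableSet_Iic : MeasurableSet (Iic (t : ℝ))) ((hVt t ht).toLp _),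
        (hVt t ht).coeFn_toLp] with s h1 h2
      rw [h1, h2]
      by_cases hs : s ∈ Iic (t : ℝ)
      · rw [indicator_of_mem hs, h2]
      · rw [indicator_of_notMem hs, convKernel_of_le f0 v (le_of_not_ge hs)]
    rw [e1]
    exact aestronglyMeasurable_wienerIntegral hW' hW.adapted T t _
  · filter_upwards [hslice _ hXmem, hslice _ (Lp.memLp LK), ae_ae_of_ae_prod_swap hXg]
      with ω h1 h2 h3
    exact ⟨h1, fun t => LK (t, ω), h2, h3⟩
  · rintro ⟨M', hM'⟩ t ht
    -- A bounded `w` has a Wiener integral at every `t`, which then serves as `A X(t)`.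
    have hWt := memLp_convKernel_slice hf0m hw hf02 hM' ht.2
    have e1 : R.compLpL 2 _ (c • (hVt t ht.2).toLp _ + hWt.toLp _) = (hVt t ht.2).toLp _ := by
      apply Lp.ext
      filter_upwards [R.coeFn_compLpL (c • (hVt t ht.2).toLp _ + hWt.toLp _),
        Lp.coeFn_add (c • (hVt t ht.2).toLp _) (hWt.toLp _),
        Lp.coeFn_smul c ((hVt t ht.2).toLp _), (hVt t ht.2).coeFn_toLp, hWt.coeFn_toLp]
        with s h1 h2 h3 h4 h5
      rw [h1, h2, Pi.add_apply, h3, Pi.smul_apply, h4, h5]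
      exact hlinear t s
    have e2 : R.compLpL 2 P (c • Z t + J (hWt.toLp _)) = Z t := by
      rw [hZ t ht.2, ← map_smul, ← map_add, ← wienerIntegral_compLpL hW' T R, e1]
    have h0 := R.coeFn_compLpL (c • Z t + J (hWt.toLp _))
    rw [e2] at h0
    filter_upwards [h0, Lp.coeFn_add (c • Z t) (J (hWt.toLp _)), Lp.coeFn_smul c (Z t), hXZ t]
      with ω h1 h2 h3 h4
    rw [h4]
    refine LinearPMap.mem_domain_of_mem_graph (y := J (hWt.toLp _) ω) ?_
    rw [hR, ← Pi.smul_apply, ← h3, ← Pi.add_apply, ← h2]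
    exact h1.symm

end Solution

/-! ### Well-posedness for an abstract quasi-accretive operator -/

section WellPosed

variable {H : Type*} [NormedAddCommGroup H] [InnerProductSpace ℝ H]
  {Ω : Type*} {mΩ : MeasurableSpace Ω} {P : Measure Ω} [IsProbabilityMeasure P]
  {W : ℝ≥0 → Ω → ℝ}

theorem MemL2Dom.of_areVersionsOn {A : H →ₗ.[ℝ] H} {T : ℝ} {X X' : ℝ → Ω → H}
    (hX : AEStronglyMeasurable (fun p : ℝ × Ω => X p.1 p.2) ((volume.restrict (Icc 0 T)).prod P))
    (hX' : AEStronglyMeasurable (fun p : ℝ × Ω => X' p.1 p.2) ((volume.restrict (Icc 0 T)).prod P))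
    (h : AreVersionsOn P T X X') (hdom : ∀ᵐ ω ∂P, MemL2Dom A T (fun t => X t ω)) :
    ∀ᵐ ω ∂P, MemL2Dom A T (fun t => X' t ω) := by
  have h1 : ∀ᵐ p ∂((volume.restrict (Icc 0 T)).prod P), X p.1 p.2 = X' p.1 p.2 := by
    refine ae_prod_eq_of_ae_ae hX hX' ?_
    filter_upwards [ae_restrict_mem measurableSet_Icc] with t ht
    exact h t ht
  filter_upwards [hdom, ae_ae_of_ae_prod_swap h1] with ω ⟨k1, y, k2, k3⟩ k4
  refine ⟨k1.ae_eq k4, y, k2, ?_⟩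
  filter_upwards [k3, k4] with t m1 m2
  rw [← m2]
  exact m1

/-- Existence, uniqueness and regularity of the strong solution driven by `f b`, for `b` with a
square integrable orbit `v' = -A v = -w`, `v(0) = b`. -/
theorem strongSolution_wellPosed [CompleteSpace H] {ℱ : Filtration ℝ≥0 mΩ} (hW : IsBrownianMotionFor ℱ W P)
    {A : H →ₗ.[ℝ] H} {κ : ℝ} (hA : IsMaxAccretive (shiftGraph A.graph κ)) {T : ℝ≥0} {f : ℝ → ℝ}
    (hf : MemLp f 2 (timeMeasure T)) {b : H} {v w : ℝ → H} (hv : StronglyMeasurable v)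
    (hw : StronglyMeasurable w) (hvw : ∀ t, 0 < t → (v t, w t) ∈ A.graph) {M : ℝ}
    (hM : ∀ t : ℝ, 0 < t → t ≤ T → ‖v t‖ ≤ M)
    (hw2 : MemLp w 2 (volume.restrict (Ioc 0 (T : ℝ))))
    (hint : ∀ t : ℝ, 0 ≤ t → v t = b - ∫ s in (0 : ℝ)..t, w s) :
    (∃ X : ℝ → Ω → H, IsStrongSolution A (fun t => f t • b) W P T X ∧ IsAdaptedOn ℱ P T X) ∧
    (∀ X X' : ℝ → Ω → H, IsStrongSolution A (fun t => f t • b) W P T X →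
      IsStrongSolution A (fun t => f t • b) W P T X' → AreVersionsOn P T X X') ∧
    ∀ X : ℝ → Ω → H, IsStrongSolution A (fun t => f t • b) W P T X →
      (∀ᵐ ω ∂P, MemL2Dom A T (fun t => X t ω)) ∧
      ((∃ M', ∀ t : ℝ, 0 < t → t ≤ T → ‖w t‖ ≤ M') →
        ∀ t ∈ Icc 0 (T : ℝ), ∀ᵐ ω ∂P, X t ω ∈ A.domain) := by
  obtain ⟨X₀, h1, h2, h3, h4⟩ := exists_strongSolution hW hA hf hv hw hvw hM hw2 hint
  have hB : MemLp (fun t => f t • b) 2 (timeMeasure T) :=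
    (ContinuousLinearMap.toSpanSingleton ℝ b).comp_memLp' hf
  have huniq : ∀ X X' : ℝ → Ω → H, IsStrongSolution A (fun t => f t • b) W P T X →
      IsStrongSolution A (fun t => f t • b) W P T X' → AreVersionsOn P T X X' :=
    fun X X' hX hX' => hX.areVersionsOn hW.isBrownian.toIsPreBrownianReal hA hB hX'
  refine ⟨⟨X₀, h1, h2⟩, huniq, fun X hX => ⟨?_, fun hM' t ht => ?_⟩⟩
  · exact MemL2Dom.of_areVersionsOn h1.1 hX.1 (huniq _ _ h1 hX) h3
  · filter_upwards [h4 hM' t ht, huniq _ _ h1 hX t ht] with ω k1 k2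
    rw [← k2]
    exact k1

end WellPosed

/-! ### The Dirichlet Laplacian and the wave operator -/

section Operators

variable {d : ℕ} {D : TopologicalSpace.Opens (EuclideanSpace ℝ (Fin d))}

instance : CompleteSpace (H10 D) :=
  (Submodule.isClosed_topologicalClosure _).completeSpace_coe

theorem H10.inner_eq (u v : H10 D) :
    ⟪u, v⟫_ℝ = ⟪H10.toL2 u, H10.toL2 v⟫_ℝ + ⟪H10.grad u, H10.grad v⟫_ℝ := rfl

/-- Solvability of `u - α Δu = ℓ` in `H¹₀(D)`. -/
theorem H10.exists_weak_solution {α : ℝ} (hα : 0 < α) (l : H10 D →L[ℝ] ℝ) :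
    ∃ u : H10 D, ∀ v : H10 D,
      ⟪H10.toL2 u, H10.toL2 v⟫_ℝ + α * ⟪H10.grad u, H10.grad v⟫_ℝ = l v := by
  let B : H10 D →L[ℝ] H10 D →L[ℝ] ℝ :=
    (isBoundedBilinearMap_inner (𝕜 := ℝ) (E := L2 D)).toContinuousLinearMap.bilinearComp
        H10.toL2 H10.toL2 +
      α • (isBoundedBilinearMap_inner (𝕜 := ℝ) (E := L2Vec D)).toContinuousLinearMap.bilinearComp
        H10.grad H10.grad
  have hB : ∀ u v, B u v = ⟪H10.toL2 u, H10.toL2 v⟫_ℝ + α * ⟪H10.grad u, H10.grad v⟫_ℝ :=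
    fun u v => rfl
  have hc : IsCoercive B := by
    refine ⟨min 1 α, by positivity, fun u => ?_⟩
    have h1 := real_inner_self_eq_norm_mul_norm u
    rw [H10.inner_eq] at h1
    rw [mul_assoc, ← h1, hB, mul_add]
    have h2 : (0 : ℝ) ≤ ⟪H10.toL2 u, H10.toL2 u⟫_ℝ := real_inner_self_nonneg
    have h3 : (0 : ℝ) ≤ ⟪H10.grad u, H10.grad u⟫_ℝ := real_inner_self_nonneg
    have h4 := mul_le_mul_of_nonneg_right (min_le_left 1 α) h2
    have h5 := mul_le_mul_of_nonneg_right (min_le_right 1 α) h3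
    linarith
  refine ⟨hc.continuousLinearEquivOfBilin.symm ((InnerProductSpace.toDual ℝ _).symm l),
    fun v => ?_⟩
  rw [← hB, ← hc.continuousLinearEquivOfBilin_apply, ContinuousLinearEquiv.apply_symm_apply,
    InnerProductSpace.toDual_symm_apply]

theorem mem_negLaplacian_graph {x y : L2 D} : (x, y) ∈ (negLaplacian D).graph ↔
    ∃ u : H10 D, H10.toL2 u = x ∧
      ∀ v : H10 D, ⟪H10.grad u, H10.grad v⟫_ℝ = ⟪y, H10.toL2 v⟫_ℝ := by
  rw [negLaplacian_graph]
  rfl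

theorem mem_negLaplacian_graph_toL2 {u : H10 D} {y : L2 D} :
    (H10.toL2 u, y) ∈ (negLaplacian D).graph ↔
      ∀ v : H10 D, ⟪H10.grad u, H10.grad v⟫_ℝ = ⟪y, H10.toL2 v⟫_ℝ := by
  rw [mem_negLaplacian_graph]
  refine ⟨?_, fun h => ⟨u, rfl, h⟩⟩
  rintro ⟨u', h1, h2⟩
  rwa [H10.toL2_injective h1] at h2

theorem mem_waveOperator_graph {x y : WaveSpace D} : (x, y) ∈ (waveOperator D).graph ↔
    H10.toL2 y.fst = -x.snd ∧ (H10.toL2 x.fst, y.snd) ∈ (negLaplacian D).graph := by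
  rw [waveOperator_graph]
  rfl

/-- The quadratic form is `‖∇u‖²`, and Lax–Milgram solves the weak form of `u - l Δu = z`. -/
theorem isMaxAccretive_negLaplacian : IsMaxAccretive (negLaplacian D).graph where
  accretive := by
    rintro ⟨x, y⟩ h
    obtain ⟨u, rfl, hu⟩ := mem_negLaplacian_graph.1 h
    change (0 : ℝ) ≤ ⟪H10.toL2 u, y⟫_ℝ
    rw [real_inner_comm, ← hu]
    exact real_inner_self_nonneg
  range := by
    intro l hl z
    obtain ⟨u, hu⟩ := H10.exists_weak_solution hl ((innerSL ℝ z).comp (H10.toL2 (D := D)))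
    refine ⟨(H10.toL2 u, l⁻¹ • (z - H10.toL2 u)), ?_, ?_⟩
    · rw [mem_negLaplacian_graph_toL2]
      intro v
      have := hu v
      simp only [ContinuousLinearMap.comp_apply, innerSL_apply_apply] at this
      rw [inner_smul_left, inner_sub_left, ← this]
      simp only [conj_trivial]
      field_simp
      ring
    · change H10.toL2 u + l • l⁻¹ • (z - H10.toL2 u) = z
      rw [smul_inv_smul₀ hl.ne']
      abel
  singleValued := fun y hy => (negLaplacian D).graph_fst_eq_zero_snd hy rfl

/-- In `⟪x, A x⟫` the gradient terms cancel, but the `L²` part of the `H¹` norm leaves `-⟪u, v⟫`.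
Adding the identity contributes `‖x‖²`, which absorbs it. -/
theorem isMaxAccretive_waveOperator : IsMaxAccretive (shiftGraph (waveOperator D).graph 1) where
  accretive := by
    rintro ⟨x, y⟩ h
    rw [mem_shiftGraph, one_smul] at h
    obtain ⟨h1, h2⟩ := mem_waveOperator_graph.1 h
    change (0 : ℝ) ≤ ⟪x, y⟫_ℝ
    have h3 := mem_negLaplacian_graph_toL2.1 h2 (-(y - x).fst)
    rw [map_neg, map_neg, h1, neg_neg] at h3
    have h4 : ⟪x, y⟫_ℝ = ⟪x, y - x⟫_ℝ + ⟪x, x⟫_ℝ := by rw [← inner_add_right, sub_add_cancel]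
    rw [h4]
    simp only [WithLp.prod_inner_apply, WithLp.ofLp_fst, WithLp.ofLp_snd, H10.inner_eq, h1]
    rw [inner_neg_right] at h3 ⊢
    rw [real_inner_comm x.snd] at h3
    have h5 := real_inner_self_nonneg (x := H10.toL2 x.fst - x.snd)
    rw [real_inner_sub_sub_self] at h5
    have h6 := real_inner_self_nonneg (x := H10.grad x.fst)
    have h7 := real_inner_self_nonneg (x := H10.toL2 x.fst)
    have h8 := real_inner_self_nonneg (x := x.snd)
    linarith
  range := by
    intro l hl z
    set s : ℝ := 1 + l with hs
    have hs0 : 0 < s := by positivity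
    -- For `x = (u, p)` the system is `s u - l p = z₁`, `s p - l Δu = z₂`. Eliminating `u` leaves `p
    -- - (l²/s²) Δp = z₂/s + (l/s²) Δz₁`, where `Δz₁` is a functional on `H¹₀` because `z₁` is only
    -- in `H¹₀`.
    obtain ⟨p, hp⟩ := H10.exists_weak_solution (α := l ^ 2 / s ^ 2) (by positivity)
      (s⁻¹ • (innerSL ℝ z.snd).comp (H10.toL2 (D := D)) -
        (l / s ^ 2) • (innerSL ℝ (H10.grad z.fst)).comp (H10.grad (D := D)))
    let x : WaveSpace D := WithLp.toLp 2 (s⁻¹ • (z.fst + l • p), H10.toL2 p)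
    let y : WaveSpace D := WithLp.toLp 2 (-p, l⁻¹ • (z.snd - s • H10.toL2 p))
    refine ⟨(x, y + (1 : ℝ) • x), add_mem_shiftGraph (mem_waveOperator_graph.2 ⟨?_, ?_⟩), ?_⟩
    · exact map_neg _ _
    · refine mem_negLaplacian_graph_toL2.2 fun φ => ?_
      have := hp φ
      simp only [sub_apply, smul_apply, smul_eq_mul,
        ContinuousLinearMap.comp_apply, innerSL_apply_apply] at this
      change ⟪H10.grad (s⁻¹ • (z.fst + l • p)), H10.grad φ⟫_ℝ =
        ⟪l⁻¹ • (z.snd - s • H10.toL2 p), H10.toL2 φ⟫_ℝ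
      simp only [map_smul, map_add, inner_smul_left, inner_add_left, inner_sub_left,
        conj_trivial]
      field_simp at this ⊢
      linarith
    · change x + l • (y + (1 : ℝ) • x) = z
      have h1 : x + l • (y + (1 : ℝ) • x) = s • x + l • y := by rw [hs]; module
      rw [h1]
      refine (WithLp.equiv 2 _).injective (Prod.ext ?_ ?_)
      · change s • s⁻¹ • (z.fst + l • p) + l • -p = z.fst
        rw [smul_inv_smul₀ hs0.ne']
        module
      · change s • H10.toL2 p + l • l⁻¹ • (z.snd - s • H10.toL2 p) = z.snd
        rw [smul_inv_smul₀ hl.ne']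
        abel
  singleValued := by
    intro y hy
    rw [mem_shiftGraph, smul_zero, sub_zero] at hy
    exact (waveOperator D).graph_fst_eq_zero_snd hy rfl

theorem shiftGraph_zero {H : Type*} [NormedAddCommGroup H] [InnerProductSpace ℝ H]
    (G : Submodule ℝ (H × H)) : shiftGraph G 0 = G := by
  ext ⟨x, y⟩
  rw [mem_shiftGraph, zero_smul, sub_zero]

/-- The orbit of a function in `H¹₀(D)` under the heat semigroup. -/
theorem exists_orbit_negLaplacian (g : H10 D) :
    ∃ v w : ℝ → L2 D, StronglyMeasurable v ∧ StronglyMeasurable w ∧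
      (∀ t, 0 < t → (v t, w t) ∈ (negLaplacian D).graph) ∧
      (∀ t, 0 ≤ t → ‖v t‖ ≤ ‖H10.toL2 g‖) ∧
      (∀ T, 0 ≤ T → MemLp w 2 (volume.restrict (Ioc 0 T))) ∧
      ∀ t, 0 ≤ t → v t = H10.toL2 g - ∫ s in (0 : ℝ)..t, w s := by
  -- For `(u, y)` in the graph, `⟪y, g⟫ = ⟪∇u, ∇g⟫` and `⟪y, u⟫ = ‖∇u‖²`, so Cauchy–Schwarz gives
  -- this constant.
  refine isMaxAccretive_negLaplacian.exists_orbit_of_symm (C := ‖H10.grad g‖ ^ 2) ?_ ?_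
  · rintro ⟨x, y⟩ h ⟨x', y'⟩ h'
    obtain ⟨u, rfl, hu⟩ := mem_negLaplacian_graph.1 h
    obtain ⟨u', rfl, hu'⟩ := mem_negLaplacian_graph.1 h'
    change ⟪y, H10.toL2 u'⟫_ℝ = ⟪H10.toL2 u, y'⟫_ℝ
    rw [← hu, real_inner_comm, hu', real_inner_comm]
  · rintro ⟨x, y⟩ h
    obtain ⟨u, rfl, hu⟩ := mem_negLaplacian_graph.1 h
    change ⟪y, H10.toL2 g⟫_ℝ ^ 2 ≤ ‖H10.grad g‖ ^ 2 * ⟪y, H10.toL2 u⟫_ℝ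
    rw [← hu, ← hu, real_inner_self_eq_norm_sq, ← mul_pow, mul_comm]
    exact sq_le_sq' (neg_le_of_abs_le (abs_real_inner_le_norm _ _)) (real_inner_le_norm _ _)

/-- The orbit of `(0, g)`, `g` in `H¹₀(D)`, under the wave group. -/
theorem exists_orbit_waveOperator (g : H10 D) (T : ℝ) :
    ∃ v w : ℝ → WaveSpace D, StronglyMeasurable v ∧ StronglyMeasurable w ∧
      (∀ t, 0 < t → (v t, w t) ∈ (waveOperator D).graph) ∧
      (∃ M, ∀ t, 0 < t → t ≤ T → ‖v t‖ ≤ M) ∧ (∃ M, ∀ t, 0 < t → t ≤ T → ‖w t‖ ≤ M) ∧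
      ∀ t, 0 ≤ t → v t = WithLp.toLp 2 (0, H10.toL2 g) - ∫ s in (0 : ℝ)..t, w s := by
  set b : WaveSpace D := WithLp.toLp 2 (0, H10.toL2 g) with hb
  set c : WaveSpace D := WithLp.toLp 2 (-g, 0) with hc
  have hbc : (b, c) ∈ (waveOperator D).graph := by
    refine mem_waveOperator_graph.2 ⟨map_neg _ _, ?_⟩
    change (H10.toL2 (0 : H10 D), (0 : L2 D)) ∈ _
    rw [map_zero]
    exact (negLaplacian D).graph.zero_mem
  obtain ⟨v, w, hv, hw, h1, h2⟩ :=
    isMaxAccretive_waveOperator.exists_orbit (add_mem_shiftGraph (κ := 1) hbc)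
  have he : StronglyMeasurable fun t : ℝ => Real.exp (1 * t) :=
    (by fun_prop : Continuous fun t : ℝ => Real.exp (1 * t)).stronglyMeasurable
  -- The factor `exp t` converts the contractive orbit of the shifted operator into the orbit of the
  -- wave operator.
  refine ⟨fun t => Real.exp (1 * t) • v t, fun t => Real.exp (1 * t) • (w t - (1 : ℝ) • v t),
    he.smul hv, he.smul (hw.sub (hv.const_smul (1 : ℝ))), fun t ht => ?_,
    ⟨Real.exp T * ‖b‖, fun t ht htT => ?_⟩,
    ⟨Real.exp T * (‖c + (1 : ℝ) • b‖ + ‖b‖), fun t ht htT => ?_⟩, fun t ht => h2 1 t ht⟩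
  · exact (waveOperator D).graph.smul_mem _ (mem_shiftGraph.1 (h1 t ht.le).1)
  · rw [norm_smul, Real.norm_of_nonneg (Real.exp_pos _).le, one_mul]
    have := (h1 t ht.le).2.1
    gcongr
  · rw [norm_smul, Real.norm_of_nonneg (Real.exp_pos _).le, one_mul, one_smul]
    have h3 := (norm_sub_le (w t) (v t)).trans
      (add_le_add (h1 t ht.le).2.2 (h1 t ht.le).2.1)
    gcongr

theorem MemL2Dom.fst_of_waveOperator {T : ℝ} {x : ℝ → WaveSpace D}
    (h : MemL2Dom (waveOperator D) T x) :
    MemL2Dom (negLaplacian D) T (fun t => H10.toL2 (x t).fst) := by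
  obtain ⟨h1, y, h2, h3⟩ := h
  refine ⟨(H10.toL2.comp (WithLp.fstL 2 ℝ (H10 D) (L2 D))).comp_memLp' h1, fun t => (y t).snd,
    (WithLp.sndL 2 ℝ (H10 D) (L2 D)).comp_memLp' h2, ?_⟩
  filter_upwards [h3] with t ht
  exact (mem_waveOperator_graph.1 ht).2

end Operators

/-! ### The heat and wave equations -/

theorem theorem1p1 {d : ℕ} (hd : 0 < d)
    (D : TopologicalSpace.Opens (EuclideanSpace ℝ (Fin d)))
    (hD : Bornology.IsBounded (D : Set (EuclideanSpace ℝ (Fin d))))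
    {Ω : Type*} {mΩ : MeasurableSpace Ω} (P : Measure Ω) [IsProbabilityMeasure P]
    (ℱ : Filtration ℝ≥0 mΩ) (W : ℝ≥0 → Ω → ℝ) (hW : IsBrownianMotionFor ℱ W P)
    (T : ℝ) (hT : 0 < T)
    (f : ℝ → ℝ) (hf : MemLp f 2 (volume.restrict (Icc 0 T))) (g : H10 D) :
    -- the heat equation
    ((∃ u : ℝ → Ω → L2 D,
        IsStrongSolution (negLaplacian D) (fun t => f t • H10.toL2 g) W P T u ∧
        IsAdaptedOn ℱ P T u) ∧
      (∀ u u' : ℝ → Ω → L2 D,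
        IsStrongSolution (negLaplacian D) (fun t => f t • H10.toL2 g) W P T u →
        IsStrongSolution (negLaplacian D) (fun t => f t • H10.toL2 g) W P T u' →
        AreVersionsOn P T u u') ∧
      (∀ u : ℝ → Ω → L2 D,
        IsStrongSolution (negLaplacian D) (fun t => f t • H10.toL2 g) W P T u →
        ∀ᵐ ω ∂P, MemL2Dom (negLaplacian D) T (fun t => u t ω))) ∧
    -- the wave equation, with `X = (u, ∂ₜu)`
    ((∃ X : ℝ → Ω → WaveSpace D,
        IsStrongSolution (waveOperator D) (fun t => WithLp.toLp 2 (0, f t • H10.toL2 g)) W P T X ∧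
        IsAdaptedOn ℱ P T X) ∧
      (∀ X X' : ℝ → Ω → WaveSpace D,
        IsStrongSolution (waveOperator D) (fun t => WithLp.toLp 2 (0, f t • H10.toL2 g)) W P T X →
        IsStrongSolution (waveOperator D) (fun t => WithLp.toLp 2 (0, f t • H10.toL2 g)) W P T X' →
        AreVersionsOn P T X X') ∧
      (∀ X : ℝ → Ω → WaveSpace D,
        IsStrongSolution (waveOperator D) (fun t => WithLp.toLp 2 (0, f t • H10.toL2 g)) W P T X →
        (∀ t ∈ Icc 0 T, ∀ᵐ ω ∂P, X t ω ∈ (waveOperator D).domain) ∧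
        ∀ᵐ ω ∂P, MemL2Dom (negLaplacian D) T (fun t => H10.toL2 (X t ω).fst))) := by
  lift T to ℝ≥0 using hT.le
  constructor
  · obtain ⟨v, w, hv, hw, h1, h2, h3, h4⟩ := exists_orbit_negLaplacian g
    have hA : IsMaxAccretive (shiftGraph (negLaplacian D).graph 0) := by
      rw [shiftGraph_zero]
      exact isMaxAccretive_negLaplacian
    obtain ⟨k1, k2, k3⟩ := strongSolution_wellPosed hW hA hf hv hw h1
      (fun t ht _ => h2 t ht.le) (h3 T hT.le) h4
    exact ⟨k1, k2, fun u hu => (k3 u hu).1⟩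
  · have hB : (fun t => WithLp.toLp 2 (0, f t • H10.toL2 g) : ℝ → WaveSpace D) =
        fun t => f t • WithLp.toLp 2 (0, H10.toL2 g) := by
      funext t
      rw [← WithLp.toLp_smul, Prod.smul_mk, smul_zero]
    rw [hB]
    obtain ⟨v, w, hv, hw, h1, ⟨M, h2⟩, ⟨M', h3⟩, h4⟩ := exists_orbit_waveOperator g T
    have hw2 : MemLp w 2 (volume.restrict (Ioc 0 (T : ℝ))) := by
      refine MemLp.of_bound hw.aestronglyMeasurable M' ?_
      filter_upwards [ae_restrict_mem measurableSet_Ioc] with t ht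
      exact h3 t ht.1 ht.2
    obtain ⟨k1, k2, k3⟩ :=
      strongSolution_wellPosed hW isMaxAccretive_waveOperator hf hv hw h1 h2 hw2 h4
    refine ⟨k1, k2, fun X hX => ⟨(k3 X hX).2 ⟨M', h3⟩, ?_⟩⟩
    filter_upwards [(k3 X hX).1] with ω hω
    exact hω.fst_of_waveOperator
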